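/- Let $\Sigma$ be a finite ordered alphabet of size $\sigma$, and let $T[1,n]\in\Sigma^n$, with $n\ge 2$ and $\sigma\le n$, be a text: $T[n]=\$$ is the smallest letter of $\Sigma$ and occurs nowhere else in $T$. A substring $T[i,j]$ ($j\ge i-1$) is right-maximal if $j=n$ or if $T[i,j]\,a$ and $T[i,j]\,b$ are substrings of $T$ for two distinct letters $a\neq b$. A set $S\subseteq\{1,\dots,n\}$ is suffixient for $T$ if for all $1\le i\le j\le n$ with $T[i,j-1]$ right-maximal there is $x\in S$ such that $T[i,j]$ is a suffix of $T[1,x]$. Let $\overleftarrow T=T[n-1]\cdots T[1]\,\$$. Let $\mathrm{SA}[1,n]$ be its suffix array (the permutation of $\{1,\dots,n\}$ that lists the suffixes of $\overleftarrow T$ in increasing lexicographic order), let $\mathrm{LCP}[i]$, $2\le i\le n$, be the length of the longest common prefix of the suffixes of $\overleftarrow T$ starting at $\mathrm{SA}[i-1]$ and $\mathrm{SA}[i]$, and let $\mathrm{BWT}[i]=\overleftarrow T[\mathrm{SA}[i]-1]$, where $\overleftarrow T[0]=\overleftarrow T[n]$. Identify $\Sigma$ with $\{1,\dots,\sigma\}$,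 and consider the following algorithm. 1. Compute $\mathrm{BWT}$, $\mathrm{LCP}$, $\mathrm{SA}$ of $\overleftarrow T$. Set $S\gets\emptyset$, $R[c]\gets(-1,0,\mathrm{false})$ for $c=1,\dots,\sigma$ (the components of $R[c]$ are called $len$, $pos$, $active$), and $m\gets\infty$. 2. Set $\mathrm{LF}[1]\gets 0$ and $\mathrm{LF}[c]\gets \mathrm{LF}[c-1]+occ(T,c-1)$ for $c=2,\dots,\sigma$, where $occ(T,c)$ is the number of occurrences of $c$ in $T$; then increment $\mathrm{LF}[\mathrm{BWT}[1]]$ by $1$. 3. For $i=2,\dots,n$: increment $\mathrm{LF}[\mathrm{BWT}[i]]$ by $1$ and set $m\gets\min\{m,\mathrm{LCP}[i]\}$. If $\mathrm{BWT}[i]\ne\mathrm{BWT}[i-1]$, then do the following for $i'=i-1$ and then for $i'=i$, with $c=\mathrm{BWT}[i']$: if $i'=i-1$, call $eval(c,m)$; if $i'=i$ and $R[c].len\neq-1$, call $eval(c,\mathrm{LCP}[\mathrm{LF}[c]]-1)$; after that, if $\mathrm{LCP}[i]>R[c].len$, set $R[c]\gets(\mathrm{LCP}[i],\,n-\mathrm{SA}[i']+1,\,\mathrm{true})$.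 When both values of $i'$ have been processed, set $m\gets\infty$. 4. Call $eval(c,-1)$ for $c=1,\dots,\sigma$, and return $S$. Here $eval(c,l)$ does the following if $l<R[c].len$, and nothing otherwise: if $R[c].active$, insert $R[c].pos$ into $S$; then set $R[c]\gets(l,0,\mathrm{false})$. Then, on a unit-cost random access machine with words of $O(\log n)$ bits, the arrays in step 1 can be computed in $O(n)$ time and $O(n)$ words of space, and, with any such implementation of step 1, the algorithm computes from $T$ a suffixient set $S$ for $T$ of smallest cardinality in $O(n)$ time and $O(n)$ words of space. The constants in the $O(\cdot)$ depend only on the implementation of step 1, not on $T$ or $\Sigma$. -/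

import Mathlib

universe u

/-! ## Strings, texts and suffixient sets (positions are 1-based) -/

namespace Suffixient

section Strings

variable {A : Type*}

/-- The substring `T[i,j]` (empty if `j < i`), for `1 ≤ i`. -/
def sub (T : List A) (i j : ℕ) : List A := (T.take j).drop (i - 1)

/-- The character `T[i]` for `1 ≤ i ≤ |T|`, with the cyclic convention `T[0] = T[|T|]`. -/
def charAt (T : List A) (i : ℕ) : Option A := if i = 0 then T.getLast? else T[i - 1]?

/-- A text of length at least two: it ends with the smallest letter of the alphabet, which occurs
nowhere else in it. -/
def IsText [LinearOrder A] (T : List A) : Prop :=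
  ∃ (w : List A) (d : A), T = w ++ [d] ∧ w ≠ [] ∧ d ∉ w ∧ ∀ a : A, d ≤ a

/-- The reverse `T[n-1] ⋯ T[1] $` of a text `T = T[1] ⋯ T[n-1] $`: the end marker stays last. -/
def revText (T : List A) : List A := T.dropLast.reverse ++ T.getLast?.toList

/-- `T[i,j]` is right-maximal. -/
def IsRightMaximal (T : List A) (i j : ℕ) : Prop :=
  j = T.length ∨ ∃ a b : A, a ≠ b ∧ (sub T i j ++ [a]) <:+: T ∧ (sub T i j ++ [b]) <:+: T

/-- `S ⊆ [n]` is suffixient for `T[1,n]`: every one-character right-extension `T[i,j]` of a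
right-maximal `T[i,j-1]` is a suffix of `T[1,x]` for some `x ∈ S`. -/
def IsSuffixient (T : List A) (S : Finset ℕ) : Prop :=
  S ⊆ Finset.Icc 1 T.length ∧
  ∀ i j : ℕ, 1 ≤ i → i ≤ j → j ≤ T.length → IsRightMaximal T i (j - 1) →
    ∃ x ∈ S, sub T i j <:+ T.take x

/-- `S` is a suffixient set of smallest cardinality. -/
def IsSmallestSuffixient (T : List A) (S : Finset ℕ) : Prop :=
  IsSuffixient T S ∧ ∀ S' : Finset ℕ, IsSuffixient T S' → S.card ≤ S'.card

/-- `sa` is the suffix array of `R[1,n]`: a permutation of `[n]` that lists the suffixes of `R` in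
increasing lexicographic order. -/
def IsSuffixArray [LinearOrder A] (R : List A) (sa : ℕ → ℕ) : Prop :=
  Set.BijOn sa (Set.Icc 1 R.length) (Set.Icc 1 R.length) ∧
  ∀ i j : ℕ, 1 ≤ i → i < j → j ≤ R.length → R.drop (sa i - 1) < R.drop (sa j - 1)

/-- Length of the longest common prefix of two strings. -/
def lcpLen [DecidableEq A] : List A → List A → ℕ
  | a :: u, b :: v => if a = b then lcpLen u v + 1 else 0
  | _, _ => 0

/-- `LCP[i]`, for `2 ≤ i ≤ n`, where `sa` is the suffix array of `R`. -/
def lcpArray [DecidableEq A] (R : List A) (sa : ℕ → ℕ) (i : ℕ) : ℕ :=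
  lcpLen (R.drop (sa i - 1)) (R.drop (sa (i - 1) - 1))

/-- `BWT[i] = R[SA[i] - 1]`, for `1 ≤ i ≤ n`, where `sa` is the suffix array of `R`. -/
def bwtArray (R : List A) (sa : ℕ → ℕ) (i : ℕ) : Option A := charAt R (sa i - 1)

/-- The number in `{1, …, σ}` by which a machine represents a letter: its rank in the alphabet. -/
def rank [Fintype A] [LinearOrder A] (c : A) : ℤ := ((Finset.univ.filter (· ≤ c)).card : ℤ)

/-- Rank of a letter, and `0` for "no letter". -/
def code [Fintype A] [LinearOrder A] (c : Option A) : ℤ := c.elim 0 rank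

end Strings

/-! ## A unit-cost random access machine

Programs manipulate integer registers and integer arrays, both named by natural numbers.
A program mentions only finitely many of them. The parameter `W` bounds the absolute value of every
number that the machine may handle (so a word has about `log₂ W` bits); a computation which would
exceed this bound, or access an array out of bounds, has no execution. -/

inductive Expr : Type
  | lit (z : ℤ)
  | var (x : ℕ)
  | get (a : ℕ) (i : Expr)
  | add (e f : Expr)
  | sub (e f : Expr)
  | mul (e f : Expr)
  | div (e f : Expr)
  | mod (e f : Expr)

inductive Cond : Type
  | lt (e f : Expr)
  | le (e f : Expr)
  | eq (e f : Expr)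
  | not (b : Cond)
  | and (b c : Cond)

inductive Cmd : Type
  | skip
  | assign (x : ℕ) (e : Expr)
  | put (a : ℕ) (i e : Expr)
  | alloc (a : ℕ) (k : Expr)
  | seq (c d : Cmd)
  | ite (b : Cond) (c d : Cmd)
  | while (b : Cond) (c : Cmd)

/-- A machine state. Array `a` has the cells `0, …, size a - 1`. `used` is the number of array
words allocated so far, the input included; memory is never given back, so `used` bounds the memory
occupied at any earlier moment, apart from the fixed finite number of registers of the program. -/
structure Store : Type where
  var : ℕ → ℤ
  size : ℕ → ℕ
  arr : ℕ → ℤ → ℤ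
  used : ℕ

namespace Store

def setVar (s : Store) (x : ℕ) (v : ℤ) : Store :=
  { s with var := Function.update s.var x v }

def setCell (s : Store) (a : ℕ) (i v : ℤ) : Store :=
  { s with arr := Function.update s.arr a (Function.update (s.arr a) i v) }

/-- Bind the name `a` to a new array of `k` cells, all zero. -/
def newArray (s : Store) (a k : ℕ) : Store :=
  { s with
    size := Function.update s.size a k
    arr := Function.update s.arr a (fun _ => 0)
    used := s.used + k }

end Store

/-- A number that fits in a machine word. -/
def fit (W : ℕ) (v : ℤ) : Option ℤ := if |v| ≤ (W : ℤ) then some v else none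

namespace Expr

/-- Value of an expression. Division and remainder are those of `ℤ`. -/
def eval (W : ℕ) (s : Store) : Expr → Option ℤ
  | lit z => fit W z
  | var x => fit W (s.var x)
  | get a i => (eval W s i).bind fun k =>
      if 0 ≤ k ∧ k < (s.size a : ℤ) then fit W (s.arr a k) else none
  | add e f => (eval W s e).bind fun u => (eval W s f).bind fun v => fit W (u + v)
  | sub e f => (eval W s e).bind fun u => (eval W s f).bind fun v => fit W (u - v)
  | mul e f => (eval W s e).bind fun u => (eval W s f).bind fun v => fit W (u * v)
  | div e f => (eval W s e).bind fun u => (eval W s f).bind fun v => fit W (u / v)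
  | mod e f => (eval W s e).bind fun u => (eval W s f).bind fun v => fit W (u % v)

/-- Evaluation time: one unit per node. -/
def cost : Expr → ℕ
  | lit _ => 1
  | var _ => 1
  | get _ i => i.cost + 1
  | add e f => e.cost + f.cost + 1
  | sub e f => e.cost + f.cost + 1
  | mul e f => e.cost + f.cost + 1
  | div e f => e.cost + f.cost + 1
  | mod e f => e.cost + f.cost + 1

end Expr

namespace Cond

def eval (W : ℕ) (s : Store) : Cond → Option Bool
  | lt e f => (e.eval W s).bind fun u => (f.eval W s).bind fun v => some (decide (u < v))
  | le e f => (e.eval W s).bind fun u => (f.eval W s).bind fun v => some (decide (u ≤ v))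
  | eq e f => (e.eval W s).bind fun u => (f.eval W s).bind fun v => some (decide (u = v))
  | not b => (eval W s b).map fun p => !p
  | and b c => (eval W s b).bind fun p => (eval W s c).map fun q => p && q

def cost : Cond → ℕ
  | lt e f => e.cost + f.cost + 1
  | le e f => e.cost + f.cost + 1
  | eq e f => e.cost + f.cost + 1
  | not b => b.cost + 1
  | and b c => b.cost + c.cost + 1

end Cond

/-- `Exec W c s t s'`: with words bounded by `W`, the program `c` started in `s` halts in `s'` after
exactly `t` time units. For given `W`, `c`, `s` there is at most one such pair `(t, s')`.
Allocating `k` cells takes time `k` on top of the evaluation of `k`. -/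
inductive Exec (W : ℕ) : Cmd → Store → ℕ → Store → Prop
  | skip (s : Store) : Exec W Cmd.skip s 1 s
  | assign (s : Store) (x : ℕ) (e : Expr) (v : ℤ) (he : e.eval W s = some v) :
      Exec W (Cmd.assign x e) s (e.cost + 1) (s.setVar x v)
  | put (s : Store) (a : ℕ) (i e : Expr) (k v : ℤ) (hi : i.eval W s = some k)
      (he : e.eval W s = some v) (h0 : 0 ≤ k) (hk : k < (s.size a : ℤ)) :
      Exec W (Cmd.put a i e) s (i.cost + e.cost + 1) (s.setCell a k v)
  | alloc (s : Store) (a : ℕ) (e : Expr) (k : ℕ) (he : e.eval W s = some (k : ℤ)) :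
      Exec W (Cmd.alloc a e) s (e.cost + k + 1) (s.newArray a k)
  | seq (s s₁ s₂ : Store) (c d : Cmd) (t₁ t₂ : ℕ) (hc : Exec W c s t₁ s₁)
      (hd : Exec W d s₁ t₂ s₂) : Exec W (Cmd.seq c d) s (t₁ + t₂) s₂
  | ite_true (s s₁ : Store) (b : Cond) (c d : Cmd) (t : ℕ) (hb : b.eval W s = some true)
      (hc : Exec W c s t s₁) : Exec W (Cmd.ite b c d) s (b.cost + t + 1) s₁
  | ite_false (s s₁ : Store) (b : Cond) (c d : Cmd) (t : ℕ) (hb : b.eval W s = some false)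
      (hd : Exec W d s t s₁) : Exec W (Cmd.ite b c d) s (b.cost + t + 1) s₁
  | while_false (s : Store) (b : Cond) (c : Cmd) (hb : b.eval W s = some false) :
      Exec W (Cmd.while b c) s (b.cost + 1) s
  | while_true (s s₁ s₂ : Store) (b : Cond) (c : Cmd) (t₁ t₂ : ℕ) (hb : b.eval W s = some true)
      (hc : Exec W c s t₁ s₁) (hw : Exec W (Cmd.while b c) s₁ t₂ s₂) :
      Exec W (Cmd.while b c) s (b.cost + t₁ + t₂ + 1) s₂

/-! ## The algorithm -/

/-- Register holding the text length `n`. -/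
def xN : ℕ := 0
/-- Register holding the alphabet size `σ`. -/
def xSigma : ℕ := 1
/-- Register for the scan position `i`. -/
def xI : ℕ := 2
/-- Register for `i' ∈ {i - 1, i}`. -/
def xK : ℕ := 3
/-- Register for the current letter. -/
def xC : ℕ := 4
/-- Register for the length passed to `eval`. -/
def xL : ℕ := 5
/-- Register for the minimum of `LCP` inside the current run. -/
def xM : ℕ := 6

def aT : ℕ := 0
def aSA : ℕ := 1
def aLCP : ℕ := 2
def aBWT : ℕ := 3
/-- Characteristic array of the output set: `x` is in the set iff cell `x` is `1`. -/
def aS : ℕ := 4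
/-- `R[c].len` -/
def aLen : ℕ := 5
/-- `R[c].pos` -/
def aPos : ℕ := 6
/-- `R[c].active`, `1` for true and `0` for false -/
def aAct : ℕ := 7
def aLF : ℕ := 8
/-- `occ(T, c)` -/
def aOcc : ℕ := 9

namespace Cmd

/-- Sequential composition of a list of commands. -/
def block : List Cmd → Cmd
  | [] => skip
  | [c] => c
  | c :: cs => seq c (block cs)

/-- `for x = lo, …, hi do c`. -/
def forUp (x : ℕ) (lo hi : Expr) (c : Cmd) : Cmd :=
  block [assign x lo,
    Cmd.while (.le (.var x) hi) (block [c, assign x (.add (.var x) (.lit 1))])]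

/-- `if b then c`. -/
def whenever (b : Cond) (c : Cmd) : Cmd := ite b c skip

/-- `a[i] ← a[i] + 1`. -/
def incr (a : ℕ) (i : Expr) : Cmd := put a i (.add (.get a i) (.lit 1))

end Cmd

open Cmd in
/-- The procedure `eval({c}, l, R, S)`, with `c` and `l` in their registers:
if `l < R[c].len` then, if `R[c].active`, insert `R[c].pos` into `S`; and set
`R[c] ← (l, 0, false)`. -/
def evalCand : Cmd :=
  whenever (.lt (.var xL) (.get aLen (.var xC))) (block [
    whenever (.eq (.get aAct (.var xC)) (.lit 1)) (put aS (.get aPos (.var xC)) (.lit 1)),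
    put aLen (.var xC) (.var xL),
    put aPos (.var xC) (.lit 0),
    put aAct (.var xC) (.lit 0)])

/-- A number exceeding every `LCP` value, in the role of `∞`. -/
def infinity : Expr := .add (.var xN) (.lit 1)

open Cmd in
/-- The body of the loop over `i' ∈ {i - 1, i}` at a run break `i`. -/
def processCand : Cmd := block [
  assign xC (.get aBWT (.var xK)),
  ite (.eq (.var xK) (.sub (.var xI) (.lit 1)))
    (block [assign xL (.var xM), evalCand])
    (whenever (.not (.eq (.get aLen (.var xC)) (.lit (-1))))
      (block [assign xL (.sub (.get aLCP (.get aLF (.var xC))) (.lit 1)), evalCand])),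
  whenever (.lt (.get aLen (.var xC)) (.get aLCP (.var xI))) (block [
    put aLen (.var xC) (.get aLCP (.var xI)),
    put aPos (.var xC) (.add (.sub (.var xN) (.get aSA (.var xK))) (.lit 1)),
    put aAct (.var xC) (.lit 1)])]

open Cmd in
/-- The linear-time algorithm, where `prep` is the program which computes the arrays `BWT`, `LCP`
and `SA` of the reversed text. -/
def linearTimeAlgorithm (prep : Cmd) : Cmd := block [
  prep,
  -- the empty set
  alloc aS (.add (.var xN) (.lit 1)),
  -- `R[1,σ] ← ((-1, 0, false), …, (-1, 0, false))`
  alloc aLen (.add (.var xSigma) (.lit 1)),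
  alloc aPos (.add (.var xSigma) (.lit 1)),
  alloc aAct (.add (.var xSigma) (.lit 1)),
  forUp xC (.lit 1) (.var xSigma) (put aLen (.var xC) (.lit (-1))),
  -- `LF[1] ← 0` and `LF[c] ← LF[c-1] + occ(T, c-1)` for `c = 2, …, σ`
  alloc aLF (.add (.var xSigma) (.lit 1)),
  alloc aOcc (.add (.var xSigma) (.lit 1)),
  assign xM infinity,
  forUp xI (.lit 1) (.var xN) (incr aOcc (.get aT (.var xI))),
  forUp xC (.lit 2) (.var xSigma)
    (put aLF (.var xC) (.add (.get aLF (.sub (.var xC) (.lit 1)))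
      (.get aOcc (.sub (.var xC) (.lit 1))))),
  incr aLF (.get aBWT (.lit 1)),
  -- the scan
  forUp xI (.lit 2) (.var xN) (block [
    incr aLF (.get aBWT (.var xI)),
    whenever (.lt (.get aLCP (.var xI)) (.var xM)) (assign xM (.get aLCP (.var xI))),
    whenever (.not (.eq (.get aBWT (.var xI)) (.get aBWT (.sub (.var xI) (.lit 1))))) (block [
      assign xK (.sub (.var xI) (.lit 1)),
      processCand,
      assign xK (.var xI),
      processCand,
      assign xM infinity])]),
  -- `eval(Σ, -1, R, S)`
  forUp xC (.lit 1) (.var xSigma) (block [assign xL (.lit (-1)), evalCand])]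

/-! ## Input, output, and the specification of the preprocessing -/

section Spec

variable {A : Type*}

/-- The initial state on input `T[1,n]`: the text in cells `1, …, n` of its array, `n` and `σ` in
their registers; all other registers are zero and all other arrays are empty. -/
def inputStore [Fintype A] [LinearOrder A] (T : List A) : Store where
  var := Function.update (Function.update (fun _ => 0) xN (T.length : ℤ)) xSigma
    (Fintype.card A : ℤ)
  size := Function.update (fun _ => 0) aT (T.length + 1)
  arr := Function.update (fun _ _ => 0) aT
    (fun i => if 1 ≤ i then code T[(i - 1).toNat]? else 0)
  used := T.length + 1

/-- The cells `lo, …, n` of array `a` exist and hold `f lo, …, f n`. -/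
def Holds (s : Store) (a lo n : ℕ) (f : ℕ → ℤ) : Prop :=
  n < s.size a ∧ ∀ i : ℕ, lo ≤ i → i ≤ n → s.arr a (i : ℤ) = f i

/-- The set of positions in `[n]` stored in the output array. -/
def outputSet (n : ℕ) (s : Store) : Finset ℕ :=
  (Finset.Icc 1 n).filter (fun x => s.arr aS (x : ℤ) = 1)

/-- `s` holds the text `T`, its length and the alphabet size, and the arrays `SA`, `LCP[2,n]` and
`BWT` of the reversed text. -/
def HoldsArrays [Fintype A] [LinearOrder A] (T : List A) (s : Store) : Prop :=
  s.var xN = T.length ∧ s.var xSigma = Fintype.card A ∧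
  Holds s aT 1 T.length (fun i => code (charAt T i)) ∧
  ∃ sa : ℕ → ℕ, IsSuffixArray (revText T) sa ∧
    Holds s aSA 1 T.length (fun i => (sa i : ℤ)) ∧
    Holds s aLCP 2 T.length (fun i => (lcpArray (revText T) sa i : ℤ)) ∧
    Holds s aBWT 1 T.length (fun i => code (bwtArray (revText T) sa i))

end Spec

/-- `c` on input `T`, `|T| = n`, halts within `C * n` time and `C * n` words of memory, with words
of `O(log n)` bits (numbers up to `n ^ C` in absolute value), in a state satisfying `post`. -/
def RunsLinearly (C : ℕ) (c : Cmd) {A : Type u} [Fintype A] [LinearOrder A] (T : List A)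
    (post : Store → Prop) : Prop :=
  ∃ (t : ℕ) (s : Store), Exec (T.length ^ C) c (inputStore T) t s ∧
    t ≤ C * T.length ∧ s.used ≤ C * T.length ∧ post s

/-- `prep` computes `SA`, `LCP` and `BWT` of the reversed text in linear time and space, for all
texts of length `n` over alphabets of size `σ ≤ n`. -/
def BuildsArrays (prep : Cmd) : Prop :=
  ∃ C : ℕ, ∀ (A : Type u) [Fintype A] [LinearOrder A] (T : List A),
    IsText T → Fintype.card A ≤ T.length → RunsLinearly C prep T (HoldsArrays T)

end Suffixient

namespace Suffixient

/-! ## Program logic for the random access machine -/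

/-- Value of an expression, disregarding word size and array bounds. -/
@[simp] def Expr.val (s : Store) : Expr → ℤ
  | .lit z => z
  | .var x => s.var x
  | .get a i => s.arr a (i.val s)
  | .add e f => e.val s + f.val s
  | .sub e f => e.val s - f.val s
  | .mul e f => e.val s * f.val s
  | .div e f => e.val s / f.val s
  | .mod e f => e.val s % f.val s

/-- The evaluation of the expression respects word size and array bounds. -/
@[simp] def Expr.ok (W : ℕ) (s : Store) : Expr → Prop
  | .lit z => -(W : ℤ) ≤ z ∧ z ≤ W
  | .var x => -(W : ℤ) ≤ s.var x ∧ s.var x ≤ W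
  | .get a i => i.ok W s ∧ (0 ≤ i.val s ∧ i.val s < s.size a) ∧
      -(W : ℤ) ≤ s.arr a (i.val s) ∧ s.arr a (i.val s) ≤ W
  | .add e f => e.ok W s ∧ f.ok W s ∧ -(W : ℤ) ≤ e.val s + f.val s ∧ e.val s + f.val s ≤ W
  | .sub e f => e.ok W s ∧ f.ok W s ∧ -(W : ℤ) ≤ e.val s - f.val s ∧ e.val s - f.val s ≤ W
  | .mul e f => e.ok W s ∧ f.ok W s ∧ -(W : ℤ) ≤ e.val s * f.val s ∧ e.val s * f.val s ≤ W
  | .div e f => e.ok W s ∧ f.ok W s ∧ -(W : ℤ) ≤ e.val s / f.val s ∧ e.val s / f.val s ≤ W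
  | .mod e f => e.ok W s ∧ f.ok W s ∧ -(W : ℤ) ≤ e.val s % f.val s ∧ e.val s % f.val s ≤ W

theorem fit_eq_some_iff {W : ℕ} {v u : ℤ} :
    fit W v = some u ↔ (-(W : ℤ) ≤ v ∧ v ≤ W) ∧ u = v := by
  unfold fit
  split_ifs with h
  · simp [abs_le.1 h, eq_comm]
  · simp only [false_iff]
    rw [abs_le] at h
    tauto

theorem Expr.eval_eq_some_iff {W : ℕ} {s : Store} (e : Expr) {u : ℤ} :
    e.eval W s = some u ↔ e.ok W s ∧ u = e.val s := by
  induction e generalizing u with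
  | lit z => simp [Expr.eval, fit_eq_some_iff]
  | var x => simp [Expr.eval, fit_eq_some_iff]
  | get a i ih =>
    simp only [Expr.eval, Option.bind_eq_some_iff, ih, Expr.ok, Expr.val]
    constructor
    · rintro ⟨k, ⟨h1, rfl⟩, h⟩
      split_ifs at h with hk
      rw [fit_eq_some_iff] at h
      exact ⟨⟨h1, hk, h.1⟩, h.2⟩
    · rintro ⟨⟨h1, hk, h⟩, rfl⟩
      refine ⟨_, ⟨h1, rfl⟩, ?_⟩
      rw [if_pos hk, fit_eq_some_iff]
      exact ⟨h, rfl⟩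
  | add e f ihe ihf | sub e f ihe ihf | mul e f ihe ihf | div e f ihe ihf | mod e f ihe ihf =>
    simp only [Expr.eval, Option.bind_eq_some_iff, ihe, ihf, fit_eq_some_iff, Expr.ok, Expr.val]
    constructor
    · rintro ⟨k, ⟨h1, rfl⟩, l, ⟨h2, rfl⟩, h, rfl⟩
      exact ⟨⟨h1, h2, h⟩, rfl⟩
    · rintro ⟨⟨h1, h2, h⟩, rfl⟩
      exact ⟨_, ⟨h1, rfl⟩, _, ⟨h2, rfl⟩, h, rfl⟩

/-- Truth of a condition, disregarding word size and array bounds. -/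
@[simp] def Cond.holds (s : Store) : Cond → Prop
  | .lt e f => e.val s < f.val s
  | .le e f => e.val s ≤ f.val s
  | .eq e f => e.val s = f.val s
  | .not b => ¬ b.holds s
  | .and b c => b.holds s ∧ c.holds s

/-- The evaluation of the condition respects word size and array bounds. -/
@[simp] def Cond.ok (W : ℕ) (s : Store) : Cond → Prop
  | .lt e f => e.ok W s ∧ f.ok W s
  | .le e f => e.ok W s ∧ f.ok W s
  | .eq e f => e.ok W s ∧ f.ok W s
  | .not b => b.ok W s
  | .and b c => b.ok W s ∧ c.ok W s

theorem Cond.eval_eq_some_iff {W : ℕ} {s : Store} (b : Cond) {p : Bool} :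
    b.eval W s = some p ↔ b.ok W s ∧ (p = true ↔ b.holds s) := by
  induction b generalizing p with
  | lt e f | le e f | eq e f =>
    simp only [Cond.eval, Option.bind_eq_some_iff, Expr.eval_eq_some_iff, Cond.ok, Cond.holds]
    constructor
    · rintro ⟨k, ⟨h1, rfl⟩, l, ⟨h2, rfl⟩, h⟩
      rw [← Option.some.inj h]
      exact ⟨⟨h1, h2⟩, decide_eq_true_iff⟩
    · rintro ⟨⟨h1, h2⟩, h⟩
      refine ⟨_, ⟨h1, rfl⟩, _, ⟨h2, rfl⟩, ?_⟩
      rw [Option.some.injEq, Bool.eq_iff_iff, h, decide_eq_true_iff]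
  | not b ih =>
    simp only [Cond.eval, Option.map_eq_some_iff, ih, Cond.ok, Cond.holds]
    constructor
    · rintro ⟨k, ⟨h1, h2⟩, rfl⟩
      refine ⟨h1, ?_⟩
      rw [← h2]
      simp
    · rintro ⟨h1, h⟩
      refine ⟨!p, ⟨h1, ?_⟩, by simp⟩
      cases p <;> simp_all
  | and b c ihb ihc =>
    simp only [Cond.eval, Option.bind_eq_some_iff, Option.map_eq_some_iff, ihb, ihc, Cond.ok,
      Cond.holds]
    constructor
    · rintro ⟨k, ⟨h1, h3⟩, l, ⟨h2, h4⟩, rfl⟩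
      refine ⟨⟨h1, h2⟩, ?_⟩
      rw [← h3, ← h4, Bool.and_eq_true]
    · rintro ⟨⟨h1, h2⟩, h⟩
      classical
      refine ⟨decide (b.holds s), ⟨h1, decide_eq_true_iff⟩, decide (c.holds s),
        ⟨h2, decide_eq_true_iff⟩, ?_⟩
      rw [Bool.eq_iff_iff, h]
      simp

theorem Cond.eval_true {W : ℕ} {s : Store} {b : Cond} (h : b.ok W s) (hb : b.holds s) :
    b.eval W s = some true := (b.eval_eq_some_iff).2 ⟨h, by simp [hb]⟩

theorem Cond.eval_false {W : ℕ} {s : Store} {b : Cond} (h : b.ok W s) (hb : ¬ b.holds s) :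
    b.eval W s = some false := (b.eval_eq_some_iff).2 ⟨h, by simp [hb]⟩

/-- The program halts in a state satisfying `Q`. -/
def Ter (W : ℕ) (c : Cmd) (s : Store) (Q : Store → Prop) : Prop :=
  ∃ t s', Exec W c s t s' ∧ Q s'

/-- The program halts within time `B` in a state satisfying `Q`. -/
def Run (W : ℕ) (c : Cmd) (s : Store) (B : ℕ) (Q : Store → Prop) : Prop :=
  ∃ t s', Exec W c s t s' ∧ t ≤ B ∧ Q s'

theorem Ter.mono {W : ℕ} {c : Cmd} {s : Store} {Q Q' : Store → Prop} (h : Ter W c s Q)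
    (hQ : ∀ s', Q s' → Q' s') : Ter W c s Q' :=
  let ⟨t, s', h1, h2⟩ := h
  ⟨t, s', h1, hQ _ h2⟩

theorem Run.mono {W : ℕ} {c : Cmd} {s : Store} {B B' : ℕ} {Q Q' : Store → Prop}
    (h : Run W c s B Q) (hB : B ≤ B') (hQ : ∀ s', Q s' → Q' s') : Run W c s B' Q' :=
  let ⟨t, s', h1, h2, h3⟩ := h
  ⟨t, s', h1, h2.trans hB, hQ _ h3⟩

theorem Run.seq {W : ℕ} {c d : Cmd} {s : Store} {B B' : ℕ} {Q : Store → Prop}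
    (h : Run W c s B (fun s' => Run W d s' B' Q)) : Run W (.seq c d) s (B + B') Q :=
  let ⟨_, _, h1, h2, _, _, h3, h4, h5⟩ := h
  ⟨_, _, .seq _ _ _ _ _ _ _ h1 h3, Nat.add_le_add h2 h4, h5⟩

@[simp] theorem Ter_skip {W : ℕ} {s : Store} {Q : Store → Prop} : Ter W .skip s Q ↔ Q s := by
  constructor
  · rintro ⟨t, s', h, hQ⟩
    cases h
    exact hQ
  · exact fun h => ⟨_, _, .skip s, h⟩

@[simp] theorem Ter_assign {W : ℕ} {s : Store} {x : ℕ} {e : Expr} {Q : Store → Prop} :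
    Ter W (.assign x e) s Q ↔ e.ok W s ∧ Q (s.setVar x (e.val s)) := by
  constructor
  · rintro ⟨t, s', h, hQ⟩
    cases h with
    | assign _ _ _ v he =>
      rw [Expr.eval_eq_some_iff] at he
      obtain ⟨h1, rfl⟩ := he
      exact ⟨h1, hQ⟩
  · exact fun h => ⟨_, _, .assign s x e _ (e.eval_eq_some_iff.2 ⟨h.1, rfl⟩), h.2⟩

@[simp] theorem Ter_put {W : ℕ} {s : Store} {a : ℕ} {i e : Expr} {Q : Store → Prop} :
    Ter W (.put a i e) s Q ↔ i.ok W s ∧ e.ok W s ∧ (0 ≤ i.val s ∧ i.val s < s.size a) ∧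
      Q (s.setCell a (i.val s) (e.val s)) := by
  constructor
  · rintro ⟨t, s', h, hQ⟩
    cases h with
    | put _ _ _ _ k v hi he h0 hk =>
      rw [Expr.eval_eq_some_iff] at he hi
      obtain ⟨h1, rfl⟩ := he
      obtain ⟨h2, rfl⟩ := hi
      exact ⟨h2, h1, ⟨h0, hk⟩, hQ⟩
  · exact fun h => ⟨_, _, .put s a i e _ _ (i.eval_eq_some_iff.2 ⟨h.1, rfl⟩)
      (e.eval_eq_some_iff.2 ⟨h.2.1, rfl⟩) h.2.2.1.1 h.2.2.1.2, h.2.2.2⟩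

@[simp] theorem Ter_seq {W : ℕ} {s : Store} {c d : Cmd} {Q : Store → Prop} :
    Ter W (.seq c d) s Q ↔ Ter W c s (fun s' => Ter W d s' Q) := by
  constructor
  · rintro ⟨t, s', h, hQ⟩
    cases h with
    | seq _ _ _ _ _ _ _ hc hd => exact ⟨_, _, hc, _, _, hd, hQ⟩
  · rintro ⟨_, _, hc, _, _, hd, hQ⟩
    exact ⟨_, _, .seq _ _ _ _ _ _ _ hc hd, hQ⟩

@[simp] theorem Ter_ite {W : ℕ} {s : Store} {b : Cond} {c d : Cmd} {Q : Store → Prop} :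
    Ter W (.ite b c d) s Q ↔
      b.ok W s ∧ (b.holds s → Ter W c s Q) ∧ (¬ b.holds s → Ter W d s Q) := by
  constructor
  · rintro ⟨t, s', h, hQ⟩
    cases h with
    | ite_true _ _ _ _ _ _ hb hc =>
      rw [Cond.eval_eq_some_iff] at hb
      have := hb.2.1 rfl
      exact ⟨hb.1, fun _ => ⟨_, _, hc, hQ⟩, fun h => absurd this h⟩
    | ite_false _ _ _ _ _ _ hb hc =>
      rw [Cond.eval_eq_some_iff] at hb
      have : ¬ b.holds s := fun h => by simpa using hb.2.2 h
      exact ⟨hb.1, fun h => absurd h this, fun _ => ⟨_, _, hc, hQ⟩⟩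
  · rintro ⟨h1, h2, h3⟩
    by_cases hb : b.holds s
    · obtain ⟨_, _, hc, hQ⟩ := h2 hb
      exact ⟨_, _, .ite_true _ _ _ _ _ _ (Cond.eval_true h1 hb) hc, hQ⟩
    · obtain ⟨_, _, hc, hQ⟩ := h3 hb
      exact ⟨_, _, .ite_false _ _ _ _ _ _ (Cond.eval_false h1 hb) hc, hQ⟩

/-! ### Effects of a program -/

/-- Registers written by a program. -/
def Cmd.wv : Cmd → List ℕ
  | .assign x _ => [x]
  | .seq c d => c.wv ++ d.wv
  | .ite _ c d => c.wv ++ d.wv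
  | .while _ c => c.wv
  | _ => []

/-- Arrays written by a program. -/
def Cmd.wa : Cmd → List ℕ
  | .put a _ _ => [a]
  | .alloc a _ => [a]
  | .seq c d => c.wa ++ d.wa
  | .ite _ c d => c.wa ++ d.wa
  | .while _ c => c.wa
  | _ => []

/-- The program allocates no memory. -/
def Cmd.noAlloc : Cmd → Bool
  | .alloc _ _ => false
  | .seq c d => c.noAlloc && d.noAlloc
  | .ite _ c d => c.noAlloc && d.noAlloc
  | .while _ c => c.noAlloc
  | _ => true

/-- The program has no loops and allocates no memory. -/
def Cmd.simple : Cmd → Bool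
  | .alloc _ _ => false
  | .seq c d => c.simple && d.simple
  | .ite _ c d => c.simple && d.simple
  | .while _ _ => false
  | _ => true

/-- Time bound for a program without loops. -/
def Cmd.maxCost : Cmd → ℕ
  | .skip => 1
  | .assign _ e => e.cost + 1
  | .put _ i e => i.cost + e.cost + 1
  | .seq c d => c.maxCost + d.maxCost
  | .ite b c d => b.cost + max c.maxCost d.maxCost + 1
  | _ => 0

/-- `s'` differs from `s` at most in the registers `X` and in the contents of the arrays `Y`. -/
structure Frame (X Y : List ℕ) (s s' : Store) : Prop where
  var : ∀ x, x ∉ X → s'.var x = s.var x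
  arr : ∀ a, a ∉ Y → s'.arr a = s.arr a
  size : s'.size = s.size
  used : s'.used = s.used

theorem Frame.refl (X Y : List ℕ) (s : Store) : Frame X Y s s :=
  ⟨fun _ _ => rfl, fun _ _ => rfl, rfl, rfl⟩

theorem Frame.trans {X Y : List ℕ} {s s' s'' : Store} (h : Frame X Y s s')
    (h' : Frame X Y s' s'') : Frame X Y s s'' :=
  ⟨fun x hx => (h'.var x hx).trans (h.var x hx), fun x hx => (h'.arr x hx).trans (h.arr x hx),
    h'.size.trans h.size, h'.used.trans h.used⟩

theorem Frame.mono {X Y X' Y' : List ℕ} {s s' : Store} (h : Frame X Y s s')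
    (hX : X ⊆ X') (hY : Y ⊆ Y') : Frame X' Y' s s' :=
  ⟨fun x hx => h.var x (fun h => hx (hX h)), fun x hx => h.arr x (fun h => hx (hY h)),
    h.size, h.used⟩

@[simp] theorem Store.setVar_var (s : Store) (x y : ℕ) (v : ℤ) :
    (s.setVar x v).var y = if y = x then v else s.var y := by
  simp [Store.setVar, Function.update_apply]

@[simp] theorem Store.setVar_arr (s : Store) (x : ℕ) (v : ℤ) : (s.setVar x v).arr = s.arr := rfl

@[simp] theorem Store.setVar_size (s : Store) (x : ℕ) (v : ℤ) : (s.setVar x v).size = s.size := rfl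

@[simp] theorem Store.setVar_used (s : Store) (x : ℕ) (v : ℤ) : (s.setVar x v).used = s.used := rfl

@[simp] theorem Store.setCell_var (s : Store) (a : ℕ) (i v : ℤ) : (s.setCell a i v).var = s.var :=
  rfl

@[simp] theorem Store.setCell_size (s : Store) (a : ℕ) (i v : ℤ) :
    (s.setCell a i v).size = s.size := rfl

@[simp] theorem Store.setCell_used (s : Store) (a : ℕ) (i v : ℤ) :
    (s.setCell a i v).used = s.used := rfl

@[simp] theorem Store.setCell_arr (s : Store) (a b : ℕ) (i j v : ℤ) :
    (s.setCell a i v).arr b j = if b = a then (if j = i then v else s.arr a j) else s.arr b j := by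
  unfold Store.setCell
  by_cases h : b = a
  · subst h
    simp [Function.update_apply]
  · simp [h]

@[simp] theorem Store.newArray_var (s : Store) (a k : ℕ) : (s.newArray a k).var = s.var := rfl

@[simp] theorem Store.newArray_size (s : Store) (a k b : ℕ) :
    (s.newArray a k).size b = if b = a then k else s.size b := by
  simp [Store.newArray, Function.update_apply]

@[simp] theorem Store.newArray_arr (s : Store) (a k b : ℕ) (j : ℤ) :
    (s.newArray a k).arr b j = if b = a then 0 else s.arr b j := by
  unfold Store.newArray
  by_cases h : b = a
  · subst h
    simp
  · simp [h]

@[simp] theorem Store.newArray_used (s : Store) (a k : ℕ) :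
    (s.newArray a k).used = s.used + k := rfl

theorem Exec.frame {W : ℕ} {c : Cmd} {s s' : Store} {t : ℕ} (h : Exec W c s t s')
    (hc : c.noAlloc = true) : Frame c.wv c.wa s s' := by
  induction h with
  | skip s => exact .refl _ _ _
  | assign s x e v he =>
    refine ⟨fun y hy => ?_, fun _ _ => rfl, rfl, rfl⟩
    simp only [Cmd.wv, List.mem_singleton] at hy
    simp [hy]
  | put s a i e k v hi he h0 hk =>
    refine ⟨fun _ _ => rfl, fun b hb => ?_, rfl, rfl⟩
    simp only [Cmd.wa, List.mem_singleton] at hb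
    funext j
    simp [hb]
  | alloc s a e k he => simp [Cmd.noAlloc] at hc
  | seq s s₁ s₂ c d t₁ t₂ hc' hd ih1 ih2 =>
    simp only [Cmd.noAlloc, Bool.and_eq_true] at hc
    exact ((ih1 hc.1).mono (by simp [Cmd.wv]) (by simp [Cmd.wa])).trans
      ((ih2 hc.2).mono (by simp [Cmd.wv]) (by simp [Cmd.wa]))
  | ite_true s s₁ b c d t hb hc' ih =>
    simp only [Cmd.noAlloc, Bool.and_eq_true] at hc
    exact (ih hc.1).mono (by simp [Cmd.wv]) (by simp [Cmd.wa])
  | ite_false s s₁ b c d t hb hc' ih =>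
    simp only [Cmd.noAlloc, Bool.and_eq_true] at hc
    exact (ih hc.2).mono (by simp [Cmd.wv]) (by simp [Cmd.wa])
  | while_false s b c hb => exact .refl _ _ _
  | while_true s s₁ s₂ b c t₁ t₂ hb hc' hw ih1 ih2 =>
    simp only [Cmd.noAlloc] at hc
    exact (ih1 hc).trans (ih2 hc)

theorem Cmd.noAlloc_of_simple {c : Cmd} (h : c.simple = true) : c.noAlloc = true := by
  induction c with
  | seq c d ihc ihd | ite b c d ihc ihd =>
    simp only [Cmd.simple, Bool.and_eq_true] at h
    simp [Cmd.noAlloc, ihc h.1, ihd h.2]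
  | _ => simp_all [Cmd.simple, Cmd.noAlloc]

theorem Exec.le_maxCost {W : ℕ} {c : Cmd} {s s' : Store} {t : ℕ} (h : Exec W c s t s')
    (hc : c.simple = true) : t ≤ c.maxCost := by
  induction h with
  | skip | assign | put => simp [Cmd.maxCost]
  | alloc s a e k he => simp [Cmd.simple] at hc
  | seq s s₁ s₂ c d t₁ t₂ hc' hd ih1 ih2 =>
    simp only [Cmd.simple, Bool.and_eq_true] at hc
    exact Nat.add_le_add (ih1 hc.1) (ih2 hc.2)
  | ite_true s s₁ b c d t hb hc' ih =>
    simp only [Cmd.simple, Bool.and_eq_true] at hc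
    have := ih hc.1
    simp only [Cmd.maxCost]
    omega
  | ite_false s s₁ b c d t hb hc' ih =>
    simp only [Cmd.simple, Bool.and_eq_true] at hc
    have := ih hc.2
    simp only [Cmd.maxCost]
    omega
  | while_false s b c hb => simp [Cmd.simple] at hc
  | while_true s s₁ s₂ b c t₁ t₂ hb hc' hw ih1 ih2 => simp [Cmd.simple] at hc

theorem Ter.run {W : ℕ} {c : Cmd} {s : Store} {Q : Store → Prop} (h : Ter W c s Q)
    (hc : c.simple = true) : Run W c s c.maxCost Q :=
  let ⟨_, _, h1, h2⟩ := h
  ⟨_, _, h1, h1.le_maxCost hc, h2⟩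

theorem Run.frame {W : ℕ} {c : Cmd} {s : Store} {B : ℕ} {Q : Store → Prop} (h : Run W c s B Q)
    (hc : c.noAlloc = true) : Run W c s B (fun s' => Q s' ∧ Frame c.wv c.wa s s') :=
  let ⟨_, _, h1, h2, h3⟩ := h
  ⟨_, _, h1, h2, h3, h1.frame hc⟩

theorem Run.alloc {W : ℕ} {s : Store} {a : ℕ} {e : Expr} {k : ℕ} {Q : Store → Prop}
    (h : e.ok W s) (hk : e.val s = k) (hQ : Q (s.newArray a k)) :
    Run W (.alloc a e) s (e.cost + k + 1) Q :=
  ⟨_, _, .alloc s a e k (e.eval_eq_some_iff.2 ⟨h, hk.symm⟩), le_rfl, hQ⟩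

theorem Expr.eval_mono {W W' : ℕ} (hW : W ≤ W') {s : Store} (e : Expr) {u : ℤ}
    (h : e.eval W s = some u) : e.eval W' s = some u := by
  rw [Expr.eval_eq_some_iff] at h ⊢
  refine ⟨?_, h.2⟩
  replace h := h.1
  induction e with
  | lit z | var x =>
    simp only [Expr.ok] at h ⊢
    omega
  | get a i ih =>
    simp only [Expr.ok] at h ⊢
    exact ⟨ih h.1, h.2.1, by omega, by omega⟩
  | add e f ihe ihf | sub e f ihe ihf | mul e f ihe ihf | div e f ihe ihf | mod e f ihe ihf =>
    simp only [Expr.ok] at h ⊢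
    exact ⟨ihe h.1, ihf h.2.1, by linarith [h.2.2.1], by linarith [h.2.2.2]⟩

theorem Cond.eval_mono {W W' : ℕ} (hW : W ≤ W') {s : Store} (b : Cond) {p : Bool}
    (h : b.eval W s = some p) : b.eval W' s = some p := by
  rw [Cond.eval_eq_some_iff] at h ⊢
  refine ⟨?_, h.2⟩
  replace h := h.1
  have key : ∀ e : Expr, e.ok W s → e.ok W' s := fun e he =>
    ((e.eval_eq_some_iff).1 (e.eval_mono hW ((e.eval_eq_some_iff).2 ⟨he, rfl⟩))).1
  induction b with
  | lt e f | le e f | eq e f => exact ⟨key _ h.1, key _ h.2⟩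
  | not b ih => exact ih h
  | and b c ihb ihc => exact ⟨ihb h.1, ihc h.2⟩

theorem Exec.mono {W W' : ℕ} (hW : W ≤ W') {c : Cmd} {s s' : Store} {t : ℕ}
    (h : Exec W c s t s') : Exec W' c s t s' := by
  induction h with
  | skip s => exact .skip s
  | assign s x e v he => exact .assign s x e v (e.eval_mono hW he)
  | put s a i e k v hi he h0 hk =>
    exact .put s a i e k v (i.eval_mono hW hi) (e.eval_mono hW he) h0 hk
  | alloc s a e k he => exact .alloc s a e k (e.eval_mono hW he)
  | seq s s₁ s₂ c d t₁ t₂ hc' hd ih1 ih2 => exact .seq _ _ _ _ _ _ _ ih1 ih2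
  | ite_true s s₁ b c d t hb hc' ih => exact .ite_true _ _ _ _ _ _ (b.eval_mono hW hb) ih
  | ite_false s s₁ b c d t hb hc' ih => exact .ite_false _ _ _ _ _ _ (b.eval_mono hW hb) ih
  | while_false s b c hb => exact .while_false _ _ _ (b.eval_mono hW hb)
  | while_true s s₁ s₂ b c t₁ t₂ hb hc' hw ih1 ih2 =>
    exact .while_true _ _ _ _ _ _ _ (b.eval_mono hW hb) ih1 ih2

/-! ### Loops -/

/-- Total correctness of a loop with invariant `I` and potential `Φ`. -/
theorem Run.loop {α : Type*} {W : ℕ} {b : Cond} {c : Cmd} (I : α → Store → Prop) (Φ : α → ℕ)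
    (hok : ∀ g s, I g s → b.ok W s)
    (step : ∀ g s, I g s → b.holds s → ∃ B, Run W c s B
      (fun s' => ∃ g', I g' s' ∧ B + b.cost + 1 + Φ g' ≤ Φ g))
    (g : α) (s : Store) (h : I g s) :
    Run W (.while b c) s (Φ g + b.cost + 1) (fun s' => ∃ g', I g' s' ∧ ¬ b.holds s') := by
  induction hn : Φ g using Nat.strong_induction_on generalizing g s with
  | _ n ih =>
    by_cases hb : b.holds s
    · obtain ⟨B, t, s', h1, h2, g', h3, h4⟩ := step g s h hb
      obtain ⟨t', s'', h5, h6, h7⟩ := ih (Φ g') (by omega) g' s' h3 rfl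
      exact ⟨_, _, .while_true _ _ _ _ _ _ _ (Cond.eval_true (hok _ _ h) hb) h1 h5,
        by omega, h7⟩
    · exact ⟨_, _, .while_false _ _ _ (Cond.eval_false (hok _ _ h) hb), by omega, g, h, hb⟩

theorem Run.forUp {W : ℕ} {x : ℕ} {elo ehi : Expr} {c : Cmd} {s : Store} (lo hi : ℕ)
    (I : ℕ → Store → Prop) (hle : lo ≤ hi) (hW : (hi : ℤ) ≤ W)
    (hc : c.simple = true) (hx : x ∉ c.wv)
    (hlo : elo.ok W s ∧ elo.val s = lo)
    (hhi : ∀ v s', lo ≤ v → v ≤ hi → Frame (x :: c.wv) c.wa s s' → s'.var x = v → I v s' →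
      ehi.ok W s' ∧ ehi.val s' = (hi : ℤ) - 1)
    (h0 : I lo (s.setVar x lo))
    (step : ∀ v s', lo ≤ v → v < hi → Frame (x :: c.wv) c.wa s s' → s'.var x = v → I v s' →
      Ter W c s' (fun s'' => I (v + 1) (s''.setVar x ((v + 1 : ℕ) : ℤ)))) :
    Run W (Cmd.forUp x elo ehi c) s ((hi - lo) * (c.maxCost + ehi.cost + 7) +
      elo.cost + ehi.cost + 4) (fun s' => I hi s' ∧ s'.var x = hi ∧
        Frame (x :: c.wv) c.wa s s') := by
  set J : ℕ → Store → Prop := fun v s' => lo ≤ v ∧ v ≤ hi ∧ Frame (x :: c.wv) c.wa s s' ∧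
    s'.var x = v ∧ I v s' with hJ
  have hinit : Exec W (.assign x elo) s (elo.cost + 1) (s.setVar x lo) :=
    .assign s x elo lo (elo.eval_eq_some_iff.2 ⟨hlo.1, hlo.2.symm⟩)
  have hJ0 : J lo (s.setVar x lo) := by
    refine ⟨le_rfl, hle, ⟨fun y hy => ?_, fun _ _ => rfl, rfl, rfl⟩, by simp, h0⟩
    simp only [List.mem_cons, not_or] at hy
    simp [hy.1]
  have hok : ∀ v s', J v s' → (Cond.le (.var x) ehi).ok W s' := by
    rintro v s' ⟨h1, h2, h3, h4, h5⟩
    refine ⟨?_, (hhi v s' h1 h2 h3 h4 h5).1⟩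
    simp only [Expr.ok, h4]
    omega
  have hw := Run.loop (W := W) (b := .le (.var x) ehi)
    (c := Cmd.block [c, .assign x (.add (.var x) (.lit 1))]) J
    (fun v => (hi - v) * (c.maxCost + ehi.cost + 7)) hok ?_ lo _ hJ0
  · obtain ⟨t, s', h1, h2, v, ⟨h3, h4, h5, h6, h7⟩, h8⟩ := hw
    refine ⟨_, _, .seq _ _ _ _ _ _ _ hinit h1, ?_, ?_⟩
    · simp only [Cond.cost, Expr.cost] at h2
      omega
    · have := (hhi v s' h3 h4 h5 h6 h7).2
      simp only [Cond.holds, Expr.val, this, h6] at h8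
      have : v = hi := by omega
      subst this
      exact ⟨h7, h6, h5⟩
  · rintro v s' ⟨h1, h2, h3, h4, h5⟩ hb
    have hv := (hhi v s' h1 h2 h3 h4 h5).2
    simp only [Cond.holds, Expr.val, h4, hv] at hb
    have hvlt : v < hi := by omega
    obtain ⟨t, s'', h6, h7⟩ := step v s' h1 hvlt h3 h4 h5
    have hfr := h6.frame (Cmd.noAlloc_of_simple hc)
    have hxv : s''.var x = v := by rw [hfr.var x hx, h4]
    refine ⟨c.maxCost + 4, _, _, .seq _ _ _ _ _ _ _ h6
      (.assign s'' x _ ((v + 1 : ℕ) : ℤ) ?_), ?_, v + 1, ⟨by omega, hvlt, ?_, by simp, h7⟩, ?_⟩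
    · rw [Expr.eval_eq_some_iff]
      simp only [Expr.ok, Expr.val, hxv]
      push_cast
      omega
    · have := h6.le_maxCost hc
      simp only [Expr.cost]
      omega
    · refine h3.trans ⟨fun y hy => ?_, fun a ha => ?_, hfr.size, hfr.used⟩
      · simp only [List.mem_cons, not_or] at hy
        simp [hy.1, hfr.var y hy.2]
      · exact hfr.arr a ha
    · obtain ⟨k, rfl⟩ : ∃ k, hi = v + 1 + k := ⟨hi - (v + 1), by omega⟩
      simp only [Cond.cost, Expr.cost]
      have e1 : v + 1 + k - (v + 1) = k := by omega
      have e2 : v + 1 + k - v = k + 1 := by omega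
      rw [e1, e2]
      nlinarith

attribute [simp] xN xSigma xI xK xC xL xM aT aSA aLCP aBWT aS aLen aPos aAct aLF aOcc
attribute [simp] Cmd.block Cmd.whenever Cmd.incr Cmd.wv Cmd.wa


/-! ## Counting sort -/

/-- Number of `j < m` with `k j = v`. -/
def countEq (k : ℕ → ℕ) (m v : ℕ) : ℕ := ((Finset.range m).filter (fun j => k j = v)).card

/-- Number of `j < m` with `k j < v`. -/
def countLt (k : ℕ → ℕ) (m v : ℕ) : ℕ := ((Finset.range m).filter (fun j => k j < v)).card

theorem countEq_zero (k : ℕ → ℕ) (v : ℕ) : countEq k 0 v = 0 := by simp [countEq]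

theorem countEq_succ (k : ℕ → ℕ) (m v : ℕ) :
    countEq k (m + 1) v = countEq k m v + if v = k m then 1 else 0 := by
  unfold countEq
  rw [Finset.range_add_one, Finset.filter_insert]
  by_cases h : k m = v
  · simp [h]
  · simp [h, Ne.symm h]

theorem countLt_zero (k : ℕ → ℕ) (m : ℕ) : countLt k m 0 = 0 := by simp [countLt]

theorem countLt_succ (k : ℕ → ℕ) (m v : ℕ) :
    countLt k m (v + 1) = countLt k m v + countEq k m v := by
  unfold countLt countEq
  rw [← Finset.card_union_of_disjoint]
  · congr 1
    ext j
    simp only [Finset.mem_filter, Finset.mem_range, Finset.mem_union]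
    omega
  · rw [Finset.disjoint_filter]
    intro j _ h1 h2
    omega

theorem countLt_le (k : ℕ → ℕ) (m v : ℕ) : countLt k m v ≤ m :=
  (Finset.card_filter_le _ _).trans (by simp)

theorem countEq_le (k : ℕ → ℕ) (m v : ℕ) : countEq k m v ≤ m :=
  (Finset.card_filter_le _ _).trans (by simp)

theorem countLt_mono (k : ℕ → ℕ) (m : ℕ) {v v' : ℕ} (h : v ≤ v') :
    countLt k m v ≤ countLt k m v' :=
  Finset.card_le_card (Finset.monotone_filter_right _ (fun _ _ hj => lt_of_lt_of_le hj h))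

theorem countEq_mono (k : ℕ → ℕ) (v : ℕ) {m m' : ℕ} (h : m ≤ m') :
    countEq k m v ≤ countEq k m' v :=
  Finset.card_le_card (Finset.filter_subset_filter _ (Finset.range_mono h))

/-- Final place of the `j`-th of `m` items in stable sorting by the keys `k`. -/
def place (k : ℕ → ℕ) (m j : ℕ) : ℕ := countLt k m (k j) + countEq k j (k j)

theorem place_lt {k : ℕ → ℕ} {m j j' : ℕ} (hj : j < m)
    (h : k j < k j' ∨ k j = k j' ∧ j < j') : place k m j < place k m j' := by
  have hs : countEq k j (k j) + 1 = countEq k (j + 1) (k j) := by simp [countEq_succ]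
  unfold place
  rcases h with h | ⟨h, h'⟩
  · have h1 := countLt_mono k m (show k j + 1 ≤ k j' from h)
    rw [countLt_succ] at h1
    have h2 := countEq_mono k (k j) (show j + 1 ≤ m from hj)
    omega
  · have h2 := countEq_mono k (k j) (show j + 1 ≤ j' from h')
    rw [← h]
    omega

theorem place_lt_card {k : ℕ → ℕ} {m j : ℕ} (hj : j < m) : place k m j < m := by
  have hs : countEq k j (k j) + 1 = countEq k (j + 1) (k j) := by simp [countEq_succ]
  have h2 := countEq_mono k (k j) (show j + 1 ≤ m from hj)
  have h3 := countLt_le k m (k j + 1)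
  rw [countLt_succ] at h3
  unfold place
  omega

theorem place_inj {k : ℕ → ℕ} {m j j' : ℕ} (hj : j < m) (hj' : j' < m)
    (h : place k m j = place k m j') : j = j' := by
  by_contra hne
  rcases lt_trichotomy (k j) (k j') with h1 | h1 | h1
  · exact absurd (place_lt hj (.inl h1)) (by omega)
  · rcases lt_or_gt_of_ne hne with h2 | h2
    · exact absurd (place_lt hj (.inr ⟨h1, h2⟩)) (by omega)
    · exact absurd (place_lt hj' (.inr ⟨h1.symm, h2⟩)) (by omega)
  · exact absurd (place_lt hj' (.inl h1)) (by omega)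

/-- `π` lists `0, …, m - 1` in the order of the keys `k`, ties in the given order. -/
structure StableSort (k : ℕ → ℕ) (m : ℕ) (π : ℕ → ℕ) : Prop where
  lt : ∀ x < m, π x < m
  sorted : ∀ x y, x < y → y < m → k (π x) < k (π y) ∨ k (π x) = k (π y) ∧ π x < π y

theorem exists_stableSort (k : ℕ → ℕ) (m : ℕ) :
    ∃ π, StableSort k m π ∧ ∀ x < m, place k m (π x) = x := by
  have hinj : Function.Injective (fun j : Fin m => (⟨place k m j, place_lt_card j.2⟩ : Fin m)) := by
    intro a b h
    exact Fin.ext (place_inj a.2 b.2 (by simpa using h))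
  have hsurj : ∀ x < m, ∃ j < m, place k m j = x := by
    intro x hx
    obtain ⟨j, hj⟩ := (Finite.injective_iff_surjective.1 hinj) ⟨x, hx⟩
    exact ⟨j, j.2, by simpa using congrArg Fin.val hj⟩
  choose! π h1 h2 using hsurj
  refine ⟨π, ⟨h1, fun x y hxy hy => ?_⟩, h2⟩
  have hx := hxy.trans hy
  by_contra hcon
  have hge : place k m (π y) < place k m (π x) ∨ π x = π y := by
    rcases lt_trichotomy (k (π x)) (k (π y)) with h | h | h
    · exact absurd (.inl h) hcon
    · rcases lt_trichotomy (π x) (π y) with h' | h' | h'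
      · exact absurd (.inr ⟨h, h'⟩) hcon
      · exact .inr h'
      · exact .inl (place_lt (h1 y hy) (.inr ⟨h.symm, h'⟩))
    · exact .inl (place_lt (h1 y hy) (.inl h))
  rw [h2 x hx, h2 y hy] at hge
  rcases hge with h | h
  · omega
  · have := h2 x hx
    rw [h, h2 y hy] at this
    omega

/-! ### Registers and arrays of the suffix sorting program -/

/-- Length of the current string. -/
notation "rM" => (10 : ℕ)
/-- Offset of the current string. -/
notation "rO" => (11 : ℕ)
/-- Recursion depth. -/
notation "rD" => (12 : ℕ)
/-- Number of items to sort. -/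
notation "rCnt" => (13 : ℕ)
/-- Largest key. -/
notation "rKb" => (14 : ℕ)
/-- Offset of the keys. -/
notation "rOff" => (15 : ℕ)
/-- Loop counter. -/
notation "rJ" => (16 : ℕ)
/-- Partial sum. -/
notation "rSum" => (17 : ℕ)
/-- Auxiliary register. -/
notation "rTmp" => (18 : ℕ)

/-- The strings of all levels of the recursion. -/
notation "aStr" => (20 : ℕ)
/-- Items being sorted. -/
notation "aItem" => (21 : ℕ)
/-- Sorted items. -/
notation "aSorted" => (22 : ℕ)
/-- Counters. -/
notation "aCount" => (23 : ℕ)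

open Cmd

/-- `for x = 0, …, e - 1 do c`. -/
def forLt (x : ℕ) (e : Expr) (c : Cmd) : Cmd := forUp x (.lit 0) (.sub e (.lit 1)) c

theorem Run.forLt {W : ℕ} {x : ℕ} {e : Expr} {c : Cmd} {s : Store} (K n : ℕ)
    (I : ℕ → Store → Prop) (hW : (n : ℤ) < W) (hK : c.maxCost + e.cost + 9 ≤ K)
    (hc : c.simple = true) (hx : x ∉ c.wv)
    (hn : ∀ v s', v ≤ n → Frame (x :: c.wv) c.wa s s' → s'.var x = v → I v s' →
      e.ok W s' ∧ e.val s' = n)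
    (h0 : I 0 (s.setVar x 0))
    (step : ∀ v s', v < n → Frame (x :: c.wv) c.wa s s' → s'.var x = v → I v s' →
      Ter W c s' (fun s'' => I (v + 1) (s''.setVar x ((v + 1 : ℕ) : ℤ)))) :
    Run W (forLt x e c) s (n * K + K)
      (fun s' => I n s' ∧ s'.var x = n ∧ Frame (x :: c.wv) c.wa s s') := by
  refine (Run.forUp 0 n I (Nat.zero_le _) (by omega) hc hx ⟨?_, rfl⟩ ?_ h0
    (fun v s' _ => step v s')).mono ?_ (fun _ h => h)
  · simp only [Expr.ok]
    omega
  · intro v s' _ h1 h2 h3 h4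
    obtain ⟨h5, h6⟩ := hn v s' h1 h2 h3 h4
    simp only [Expr.ok, Expr.val, h5, h6]
    refine ⟨⟨trivial, ⟨?_, ?_⟩, ?_, ?_⟩, trivial⟩ <;> omega
  · simp only [Expr.cost]
    have : (n - 0) * (c.maxCost + (e.cost + 1 + 1) + 7) ≤ n * K := by
      rw [Nat.sub_zero]
      exact Nat.mul_le_mul_left _ (by omega)
    omega

/-- Key of the item in the cell given by the loop counter. -/
def keyExpr : Expr := .get aStr (.add (.var rOff) (.get aItem (.var rJ)))

/-- Set all counters to zero. -/
def clearCounts : Cmd := forLt rJ (.add (.var rKb) (.lit 1)) (put aCount (.var rJ) (.lit 0))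

/-- Count the keys. -/
def countKeys : Cmd := forLt rJ (.var rCnt) (incr aCount keyExpr)

/-- Replace the counters by their partial sums. -/
def sumCounts : Cmd := forLt rJ (.add (.var rKb) (.lit 1)) (block [
  assign rTmp (.get aCount (.var rJ)),
  put aCount (.var rJ) (.var rSum),
  assign rSum (.add (.var rSum) (.var rTmp))])

/-- Move every item to its place. -/
def placeItems : Cmd := forLt rJ (.var rCnt) (block [
  put aSorted (.get aCount keyExpr) (.get aItem (.var rJ)),
  incr aCount keyExpr])

/-- Copy the sorted items. -/
def copyItems : Cmd := forLt rJ (.var rCnt) (put aItem (.var rJ) (.get aSorted (.var rJ)))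

/-- Stable sorting of the items by their keys. -/
def sortPass : Cmd :=
  block [clearCounts, countKeys, assign rSum (.lit 0), sumCounts, placeItems, copyItems]

/-- The items `src`, with the keys `key ≤ kb`, are ready to be sorted. -/
structure SortInput (W : ℕ) (s : Store) (cnt kb : ℕ) (off : ℤ) (src key : ℕ → ℕ) : Prop where
  cnt_lt : (cnt : ℤ) < W
  kb_lt : (kb : ℤ) + 1 < W
  off_fit : -(W : ℤ) ≤ off ∧ off ≤ W
  cnt_eq : s.var rCnt = cnt
  kb_eq : s.var rKb = kb
  off_eq : s.var rOff = off
  size_item : cnt ≤ s.size aItem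
  size_sorted : cnt ≤ s.size aSorted
  size_count : kb < s.size aCount
  item : ∀ j < cnt, s.arr aItem j = src j
  item_fit : ∀ j < cnt, (src j : ℤ) ≤ W
  key_eq : ∀ j < cnt, s.arr aStr (off + src j) = key j
  key_le : ∀ j < cnt, key j ≤ kb
  key_ok : ∀ j < cnt, 0 ≤ off + src j ∧ off + src j < s.size aStr ∧ off + src j ≤ W

theorem SortInput.frame {W : ℕ} {s s' : Store} {cnt kb : ℕ} {off : ℤ} {src key : ℕ → ℕ}
    (h : SortInput W s cnt kb off src key) {X Y : List ℕ} (f : Frame X Y s s')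
    (hX : rCnt ∉ X ∧ rKb ∉ X ∧ rOff ∉ X) (hY : aItem ∉ Y ∧ aStr ∉ Y) :
    SortInput W s' cnt kb off src key where
  __ := h
  cnt_eq := by rw [f.var _ hX.1, h.cnt_eq]
  kb_eq := by rw [f.var _ hX.2.1, h.kb_eq]
  off_eq := by rw [f.var _ hX.2.2, h.off_eq]
  size_item := by rw [f.size]; exact h.size_item
  size_sorted := by rw [f.size]; exact h.size_sorted
  size_count := by rw [f.size]; exact h.size_count
  item := by rw [f.arr _ hY.1]; exact h.item
  key_eq := by rw [f.arr _ hY.2]; exact h.key_eq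
  key_ok := by rw [f.size]; exact h.key_ok

section

variable {W : ℕ} {s : Store} {cnt kb : ℕ} {off : ℤ} {src key : ℕ → ℕ}

theorem SortInput.keyExpr_ok (h : SortInput W s cnt kb off src key) {j : ℕ} (hj : j < cnt)
    (hs : s.var rJ = j) : keyExpr.ok W s ∧ keyExpr.val s = key j := by
  have h1 := h.item j hj
  have h2 := h.item_fit j hj
  have h3 := h.key_eq j hj
  have h4 := h.key_le j hj
  have h5 := h.key_ok j hj
  have h6 := h.size_item
  have h7 := h.cnt_lt
  have h8 := h.kb_lt
  have h9 := h.off_fit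
  have h10 := h.off_eq
  simp only [keyExpr, Expr.ok, Expr.val, hs, h10, h1, h3, and_true]
  omega

theorem clearCounts_run (h : SortInput W s cnt kb off src key) :
    Run W clearCounts s ((kb + 1) * 20 + 20) (fun s' =>
      (∀ v ≤ kb, s'.arr aCount (v : ℕ) = 0) ∧ Frame [rJ] [aCount] s s') := by
  have h1 := h.kb_lt
  have h2 := h.size_count
  refine (Run.forLt 20 (kb + 1) (fun v s' => ∀ u : ℕ, u < v → s'.arr aCount u = 0)
    (by push_cast; omega) (by decide) rfl (by decide) ?_ ?_ ?_).mono le_rfl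
    (fun s' h => ⟨fun v hv => h.1 v (by omega), h.2.2⟩)
  · intro v s' hv f hs _
    simp [f.var, h.kb_eq]
    omega
  · simp
  · intro v s' hv f hs hI
    simp [hs, f.size]
    refine ⟨by omega, by omega, fun u hu hne => hI u (by omega)⟩

theorem countKeys_run (h : SortInput W s cnt kb off src key)
    (h0 : ∀ v ≤ kb, s.arr aCount (v : ℕ) = 0) :
    Run W countKeys s (cnt * 40 + 40) (fun s' =>
      (∀ v ≤ kb, s'.arr aCount (v : ℕ) = countEq key cnt v) ∧ Frame [rJ] [aCount] s s') := by
  have h1 := h.cnt_lt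
  have h2 := h.size_count
  have h3 := h.kb_lt
  refine (Run.forLt 40 cnt (fun j s' => ∀ v ≤ kb, s'.arr aCount (v : ℕ) = countEq key j v)
    (by omega) (by decide) rfl (by decide) ?_ ?_ ?_).mono le_rfl
    (fun s' h => ⟨fun v hv => h.1 v (by omega), h.2.2⟩)
  · intro v s' hv f hs _
    simp [f.var, h.cnt_eq]
    omega
  · simpa [countEq_zero] using h0
  · intro v s' hv f hs hI
    have h' := h.frame f (by decide) (by decide)
    obtain ⟨k1, k2⟩ := h'.keyExpr_ok hv hs
    have h4 := h.key_le v hv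
    have h5 := countEq_le key v (key v)
    simp [k1, k2, f.size, hI _ h4]
    refine ⟨by omega, by omega, fun u hu => ?_⟩
    rw [countEq_succ, hI u hu]
    split_ifs <;> simp_all

theorem sumCounts_run (h : SortInput W s cnt kb off src key) (hsum : s.var rSum = 0)
    (h0 : ∀ v ≤ kb, s.arr aCount (v : ℕ) = countEq key cnt v) :
    Run W sumCounts s ((kb + 1) * 40 + 40) (fun s' =>
      (∀ v ≤ kb, s'.arr aCount (v : ℕ) = countLt key cnt v) ∧
        Frame [rJ, rTmp, rSum] [aCount] s s') := by
  have h1 := h.cnt_lt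
  have h2 := h.size_count
  have h3 := h.kb_lt
  refine (Run.forLt 40 (kb + 1) (fun j s' => s'.var rSum = countLt key cnt j ∧
    (∀ v < j, s'.arr aCount (v : ℕ) = countLt key cnt v) ∧
    (∀ v ≤ kb, j ≤ v → s'.arr aCount (v : ℕ) = countEq key cnt v))
    (by push_cast; omega) (by decide) rfl (by decide) ?_ ?_ ?_).mono le_rfl
    (fun s' h => ⟨fun v hv => h.1.2.1 v (by omega), h.2.2⟩)
  · intro v s' hv f hs _
    simp [f.var, h.kb_eq]
    omega
  · simpa [countLt_zero, hsum] using h0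
  · rintro v s' hv f hs ⟨i1, i2, i3⟩
    have h4 := countEq_le key cnt v
    have h5 := countLt_le key cnt v
    have h6 := countLt_le key cnt (v + 1)
    rw [countLt_succ] at h6
    simp [f.size, hs, i1, i3 v (by omega) le_rfl, countLt_succ]
    and_intros
    any_goals omega
    · intro u hu
      split_ifs with huv
      · rw [huv]
      · exact i2 u (by omega)
    · intro u hu huv
      rw [if_neg (by omega)]
      exact i3 u hu (by omega)

theorem placeItems_run (h : SortInput W s cnt kb off src key)
    (h0 : ∀ v ≤ kb, s.arr aCount (v : ℕ) = countLt key cnt v) :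
    Run W placeItems s (cnt * 60 + 60) (fun s' =>
      (∀ j < cnt, s'.arr aSorted (place key cnt j : ℕ) = src j) ∧
        Frame [rJ] [aSorted, aCount] s s') := by
  have h1 := h.cnt_lt
  have h2 := h.size_count
  have h3 := h.kb_lt
  have h6 := h.size_item
  have h7 := h.size_sorted
  refine (Run.forLt 60 cnt (fun j s' =>
    (∀ v ≤ kb, s'.arr aCount (v : ℕ) = (countLt key cnt v + countEq key j v : ℕ)) ∧
    (∀ i < j, s'.arr aSorted (place key cnt i : ℕ) = src i))
    (by omega) (by decide) rfl (by decide) ?_ ?_ ?_).mono le_rfl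
    (fun s' h => ⟨fun v hv => h.1.2 v (by omega), h.2.2⟩)
  · intro v s' hv f hs _
    simp [f.var, h.cnt_eq]
    omega
  · simpa [countEq_zero] using h0
  · rintro v s' hv f hs ⟨i1, i2⟩
    have h' := h.frame f (by decide) (by decide)
    obtain ⟨k1, k2⟩ := h'.keyExpr_ok hv hs
    have h4 := h.key_le v hv
    have h8 := place_lt_card (k := key) hv
    have e1 : s'.arr aCount (key v : ℕ) = (place key cnt v : ℕ) := i1 _ h4
    have e2 := h'.item v hv
    have e3 := h.item_fit v hv
    have key' : ∀ x, (keyExpr.ok W (s'.setCell aSorted (place key cnt v : ℕ) x)) ∧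
        keyExpr.val (s'.setCell aSorted (place key cnt v : ℕ) x) = key v := by
      intro x
      refine SortInput.keyExpr_ok (h'.frame (X := []) (Y := [aSorted])
        ⟨fun _ _ => rfl, ?_, rfl, rfl⟩ (by decide) (by decide)) hv hs
      intro a ha
      funext j
      simp at ha
      simp
    simp [k1, k2, f.size, e1, hs, e2, key']
    and_intros
    any_goals omega
    · intro u hu
      rw [countEq_succ, i1 u hu]
      split_ifs with huv
      · subst huv
        simp [place]
        ring
      · simp
    · intro i hi
      by_cases hiv : i = v
      · simp [hiv]
      · rw [if_neg, i2 i (by omega)]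
        intro hcon
        exact hiv (place_inj (by omega) hv hcon)

theorem copyItems_run (h : SortInput W s cnt kb off src key) (f : ℕ → ℕ)
    (h0 : ∀ x < cnt, s.arr aSorted x = f x) (hf : ∀ x < cnt, (f x : ℤ) ≤ W) :
    Run W copyItems s (cnt * 20 + 20) (fun s' =>
      (∀ x < cnt, s'.arr aItem x = f x) ∧ Frame [rJ] [aItem] s s') := by
  have h1 := h.cnt_lt
  have h6 := h.size_item
  have h7 := h.size_sorted
  refine (Run.forLt 20 cnt (fun j s' => ∀ x < j, s'.arr aItem x = f x)
    (by omega) (by decide) rfl (by decide) ?_ ?_ ?_).mono le_rfl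
    (fun s' h => ⟨h.1, h.2.2⟩)
  · intro v s' hv f hs _
    simp [f.var, h.cnt_eq]
    omega
  · simp
  · rintro v s' hv fr hs i1
    have h3 := hf v hv
    simp [fr.size, fr.arr, hs, h0 v hv]
    refine ⟨by omega, by omega, by omega, fun u hu => ?_⟩
    split_ifs with huv
    · rw [huv]
    · exact i1 u (by omega)

theorem sortPass_run (h : SortInput W s cnt kb off src key) :
    Run W sortPass s (400 * (cnt + kb + 1)) (fun s' =>
      (∃ π, StableSort key cnt π ∧ ∀ x < cnt, s'.arr aItem x = src (π x)) ∧
      Frame [rJ, rTmp, rSum] [aItem, aSorted, aCount] s s') := by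
  obtain ⟨t1, s1, e1, b1, p1, f1⟩ := clearCounts_run h
  have h1 := h.frame f1 (by decide) (by decide)
  obtain ⟨t2, s2, e2, b2, p2, f2⟩ := countKeys_run h1 p1
  have h2 := h1.frame f2 (by decide) (by decide)
  have f3 : Frame [rSum] [] s2 (s2.setVar rSum 0) :=
    ⟨fun x hx => by simp at hx; simp [hx], fun _ _ => rfl, rfl, rfl⟩
  have h3 := h2.frame f3 (by decide) (by decide)
  have e3 : Exec W (assign rSum (.lit 0)) s2 2 (s2.setVar rSum 0) :=
    .assign s2 rSum (.lit 0) 0 ((Expr.eval_eq_some_iff _).2 ⟨by simp, rfl⟩)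
  obtain ⟨t4, s4, e4, b4, p4, f4⟩ := sumCounts_run h3 (by simp) (by simpa using p2)
  have h4 := h3.frame f4 (by decide) (by decide)
  obtain ⟨t5, s5, e5, b5, p5, f5⟩ := placeItems_run h4 p4
  have h5 := h4.frame f5 (by decide) (by decide)
  obtain ⟨π, hπ, hπ'⟩ := exists_stableSort key cnt
  obtain ⟨t6, s6, e6, b6, p6, f6⟩ := copyItems_run h5 (fun x => src (π x))
    (fun x hx => by rw [← p5 _ (hπ.lt x hx), hπ' x hx]) (fun x hx => h.item_fit _ (hπ.lt x hx))
  refine ⟨_, _, .seq _ _ _ _ _ _ _ e1 <| .seq _ _ _ _ _ _ _ e2 <| .seq _ _ _ _ _ _ _ e3 <|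
    .seq _ _ _ _ _ _ _ e4 <| .seq _ _ _ _ _ _ _ e5 e6, by omega, ⟨π, hπ, p6⟩, ?_⟩
  exact (f1.mono (by decide) (by decide)).trans <| (f2.mono (by decide) (by decide)).trans <|
    (f3.mono (by decide) (by decide)).trans <| (f4.mono (by decide) (by decide)).trans <|
    (f5.mono (by decide) (by decide)).trans (f6.mono (by decide) (by decide))

end


/-! ## Sorting the suffixes of a string of numbers by difference covers modulo three

A string of length `m` is a function which is positive below `m` and zero from `m` on. -/

/-- The suffix at `i` is smaller than the suffix at `j`. -/
def Slt (s : ℕ → ℕ) (i j : ℕ) : Prop :=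
  ∃ k, (∀ l < k, s (i + l) = s (j + l)) ∧ s (i + k) < s (j + k)

/-- `s` is a string of length `m`. -/
structure IsStr (s : ℕ → ℕ) (m : ℕ) : Prop where
  pos : ∀ i < m, 1 ≤ s i
  zero : ∀ i, m ≤ i → s i = 0

theorem Slt.irrefl {s : ℕ → ℕ} {i : ℕ} : ¬ Slt s i i := fun ⟨_, _, h⟩ => lt_irrefl _ h

theorem Slt.trans {s : ℕ → ℕ} {i j k : ℕ} (h : Slt s i j) (h' : Slt s j k) : Slt s i k := by
  obtain ⟨a, h1, h2⟩ := h
  obtain ⟨b, h3, h4⟩ := h'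
  rcases lt_trichotomy a b with hab | rfl | hab
  · exact ⟨a, fun l hl => (h1 l hl).trans (h3 l (hl.trans hab)), by rw [← h3 a hab]; exact h2⟩
  · exact ⟨a, fun l hl => (h1 l hl).trans (h3 l hl), h2.trans h4⟩
  · exact ⟨b, fun l hl => (h1 l (hl.trans hab)).trans (h3 l hl), by rw [h1 b hab]; exact h4⟩

theorem Slt.asymm {s : ℕ → ℕ} {i j : ℕ} (h : Slt s i j) : ¬ Slt s j i :=
  fun h' => Slt.irrefl (h.trans h')

theorem slt_iff {s : ℕ → ℕ} {i j : ℕ} :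
    Slt s i j ↔ s i < s j ∨ s i = s j ∧ Slt s (i + 1) (j + 1) := by
  constructor
  · rintro ⟨k, h1, h2⟩
    rcases k with _ | k
    · exact .inl h2
    · refine .inr ⟨h1 0 (by omega), k, fun l hl => ?_, ?_⟩
      · have := h1 (l + 1) (by omega)
        rwa [add_assoc, add_comm 1, add_assoc j, add_comm 1]
      · rwa [add_assoc, add_comm 1, add_assoc j, add_comm 1]
  · rintro (h | ⟨h, k, h1, h2⟩)
    · exact ⟨0, by simp, h⟩
    · refine ⟨k + 1, fun l hl => ?_, ?_⟩
      · rcases l with _ | l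
        · exact h
        · have := h1 l (by omega)
          rwa [add_assoc, add_comm 1, add_assoc j, add_comm 1] at this
      · rwa [add_assoc, add_comm 1, add_assoc j, add_comm 1] at h2

theorem IsStr.exists_ne {s : ℕ → ℕ} {m : ℕ} (hs : IsStr s m) {i j : ℕ} (hij : i ≠ j)
    (hi : i ≤ m) (hj : j ≤ m) : ∃ k, i + k ≤ m ∧ j + k ≤ m ∧ (∀ l < k, s (i + l) = s (j + l)) ∧
      s (i + k) ≠ s (j + k) := by
  classical
  have hex : ∃ k, s (i + k) ≠ s (j + k) := by
    rcases lt_or_gt_of_ne hij with h | h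
    · refine ⟨m - j, ?_⟩
      have h1 := hs.pos (i + (m - j)) (by omega)
      have h2 := hs.zero (j + (m - j)) (by omega)
      omega
    · refine ⟨m - i, ?_⟩
      have h1 := hs.pos (j + (m - i)) (by omega)
      have h2 := hs.zero (i + (m - i)) (by omega)
      omega
  refine ⟨Nat.find hex, ?_, ?_, fun l hl => not_not.1 (Nat.find_min hex hl), Nat.find_spec hex⟩
  · by_contra hlt
    have h1 := not_not.1 (Nat.find_min hex (show m - i < _ by omega))
    have h2 := hs.zero (i + (m - i)) (by omega)
    have h3 : ¬ j + (m - i) < m := fun h => by have := hs.pos _ h; omega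
    have h4 := not_not.1 (Nat.find_min hex (show m - j < _ by omega))
    have h5 := hs.zero (j + (m - j)) (by omega)
    have h6 : ¬ i + (m - j) < m := fun h => by have := hs.pos _ h; omega
    omega
  · by_contra hlt
    have h4 := not_not.1 (Nat.find_min hex (show m - j < _ by omega))
    have h5 := hs.zero (j + (m - j)) (by omega)
    have h6 : ¬ i + (m - j) < m := fun h => by have := hs.pos _ h; omega
    have h1 := not_not.1 (Nat.find_min hex (show m - i < _ by omega))
    have h2 := hs.zero (i + (m - i)) (by omega)
    have h3 : ¬ j + (m - i) < m := fun h => by have := hs.pos _ h; omega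
    omega

theorem IsStr.total {s : ℕ → ℕ} {m : ℕ} (hs : IsStr s m) {i j : ℕ} (hij : i ≠ j)
    (hi : i ≤ m) (hj : j ≤ m) : Slt s i j ∨ Slt s j i := by
  obtain ⟨k, -, -, h1, h2⟩ := hs.exists_ne hij hi hj
  rcases lt_or_gt_of_ne h2 with h | h
  · exact .inl ⟨k, h1, h⟩
  · exact .inr ⟨k, fun l hl => (h1 l hl).symm, h⟩

theorem IsStr.lt_of_slt {s : ℕ → ℕ} {m : ℕ} (hs : IsStr s m) {i j : ℕ} (h : Slt s i j) :
    j < m := by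
  obtain ⟨k, -, h⟩ := h
  by_contra hj
  have := hs.zero (j + k) (by omega)
  omega

/-- The offset of the first mismatch. -/
theorem IsStr.slt_bound {s : ℕ → ℕ} {m : ℕ} (hs : IsStr s m) {i j : ℕ} (hi : i ≤ m)
    (h : Slt s i j) : ∃ k, i + k ≤ m ∧ j + k < m ∧ (∀ l < k, s (i + l) = s (j + l)) ∧
      s (i + k) < s (j + k) := by
  obtain ⟨k, h1, h2⟩ := h
  have h3 : j + k < m := by
    by_contra hcon
    have := hs.zero (j + k) (by omega)
    omega
  obtain ⟨k', h4, h5, h6, h7⟩ := hs.exists_ne (i := i) (j := j)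
    (by rintro rfl; omega) hi (by omega)
  have : k = k' := by
    rcases lt_trichotomy k k' with h | h | h
    · have := h6 k h
      omega
    · exact h
    · exact absurd (h1 k' h) h7
  subst this
  exact ⟨k, h4, h3, h1, h2⟩

/-- Number of sample positions: those congruent to `1` up to `m`, and those congruent to `2`
below `m`. -/
def sampleCard (m : ℕ) : ℕ := (m + 2) / 3 + m / 3

/-- The `k`-th sample position. -/
def samplePos (m k : ℕ) : ℕ := if k < (m + 2) / 3 then 3 * k + 1 else 3 * (k - (m + 2) / 3) + 2

/-- Index of a sample position. -/
def sampleIdx (m p : ℕ) : ℕ := if p % 3 = 1 then p / 3 else (m + 2) / 3 + p / 3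

theorem sampleIdx_samplePos {m k : ℕ} : sampleIdx m (samplePos m k) = k := by
  unfold sampleIdx samplePos
  split_ifs <;> omega

theorem samplePos_le {m k : ℕ} (h : k < sampleCard m) : samplePos m k ≤ m := by
  unfold samplePos
  unfold sampleCard at h
  split_ifs <;> omega

theorem samplePos_mod {m k : ℕ} : samplePos m k % 3 ≠ 0 := by
  unfold samplePos
  split_ifs <;> omega

theorem samplePos_sampleIdx {m p : ℕ} (hp : p < m) (h3 : p % 3 ≠ 0) :
    sampleIdx m p < sampleCard m ∧ samplePos m (sampleIdx m p) = p := by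
  unfold samplePos sampleIdx sampleCard
  split_ifs <;> omega

/-- Triples in lexicographic order. -/
def TripleLt (s : ℕ → ℕ) (p q : ℕ) : Prop :=
  s p < s q ∨ s p = s q ∧ (s (p + 1) < s (q + 1) ∨ s (p + 1) = s (q + 1) ∧ s (p + 2) < s (q + 2))

/-- Equal triples. -/
def TripleEq (s : ℕ → ℕ) (p q : ℕ) : Prop :=
  s p = s q ∧ s (p + 1) = s (q + 1) ∧ s (p + 2) = s (q + 2)

/-- `s'` consists of the names of the triples of `s` at the sample positions. -/
structure Reduces (s : ℕ → ℕ) (m : ℕ) (s' : ℕ → ℕ) : Prop where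
  str : IsStr s' (sampleCard m)
  le : ∀ k, s' k ≤ sampleCard m
  lt : ∀ k < sampleCard m, ∀ k' < sampleCard m, TripleLt s (samplePos m k) (samplePos m k') →
    s' k < s' k'
  eq : ∀ k < sampleCard m, ∀ k' < sampleCard m, TripleEq s (samplePos m k) (samplePos m k') →
    s' k = s' k'

theorem samplePos_add {m k l : ℕ} (h : samplePos m k + 3 * l < m) :
    k + l < sampleCard m ∧ samplePos m (k + l) = samplePos m k + 3 * l := by
  unfold samplePos sampleCard at *
  split_ifs at * <;> omega

theorem samplePos_add_of_le {m k l : ℕ} (h : samplePos m k + 3 * l = m) :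
    (k + l < sampleCard m ∧ samplePos m (k + l) = samplePos m k + 3 * l) ∨
      k + l = sampleCard m := by
  unfold samplePos sampleCard at *
  split_ifs at * <;> omega

theorem Reduces.slt_of_slt {s s' : ℕ → ℕ} {m : ℕ} (hs : IsStr s m) (hr : Reduces s m s')
    {k k' : ℕ} (hk : k < sampleCard m)
    (h : Slt s (samplePos m k) (samplePos m k')) : Slt s' k k' := by
  obtain ⟨d, h1, h2, h3, h4⟩ := hs.slt_bound (samplePos_le hk) h
  have hd : d = 3 * (d / 3) + d % 3 := by omega
  refine ⟨d / 3, fun l hl => ?_, ?_⟩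
  · obtain ⟨a1, a2⟩ := samplePos_add (m := m) (k := k) (l := l) (by omega)
    obtain ⟨b1, b2⟩ := samplePos_add (m := m) (k := k') (l := l) (by omega)
    refine hr.eq _ a1 _ b1 ⟨?_, ?_, ?_⟩
    · rw [a2, b2]
      exact h3 _ (by omega)
    · rw [a2, b2, add_assoc, add_assoc]
      exact h3 _ (by omega)
    · rw [a2, b2, add_assoc, add_assoc]
      exact h3 _ (by omega)
  · obtain ⟨b1, b2⟩ := samplePos_add (m := m) (k := k') (l := d / 3) (by omega)
    have key : k + d / 3 < sampleCard m ∧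
        samplePos m (k + d / 3) = samplePos m k + 3 * (d / 3) → s' (k + d / 3) < s' (k' + d / 3) := by
      rintro ⟨a1, a2⟩
      refine hr.lt _ a1 _ b1 ?_
      unfold TripleLt
      rw [a2, b2]
      have hr3 : d % 3 = 0 ∨ d % 3 = 1 ∨ d % 3 = 2 := by omega
      have e0 := h3 (3 * (d / 3))
      have e1 := h3 (3 * (d / 3) + 1)
      rw [← add_assoc, ← add_assoc] at e1
      rw [hd, ← add_assoc, ← add_assoc] at h4
      rcases hr3 with h | h | h
      · left
        rw [h] at h4
        simpa using h4
      · right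
        refine ⟨e0 (by omega), .inl ?_⟩
        rw [h] at h4
        simpa [add_assoc] using h4
      · right
        refine ⟨e0 (by omega), .inr ⟨?_, ?_⟩⟩
        · exact e1 (by omega)
        rw [h] at h4
        simpa [add_assoc] using h4
    rcases lt_or_eq_of_le (show samplePos m k + 3 * (d / 3) ≤ m by omega) with h | h
    · exact key (samplePos_add h)
    · rcases samplePos_add_of_le h with h | h
      · exact key h
      · rw [h, hr.str.zero _ le_rfl]
        exact hr.str.pos _ b1

theorem Reduces.slt_iff {s s' : ℕ → ℕ} {m : ℕ} (hs : IsStr s m) (hr : Reduces s m s')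
    {k k' : ℕ} (hk : k < sampleCard m) (hk' : k' < sampleCard m) :
    Slt s' k k' ↔ Slt s (samplePos m k) (samplePos m k') := by
  refine ⟨fun h => ?_, hr.slt_of_slt hs hk⟩
  have hne : samplePos m k ≠ samplePos m k' := by
    intro he
    have := congrArg (sampleIdx m) he
    rw [sampleIdx_samplePos, sampleIdx_samplePos] at this
    subst this
    exact Slt.irrefl h
  rcases hs.total hne (samplePos_le hk) (samplePos_le hk') with h' | h'
  · exact h'
  · exact absurd (hr.slt_of_slt hs hk' h') h.asymm

/-- `f` lists the suffixes of the string `s` of length `m` in increasing order. -/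
structure IsSorted (s : ℕ → ℕ) (m : ℕ) (f : ℕ → ℕ) : Prop where
  lt : ∀ x < m, f x < m
  slt : ∀ x y, x < y → y < m → Slt s (f x) (f y)

theorem exists_of_injOn {m : ℕ} {f : ℕ → ℕ} (h : ∀ x < m, f x < m)
    (hinj : ∀ x y, x < y → y < m → f x ≠ f y) {i : ℕ} (hi : i < m) : ∃ x < m, f x = i := by
  have hinj' : Function.Injective (fun j : Fin m => (⟨f j, h j j.2⟩ : Fin m)) := by
    intro a b hab
    have hab' : f a = f b := by simpa using hab
    rcases lt_trichotomy a b with h' | h' | h'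
    · exact absurd hab' (hinj a b h' b.2)
    · exact h'
    · exact absurd hab'.symm (hinj b a h' a.2)
  obtain ⟨x, hx⟩ := (Finite.injective_iff_surjective.1 hinj') ⟨i, hi⟩
  exact ⟨x, x.2, by simpa using congrArg Fin.val hx⟩

theorem IsSorted.exists {s : ℕ → ℕ} {m : ℕ} {f : ℕ → ℕ} (h : IsSorted s m f) {i : ℕ}
    (hi : i < m) : ∃ x < m, f x = i :=
  exists_of_injOn h.lt (fun x y hxy hy he => Slt.irrefl (he ▸ h.slt x y hxy hy)) hi

theorem IsSorted.inj {s : ℕ → ℕ} {m : ℕ} {f : ℕ → ℕ} (h : IsSorted s m f) {x y : ℕ}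
    (hx : x < m) (hy : y < m) (he : f x = f y) : x = y := by
  rcases lt_trichotomy x y with h' | h' | h'
  · exact absurd (h.slt x y h' hy) (he ▸ Slt.irrefl)
  · exact h'
  · exact absurd (h.slt y x h' hx) (he ▸ Slt.irrefl)

theorem IsSorted.lt_of_slt {s : ℕ → ℕ} {m : ℕ} {f : ℕ → ℕ} (h : IsSorted s m f) {x y : ℕ}
    (hx : x < m) (hlt : Slt s (f x) (f y)) : x < y := by
  by_contra hcon
  rcases lt_or_eq_of_le (not_lt.1 hcon) with h' | h'
  · exact hlt.asymm (h.slt y x h' hx)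
  · exact Slt.irrefl (h' ▸ hlt)

/-- `r` holds the ranks, from `1`, of the sample suffixes, and `0` elsewhere. -/
structure IsSampleRank (m : ℕ) (f r : ℕ → ℕ) : Prop where
  sample : ∀ x < sampleCard m, r (samplePos m (f x)) = x + 1
  other : ∀ p, (∀ x < sampleCard m, p ≠ samplePos m (f x)) → r p = 0

section Rank

variable {s s' f r : ℕ → ℕ} {m : ℕ}

theorem IsSampleRank.lt_of_slt (hs : IsStr s m) (hr : Reduces s m s')
    (hf : IsSorted s' (sampleCard m) f) (h : IsSampleRank m f r) {p q : ℕ}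
    (hq : q % 3 ≠ 0) (hlt : Slt s p q) : r p < r q := by
  obtain ⟨b1, b2⟩ := samplePos_sampleIdx (hs.lt_of_slt hlt) hq
  obtain ⟨y, hy, hy'⟩ := hf.exists b1
  have hq' : samplePos m (f y) = q := by rw [hy', b2]
  rw [← hq', h.sample y hy]
  by_cases hp : ∃ x < sampleCard m, p = samplePos m (f x)
  · obtain ⟨x, hx, rfl⟩ := hp
    rw [h.sample x hx]
    rw [← hq', ← hr.slt_iff hs (hf.lt x hx) (hf.lt y hy)] at hlt
    have := hf.lt_of_slt hx hlt
    omega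
  · push Not at hp
    rw [h.other p hp]
    omega

theorem IsSampleRank.slt_iff (hs : IsStr s m) (hr : Reduces s m s')
    (hf : IsSorted s' (sampleCard m) f) (h : IsSampleRank m f r) {p q : ℕ} (hne : p ≠ q)
    (hpm : p ≤ m) (hqm : q ≤ m) (hp : p % 3 ≠ 0) (hq : q % 3 ≠ 0) : Slt s p q ↔ r p < r q := by
  refine ⟨h.lt_of_slt hs hr hf hq, fun hlt => ?_⟩
  rcases hs.total hne hpm hqm with h' | h'
  · exact h'
  · have := h.lt_of_slt hs hr hf hp h'
    omega

theorem IsSampleRank.slt_iff_pair (hs : IsStr s m) (hr : Reduces s m s')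
    (hf : IsSorted s' (sampleCard m) f) (h : IsSampleRank m f r) {i j : ℕ} (hne : i ≠ j)
    (him : i < m) (hjm : j < m) (hi : (i + 1) % 3 ≠ 0) (hj : (j + 1) % 3 ≠ 0) :
    Slt s i j ↔ s i < s j ∨ s i = s j ∧ r (i + 1) < r (j + 1) := by
  rw [Suffixient.slt_iff, h.slt_iff hs hr hf (by omega) (by omega) (by omega) hi hj]

theorem IsSampleRank.slt_iff_triple (hs : IsStr s m) (hr : Reduces s m s')
    (hf : IsSorted s' (sampleCard m) f) (h : IsSampleRank m f r) {i j : ℕ} (hne : i ≠ j)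
    (him : i < m) (hjm : j < m) (hi : (i + 2) % 3 ≠ 0) (hj : (j + 2) % 3 ≠ 0) :
    Slt s i j ↔ s i < s j ∨ s i = s j ∧
      (s (i + 1) < s (j + 1) ∨ s (i + 1) = s (j + 1) ∧ r (i + 2) < r (j + 2)) := by
  rw [Suffixient.slt_iff, Suffixient.slt_iff (i := i + 1)]
  by_cases he : s (i + 1) = s (j + 1)
  · have hlt : i + 1 < m ∧ j + 1 < m := by
      by_contra hcon
      have h1 : i + 1 < m → 1 ≤ s (i + 1) := hs.pos _
      have h2 : j + 1 < m → 1 ≤ s (j + 1) := hs.pos _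
      have h3 : m ≤ i + 1 → s (i + 1) = 0 := hs.zero _
      have h4 : m ≤ j + 1 → s (j + 1) = 0 := hs.zero _
      omega
    rw [h.slt_iff hs hr hf (p := i + 1 + 1) (q := j + 1 + 1) (by omega) (by omega) (by omega)
      (by omega) (by omega)]
  · simp [he]

end Rank


/-! ### Naming the triples -/

theorem StableSort.inj {k : ℕ → ℕ} {m : ℕ} {π : ℕ → ℕ} (h : StableSort k m π) {x y : ℕ}
    (hxy : x < y) (hy : y < m) : π x ≠ π y := by
  intro he
  have := h.sorted x y hxy hy
  rw [he] at this
  omega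

/-- `g` lists the sample positions in the order of their triples. -/
structure SortsTriples (s : ℕ → ℕ) (m : ℕ) (g : ℕ → ℕ) : Prop where
  sample : ∀ x < sampleCard m, ∃ k < sampleCard m, g x = samplePos m k
  exists_eq : ∀ k < sampleCard m, ∃ x < sampleCard m, g x = samplePos m k
  inj : ∀ x y, x < y → y < sampleCard m → g x ≠ g y
  sorted : ∀ x y, x < y → y < sampleCard m → TripleLt s (g x) (g y) ∨ TripleEq s (g x) (g y)

theorem sortsTriples_of_stableSort {s : ℕ → ℕ} {m : ℕ} {π₁ π₂ π₃ : ℕ → ℕ}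
    (h₁ : StableSort (fun x => s (samplePos m x + 2)) (sampleCard m) π₁)
    (h₂ : StableSort (fun x => s (samplePos m (π₁ x) + 1)) (sampleCard m) π₂)
    (h₃ : StableSort (fun x => s (samplePos m (π₁ (π₂ x)))) (sampleCard m) π₃) :
    SortsTriples s m (fun x => samplePos m (π₁ (π₂ (π₃ x)))) := by
  have hne : ∀ {π : ℕ → ℕ} {k : ℕ → ℕ}, StableSort k (sampleCard m) π → ∀ x y, x ≠ y →
      x < sampleCard m → y < sampleCard m → π x ≠ π y := by
    intro π k h x y hxy hx hy
    rcases lt_or_gt_of_ne hxy with h' | h'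
    · exact h.inj h' hy
    · exact (h.inj h' hx).symm
  have hlt : ∀ x < sampleCard m, π₁ (π₂ (π₃ x)) < sampleCard m :=
    fun x hx => h₁.lt _ (h₂.lt _ (h₃.lt _ hx))
  have hinj : ∀ x y, x < y → y < sampleCard m → π₁ (π₂ (π₃ x)) ≠ π₁ (π₂ (π₃ y)) := by
    intro x y hxy hy
    have hx := hxy.trans hy
    exact hne h₁ _ _ (hne h₂ _ _ (hne h₃ _ _ hxy.ne hx hy) (h₃.lt _ hx) (h₃.lt _ hy))
      (h₂.lt _ (h₃.lt _ hx)) (h₂.lt _ (h₃.lt _ hy))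
  refine ⟨fun x hx => ⟨_, hlt x hx, rfl⟩, fun k hk => ?_, fun x y hxy hy he => ?_,
    fun x y hxy hy => ?_⟩
  · obtain ⟨x, hx, he⟩ := exists_of_injOn hlt hinj hk
    exact ⟨x, hx, by simp only [he]⟩
  · have := congrArg (sampleIdx m) he
    rw [sampleIdx_samplePos, sampleIdx_samplePos] at this
    exact hinj x y hxy hy this
  · unfold TripleLt TripleEq
    have hx := hxy.trans hy
    rcases h₃.sorted x y hxy hy with h | ⟨h, h'⟩
    · exact .inl (.inl h)
    · rcases h₂.sorted _ _ h' (h₃.lt _ hy) with h2 | ⟨h2, h2'⟩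
      · exact .inl (.inr ⟨h, .inl h2⟩)
      · rcases h₁.sorted _ _ h2' (h₂.lt _ (h₃.lt _ hy)) with h3 | ⟨h3, h3'⟩
        · exact .inl (.inr ⟨h, .inr ⟨h2, h3⟩⟩)
        · exact .inr ⟨h, h2, h3⟩

instance (s : ℕ → ℕ) (p q : ℕ) : Decidable (TripleEq s p q) :=
  inferInstanceAs (Decidable (_ ∧ _ ∧ _))

/-- The name given to the last of the first `j` positions in the list `g`. -/
def tripleName (s g : ℕ → ℕ) : ℕ → ℕ
  | 0 => 0
  | j + 1 => if 0 < j ∧ TripleEq s (g (j - 1)) (g j) then tripleName s g j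
      else tripleName s g j + 1

theorem tripleName_le (s g : ℕ → ℕ) (j : ℕ) : tripleName s g j ≤ j := by
  induction j with
  | zero => simp [tripleName]
  | succ j ih =>
    unfold tripleName
    split_ifs <;> omega

theorem tripleName_pos (s g : ℕ → ℕ) (j : ℕ) : 1 ≤ tripleName s g (j + 1) := by
  induction j with
  | zero => simp [tripleName]
  | succ j ih =>
    unfold tripleName
    split_ifs <;> omega

theorem SortsTriples.name_cases {s : ℕ → ℕ} {m : ℕ} {g : ℕ → ℕ} (h : SortsTriples s m g) {x y : ℕ}
    (hxy : x ≤ y) (hy : y < sampleCard m) :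
    (tripleName s g (y + 1) = tripleName s g (x + 1) ∧ TripleEq s (g x) (g y)) ∨
    (tripleName s g (x + 1) < tripleName s g (y + 1) ∧ TripleLt s (g x) (g y)) := by
  induction y, hxy using Nat.le_induction with
  | base => exact .inl ⟨rfl, rfl, rfl, rfl⟩
  | succ y hxy ih =>
    have ih := ih (by omega)
    have hs := h.sorted y (y + 1) (by omega) hy
    rw [show tripleName s g (y + 1 + 1) = if 0 < y + 1 ∧ TripleEq s (g (y + 1 - 1)) (g (y + 1))
      then tripleName s g (y + 1) else tripleName s g (y + 1) + 1 from rfl]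
    simp only [Nat.add_sub_cancel]
    unfold TripleLt TripleEq at *
    by_cases he : s (g y) = s (g (y + 1)) ∧ s (g y + 1) = s (g (y + 1) + 1) ∧
        s (g y + 2) = s (g (y + 1) + 2)
    · rw [if_pos ⟨by omega, he⟩]
      omega
    · rw [if_neg (by tauto)]
      omega

theorem SortsTriples.reduces {s s' : ℕ → ℕ} {m : ℕ} {g : ℕ → ℕ} (h : SortsTriples s m g)
    (h0 : ∀ k, sampleCard m ≤ k → s' k = 0)
    (hn : ∀ x < sampleCard m, s' (sampleIdx m (g x)) = tripleName s g (x + 1)) :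
    Reduces s m s' := by
  have key : ∀ k < sampleCard m, ∃ x < sampleCard m, samplePos m k = g x ∧
      s' k = tripleName s g (x + 1) := by
    intro k hk
    obtain ⟨x, hx, he⟩ := h.exists_eq k hk
    refine ⟨x, hx, he.symm, ?_⟩
    rw [← hn x hx, he, sampleIdx_samplePos]
  have excl : ∀ p q, TripleLt s p q → TripleEq s p q → False := by
    unfold TripleLt TripleEq
    intro p q
    omega
  have excl' : ∀ p q, TripleLt s p q → TripleLt s q p → False := by
    unfold TripleLt
    intro p q
    omega
  refine ⟨⟨fun k hk => ?_, h0⟩, fun k => ?_, fun k hk k' hk' hlt => ?_, fun k hk k' hk' he => ?_⟩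
  · obtain ⟨x, hx, -, he⟩ := key k hk
    rw [he]
    exact tripleName_pos s g x
  · by_cases hk : k < sampleCard m
    · obtain ⟨x, hx, -, he⟩ := key k hk
      have := tripleName_le s g (x + 1)
      omega
    · rw [h0 k (by omega)]
      omega
  · obtain ⟨x, hx, e1, e2⟩ := key k hk
    obtain ⟨y, hy, e3, e4⟩ := key k' hk'
    rw [e1, e3] at hlt
    rw [e2, e4]
    rcases le_total x y with hxy | hxy
    · rcases h.name_cases hxy hy with h' | h'
      · exact (excl _ _ hlt h'.2).elim
      · exact h'.1
    · rcases h.name_cases hxy hx with h' | h'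
      · exact (excl _ _ hlt ⟨h'.2.1.symm, h'.2.2.1.symm, h'.2.2.2.symm⟩).elim
      · exact (excl' _ _ hlt h'.2).elim
  · obtain ⟨x, hx, e1, e2⟩ := key k hk
    obtain ⟨y, hy, e3, e4⟩ := key k' hk'
    rw [e1, e3] at he
    rw [e2, e4]
    rcases le_total x y with hxy | hxy
    · rcases h.name_cases hxy hy with h' | h'
      · exact h'.1.symm
      · exact (excl _ _ h'.2 he).elim
    · rcases h.name_cases hxy hx with h' | h'
      · exact h'.1
      · exact (excl _ _ h'.2 ⟨he.1.symm, he.2.1.symm, he.2.2.symm⟩).elim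

/-! ### Passing to the string of names -/

/-- Number of sample positions congruent to `1`. -/
notation "rHalf" => (19 : ℕ)
/-- Current name. -/
notation "rName" => (20 : ℕ)
/-- First letter of the last triple. -/
notation "rTripA" => (21 : ℕ)
/-- Second letter of the last triple. -/
notation "rTripB" => (22 : ℕ)
/-- Third letter of the last triple. -/
notation "rTripC" => (23 : ℕ)
/-- Current position. -/
notation "rPos" => (24 : ℕ)
/-- Offset of the string of names. -/
notation "rNext" => (25 : ℕ)

/-- Stack of offsets. -/
notation "aOffs" => (24 : ℕ)
/-- Stack of lengths. -/
notation "aLens" => (25 : ℕ)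

open Cmd

/-- Compute the number of sample positions. -/
def sampleSizes : Cmd := block [
  assign rHalf (.div (.add (.var rM) (.lit 2)) (.lit 3)),
  assign rCnt (.add (.var rHalf) (.div (.var rM) (.lit 3))),
  assign rKb (.var rM)]

/-- List the sample positions. -/
def fillSample : Cmd := forLt rJ (.var rCnt) (ite (.lt (.var rJ) (.var rHalf))
  (put aItem (.var rJ) (.add (.mul (.lit 3) (.var rJ)) (.lit 1)))
  (put aItem (.var rJ) (.add (.mul (.lit 3) (.sub (.var rJ) (.var rHalf))) (.lit 2))))

/-- Sort the items by the letters at distance `d`. -/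
def sortBy (d : ℤ) : Cmd := seq (assign rOff (.add (.var rO) (.lit d))) sortPass

/-- Push the current string onto the stack and prepare for naming. -/
def pushLevel : Cmd := block [
  put aOffs (.var rD) (.var rO),
  put aLens (.var rD) (.var rM),
  assign rD (.add (.var rD) (.lit 1)),
  assign rNext (.add (.add (.var rO) (.var rM)) (.lit 3)),
  assign rName (.lit 0),
  assign rTripA (.lit (-1)),
  assign rTripB (.lit (-1)),
  assign rTripC (.lit (-1))]

/-- The letter at distance `d` from the current position. -/
def letterExpr (d : ℤ) : Expr := .get aStr (.add (.add (.var rO) (.var rPos)) (.lit d))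

/-- Write the names of the sorted triples. -/
def nameTriples : Cmd := forLt rJ (.var rCnt) (block [
  assign rPos (.get aItem (.var rJ)),
  ite (.and (.eq (.var rTripA) (letterExpr 0))
      (.and (.eq (.var rTripB) (letterExpr 1)) (.eq (.var rTripC) (letterExpr 2))))
    skip
    (block [assign rName (.add (.var rName) (.lit 1)), assign rTripA (letterExpr 0),
      assign rTripB (letterExpr 1), assign rTripC (letterExpr 2)]),
  ite (.eq (.mod (.var rPos) (.lit 3)) (.lit 1))
    (put aStr (.add (.var rNext) (.div (.var rPos) (.lit 3))) (.var rName))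
    (put aStr (.add (.add (.var rNext) (.var rHalf)) (.div (.var rPos) (.lit 3))) (.var rName))])

/-- Replace the current string by the string of names. -/
def descend : Cmd := block [sampleSizes, fillSample, sortBy 2, sortBy 1, sortBy 0, pushLevel,
  nameTriples, assign rO (.var rNext), assign rM (.var rCnt)]

/-- The string `str` of length `m` is stored at the offset `o`. -/
structure StrAt (W : ℕ) (s : Store) (o m : ℕ) (str : ℕ → ℕ) : Prop where
  isStr : IsStr str m
  le : ∀ i, str i ≤ m
  arr : ∀ i ≤ m + 2, s.arr aStr ((o : ℤ) + (i : ℕ)) = str i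
  size : o + m + 2 < s.size aStr
  fit : (s.size aStr : ℤ) + 10 < W

theorem StrAt.frame {W : ℕ} {s s' : Store} {o m : ℕ} {str : ℕ → ℕ} (h : StrAt W s o m str)
    {X Y : List ℕ} (f : Frame X Y s s') (hY : aStr ∉ Y) : StrAt W s' o m str where
  __ := h
  arr := by rw [f.arr _ hY]; exact h.arr
  size := by rw [f.size]; exact h.size
  fit := by rw [f.size]; exact h.fit

/-- The working arrays are large enough for strings of length `N`. -/
structure WorkSpace (s : Store) (N : ℕ) : Prop where
  item : N ≤ s.size aItem
  sorted : N ≤ s.size aSorted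
  count : N < s.size aCount

theorem WorkSpace.frame {s s' : Store} {N : ℕ} (h : WorkSpace s N) {X Y : List ℕ}
    (f : Frame X Y s s') : WorkSpace s' N := by
  obtain ⟨h1, h2, h3⟩ := h
  exact ⟨by rwa [f.size], by rwa [f.size], by rwa [f.size]⟩

theorem sampleCard_le (m : ℕ) (hm : 1 ≤ m) : sampleCard m ≤ m := by
  unfold sampleCard
  omega

section

variable {W : ℕ} {s : Store} {o m : ℕ} {str : ℕ → ℕ}

theorem sampleSizes_run (h : StrAt W s o m str) (hm : s.var rM = m) :
    Run W sampleSizes s 20 (fun s' => (s'.var rHalf = ((m + 2) / 3 : ℕ) ∧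
      s'.var rCnt = (sampleCard m : ℕ) ∧ s'.var rKb = m) ∧
      Frame [rHalf, rCnt, rKb] [] s s') := by
  have h1 := h.size
  have h2 := h.fit
  refine (Ter.run (c := sampleSizes) ?_ rfl).frame rfl |>.mono (by decide) (fun _ h => h)
  simp [sampleSizes, hm, sampleCard]
  omega

theorem fillSample_run (h : StrAt W s o m str) (hw : WorkSpace s m) (h1m : 1 ≤ m)
    (hhalf : s.var rHalf = ((m + 2) / 3 : ℕ)) (hcnt : s.var rCnt = (sampleCard m : ℕ)) :
    Run W fillSample s (sampleCard m * 30 + 30) (fun s' =>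
      (∀ k < sampleCard m, s'.arr aItem (k : ℕ) = (samplePos m k : ℕ)) ∧
      Frame [rJ] [aItem] s s') := by
  have h1 := h.size
  have h2 := h.fit
  have h3 := sampleCard_le m h1m
  have h4 := hw.item
  refine (Run.forLt 30 (sampleCard m) (fun j s' => ∀ k < j, s'.arr aItem (k : ℕ) =
    (samplePos m k : ℕ)) (by omega) (by decide) rfl (by decide) ?_ ?_ ?_).mono le_rfl
    (fun s' h => ⟨h.1, h.2.2.mono (by decide) (by decide)⟩)
  · intro v s' hv f hs _
    simp [f.var, hcnt]
    omega
  · simp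
  · intro v s' hv f hs hI
    have hp : (samplePos m v : ℤ) ≤ m := by exact_mod_cast samplePos_le hv
    have e : ∀ x : ℤ, x = (samplePos m v : ℕ) → ∀ k ≤ v,
        (if k = v then x else s'.arr aItem k) = (samplePos m k : ℕ) := by
      intro x hx k hk
      split_ifs with hkv
      · rw [hx, hkv]
      · exact hI k (by omega)
    simp [f.var, f.size, hs, hhalf]
    constructor
    · omega
    constructor
    · intro hlt
      have hp' : (samplePos m v : ℤ) = 3 * v + 1 := by
        unfold samplePos
        rw [if_pos (by omega)]
        push_cast
        ring
      and_intros
      any_goals omega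
      exact e _ hp'.symm
    · intro hlt
      have hp' : (samplePos m v : ℤ) = 3 * (v - (m + 2) / 3) + 2 := by
        unfold samplePos
        rw [if_neg (by omega)]
        omega
      and_intros
      any_goals omega
      exact e _ hp'.symm

theorem sortBy_run (h : StrAt W s o m str) (hw : WorkSpace s m) (d : ℕ) (hd : d ≤ 2)
    {cnt : ℕ} {src : ℕ → ℕ} (hc : cnt ≤ m) (ho : s.var rO = o)
    (hcnt : s.var rCnt = cnt) (hkb : s.var rKb = m) (hsrc : ∀ x < cnt, src x ≤ m)
    (hA : ∀ x < cnt, s.arr aItem (x : ℕ) = src x) :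
    Run W (sortBy d) s (410 * (cnt + m + 1)) (fun s' =>
      (∃ π, StableSort (fun x => str (src x + d)) cnt π ∧
        ∀ x < cnt, s'.arr aItem (x : ℕ) = src (π x)) ∧
      Frame [rOff, rJ, rTmp, rSum] [aItem, aSorted, aCount] s s') := by
  have h1 := h.size
  have h2 := h.fit
  have e1 : Exec W (assign rOff (.add (.var rO) (.lit d))) s 4 (s.setVar rOff (o + d)) := by
    refine .assign s rOff _ _ ((Expr.eval_eq_some_iff _).2 ⟨?_, ?_⟩)
    · simp [ho]
      omega
    · simp [ho]
  have f1 : Frame [rOff] [] s (s.setVar rOff (o + d)) :=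
    ⟨fun x hx => by simp at hx; simp [hx], fun _ _ => rfl, rfl, rfl⟩
  have hin : SortInput W (s.setVar rOff (o + d)) cnt m (o + d) src (fun x => str (src x + d)) :=
    { cnt_lt := by omega
      kb_lt := by omega
      off_fit := by omega
      cnt_eq := by simp [hcnt]
      kb_eq := by simp [hkb]
      off_eq := by simp
      size_item := hc.trans hw.item
      size_sorted := hc.trans hw.sorted
      size_count := hw.count
      item := hA
      item_fit := fun j hj => by have := hsrc j hj; omega
      key_eq := fun j hj => by
        have := h.arr (src j + d) (by have := hsrc j hj; omega)
        push_cast at this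
        simp only [Store.setVar_arr]
        rw [← this]
        congr 1
        ring
      key_le := fun j hj => h.le _
      key_ok := fun j hj => by
        have := hsrc j hj
        simp only [Store.setVar_size]
        omega }
  obtain ⟨t2, s2, e2, b2, p2, f2⟩ := sortPass_run hin
  exact ⟨_, _, .seq _ _ _ _ _ _ _ e1 e2, by omega, p2,
    (f1.mono (by decide) (by decide)).trans (f2.mono (by decide) (by decide))⟩

theorem pushLevel_run (h : StrAt W s o m str) {d : ℕ} (ho : s.var rO = o) (hm : s.var rM = m)
    (hd : s.var rD = d) (hd1 : d < s.size aOffs) (hd2 : d < s.size aLens) (hdW : (d : ℤ) + 1 < W)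
    (hW : (o : ℤ) + m + 3 < W) :
    Run W pushLevel s 40 (fun s' => (s'.var rD = (d + 1 : ℕ) ∧ s'.var rNext = (o + m + 3 : ℕ) ∧
      s'.var rName = 0 ∧ s'.var rTripA = -1 ∧
      s'.var rTripB = -1 ∧ s'.var rTripC = -1 ∧
      (∀ i, s'.arr aOffs i = if i = d then (o : ℤ) else s.arr aOffs i) ∧
      (∀ i, s'.arr aLens i = if i = d then (m : ℤ) else s.arr aLens i)) ∧
      Frame [rD, rNext, rName, rTripA, rTripB, rTripC] [aOffs, aLens] s s') := by
  have h1 := h.size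
  have h2 := h.fit
  refine (Ter.run (c := pushLevel) ?_ rfl).frame rfl |>.mono (by decide) (fun _ h => h)
  simp [pushLevel, hm, ho, hd]
  omega

end


section

variable {W : ℕ} {s : Store} {o m : ℕ} {str : ℕ → ℕ}

theorem StrAt.letter (h : StrAt W s o m str) {p : ℕ} (hp : p ≤ m) :
    s.arr aStr ((o : ℤ) + p) = str p ∧ s.arr aStr ((o : ℤ) + p + 1) = str (p + 1) ∧
      s.arr aStr ((o : ℤ) + p + 2) = str (p + 2) := by
  refine ⟨h.arr p (by omega), ?_, ?_⟩
  · rw [← h.arr (p + 1) (by omega)]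
    push_cast
    rw [add_assoc]
  · rw [← h.arr (p + 2) (by omega)]
    push_cast
    rw [add_assoc]

theorem nameTriples_run (h : StrAt W s o m str) (h1m : 1 ≤ m) {g : ℕ → ℕ}
    (hg : SortsTriples str m g) (ho : s.var rO = o)
    (hhalf : s.var rHalf = ((m + 2) / 3 : ℕ)) (hcnt : s.var rCnt = (sampleCard m : ℕ))
    (hz : sampleCard m ≤ s.size aItem) (hz' : o + m + 3 + sampleCard m ≤ s.size aStr)
    (hA : ∀ x < sampleCard m, s.arr aItem (x : ℕ) = g x)
    (hnext : s.var rNext = (o + m + 3 : ℕ)) (hname : s.var rName = 0) (ha : s.var rTripA = -1)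
    (hb : s.var rTripB = -1) (hc : s.var rTripC = -1) :
    Run W nameTriples s (sampleCard m * 120 + 120) (fun s' =>
      ((∀ x < sampleCard m, s'.arr aStr ((o : ℤ) + m + 3 + (sampleIdx m (g x) : ℕ)) =
        tripleName str g (x + 1)) ∧
      (∀ i : ℤ, (i < o + m + 3 ∨ o + m + 3 + sampleCard m ≤ i) →
        s'.arr aStr i = s.arr aStr i)) ∧
      Frame [rJ, rPos, rName, rTripA, rTripB, rTripC] [aStr] s s') := by
  have h1 := h.size
  have h2 := h.fit
  have h3 := sampleCard_le m h1m
  refine (Run.forLt 120 (sampleCard m) (fun j s' =>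
    (s'.var rName = tripleName str g j ∧
    s'.var rTripA = (if j = 0 then -1 else (str (g (j - 1)) : ℤ)) ∧
    s'.var rTripB = (if j = 0 then -1 else (str (g (j - 1) + 1) : ℤ)) ∧
    s'.var rTripC = (if j = 0 then -1 else (str (g (j - 1) + 2) : ℤ))) ∧
    (∀ x < j, s'.arr aStr ((o : ℤ) + m + 3 + (sampleIdx m (g x) : ℕ)) = tripleName str g (x + 1)) ∧
    (∀ i : ℤ, (i < o + m + 3 ∨ o + m + 3 + sampleCard m ≤ i) → s'.arr aStr i = s.arr aStr i))
    (by omega) (by decide) rfl (by decide) ?_ ?_ ?_).mono le_rfl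
    (fun s' h => ⟨h.1.2, h.2.2.mono (by decide) (by decide)⟩)
  · intro v s' hv f hs _
    simp [f.var, hcnt]
    omega
  · simp [tripleName, hname, ha, hb, hc]
  · rintro v s' hv f hs ⟨⟨i1, i2, i3, i4⟩, i5, i6⟩
    obtain ⟨k, hk, hgk⟩ := hg.sample v hv
    have hgm : g v ≤ m := hgk ▸ samplePos_le hk
    have hidx : sampleIdx m (g v) = k := by rw [hgk, sampleIdx_samplePos]
    have hstr : StrAt W s' o m str :=
      { h with
        arr := fun i hi => by rw [i6 _ (by omega)]; exact h.arr i hi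
        size := by rw [f.size]; exact h.size
        fit := by rw [f.size]; exact h.fit }
    obtain ⟨l0, l1, l2⟩ := hstr.letter hgm
    have b0 := h.le (g v)
    have b1 := h.le (g v + 1)
    have b2 := h.le (g v + 2)
    have ha' : -1 ≤ s'.var rTripA ∧ s'.var rTripA ≤ m := by
      have := h.le (g (v - 1))
      rw [i2]
      split_ifs <;> omega
    have hb' : -1 ≤ s'.var rTripB ∧ s'.var rTripB ≤ m := by
      have := h.le (g (v - 1) + 1)
      rw [i3]
      split_ifs <;> omega
    have hc' : -1 ≤ s'.var rTripC ∧ s'.var rTripC ≤ m := by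
      have := h.le (g (v - 1) + 2)
      rw [i4]
      split_ifs <;> omega
    have hnm := tripleName_le str g v
    have hnm' := tripleName_le str g (v + 1)
    have hcond : (s'.var rTripA = str (g v) ∧ s'.var rTripB = str (g v + 1) ∧
        s'.var rTripC = str (g v + 2)) ↔ (0 < v ∧ TripleEq str (g (v - 1)) (g v)) := by
      rw [i2, i3, i4]
      unfold TripleEq
      split_ifs with hv0
      · constructor
        · rintro ⟨e1, -⟩
          exact e1.elim
        · rintro ⟨e1, -⟩
          omega
      · constructor
        · rintro ⟨e1, e2, e3⟩
          exact ⟨by omega, by exact_mod_cast e1, by exact_mod_cast e2, by exact_mod_cast e3⟩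
        · rintro ⟨-, e1, e2, e3⟩
          exact ⟨by exact_mod_cast e1, by exact_mod_cast e2, by exact_mod_cast e3⟩
    simp only [block]
    rw [Ter_seq, Ter_assign]
    refine ⟨?_, ?_⟩
    · simp [hs, f.arr, f.size, hA v hv]
      omega
    rw [Ter_seq]
    refine Ter.mono (Q := fun t => t.var rName = tripleName str g (v + 1) ∧
      t.var rTripA = str (g v) ∧ t.var rTripB = str (g v + 1) ∧ t.var rTripC = str (g v + 2) ∧
      t.var rPos = g v ∧ t.var rNext = (o + m + 3 : ℕ) ∧ t.var rHalf = ((m + 2) / 3 : ℕ) ∧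
      t.arr = s'.arr ∧ t.size = s.size) ?_ ?_
    · have hnm1 : tripleName str g (v + 1) = if 0 < v ∧ TripleEq str (g (v - 1)) (g v) then
        tripleName str g v else tripleName str g v + 1 := rfl
      simp [letterExpr, hs, f.arr, f.size, f.var, hA v hv, ho, l0, l1, l2, hnext, hhalf, i1]
      constructor
      · omega
      constructor
      · intro c1 c2 c3
        rw [if_pos (hcond.1 ⟨c1, c2, c3⟩)] at hnm1
        rw [hnm1]
        simp [c1, c2, c3]
      · intro hcd
        rw [if_neg (fun hc => hcd (hcond.2 hc).1 (hcond.2 hc).2.1 (hcond.2 hc).2.2)] at hnm1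
        rw [hnm1]
        push_cast
        omega
    · rintro t ⟨t1, t2, t3, t4, t5, t6, t7, t8, t9⟩
      have fin : ∀ y : ℤ, y = o + m + 3 + (sampleIdx m (g v) : ℕ) →
          (∀ x < v + 1, (if (o : ℤ) + m + 3 + (sampleIdx m (g x) : ℕ) = y then
            (tripleName str g (v + 1) : ℤ) else
            s'.arr aStr ((o : ℤ) + m + 3 + (sampleIdx m (g x) : ℕ))) = tripleName str g (x + 1)) ∧
          (∀ i : ℤ, (i < o + m + 3 ∨ o + m + 3 + sampleCard m ≤ i) →
            (if i = y then (tripleName str g (v + 1) : ℤ) else s'.arr aStr i) = s.arr aStr i) := by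
        rintro y rfl
        refine ⟨fun x hx => ?_, fun i hi => ?_⟩
        · rcases Nat.lt_succ_iff_lt_or_eq.1 hx with hxv | rfl
          · obtain ⟨k', hk', hgk'⟩ := hg.sample x (hxv.trans hv)
            rw [if_neg, i5 x hxv]
            intro hcon
            have hcon' : sampleIdx m (g x) = sampleIdx m (g v) := by omega
            rw [hidx, hgk', sampleIdx_samplePos] at hcon'
            exact hg.inj x v hxv hv (by rw [hgk, hgk', hcon'])
          · rw [if_pos rfl]
        · rw [if_neg (by omega), i6 i hi]
      rw [Ter_ite, Ter_put, Ter_put]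
      simp only [Cond.ok, Cond.holds, Expr.ok, Expr.val, t1, t5, t6, t7, t9,
        Store.setVar_var, Store.setVar_arr, Store.setCell_var, Store.setCell_arr, t2, t3, t4, t8,
        Nat.add_sub_cancel, if_true]
      have hm3 := samplePos_mod (m := m) (k := k)
      rw [← hgk] at hm3
      constructor
      · omega
      constructor
      · intro hmod
        have hi : sampleIdx m (g v) = g v / 3 := by
          unfold sampleIdx
          rw [if_pos (by omega)]
        have := fin _ (by rw [hi])
        push_cast at this ⊢
        refine ⟨by omega, by omega, by omega, ?_, this⟩
        simp
      · intro hmod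
        have hi : sampleIdx m (g v) = (m + 2) / 3 + g v / 3 := by
          unfold sampleIdx
          rw [if_neg (by omega)]
        have := fin ((o : ℤ) + m + 3 + ((m + 2) / 3 : ℕ) + (g v : ℤ) / 3)
          (by rw [hi]; push_cast; ring)
        push_cast at this ⊢
        refine ⟨by omega, by omega, by omega, ?_, this⟩
        simp

theorem descend_run (h : StrAt W s o m str) (hw : WorkSpace s m) (h2m : 2 ≤ m) {d : ℕ}
    (ho : s.var rO = o) (hm : s.var rM = m) (hd : s.var rD = d) (hd1 : d < s.size aOffs)
    (hd2 : d < s.size aLens) (hdW : (d : ℤ) + 1 < W)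
    (hz : o + m + 3 + sampleCard m + 2 < s.size aStr)
    (hzero : ∀ i : ℤ, (o : ℤ) + m ≤ i → s.arr aStr i = 0) :
    Run W descend s (4000 * m) (fun s' => ∃ str', Reduces str m str' ∧
      StrAt W s' (o + m + 3) (sampleCard m) str' ∧ s'.var rO = (o + m + 3 : ℕ) ∧
      s'.var rM = sampleCard m ∧ s'.var rD = (d + 1 : ℕ) ∧
      (∀ i : ℤ, (o + m + 3 : ℕ) + (sampleCard m : ℤ) ≤ i → s'.arr aStr i = 0) ∧
      (∀ i : ℤ, i < (o : ℤ) + m + 3 → s'.arr aStr i = s.arr aStr i) ∧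
      (∀ i, s'.arr aOffs i = if i = d then (o : ℤ) else s.arr aOffs i) ∧
      (∀ i, s'.arr aLens i = if i = d then (m : ℤ) else s.arr aLens i) ∧
      s'.size = s.size ∧ s'.used = s.used) := by
  have hsz := h.size
  have hfit := h.fit
  have hcm := sampleCard_le m (by omega)
  obtain ⟨t1, s1, e1, b1, ⟨p1, q1, r1⟩, f1⟩ := sampleSizes_run h hm
  have h1 := h.frame f1 (by decide)
  have w1 := hw.frame f1
  obtain ⟨t2, s2, e2, b2, p2, f2⟩ := fillSample_run h1 w1 (by omega) p1 q1
  have h2 := h1.frame f2 (by decide)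
  have w2 := w1.frame f2
  have f12 := (f1.mono (X' := [rHalf, rCnt, rKb, rJ]) (Y' := [aItem]) (by decide) (by decide)).trans
    (f2.mono (by decide) (by decide))
  obtain ⟨t3, s3, e3, b3, ⟨π₁, hπ₁, p3⟩, f3⟩ := sortBy_run h2 w2 2 le_rfl (src := samplePos m) hcm
    (by rw [f12.var _ (by decide), ho]) (by rw [f2.var _ (by decide), q1])
    (by rw [f2.var _ (by decide), r1]) (fun x hx => samplePos_le hx) p2
  have h3 := h2.frame f3 (by decide)
  have w3 := w2.frame f3
  have f13 := (f12.mono (X' := [rHalf, rCnt, rKb, rOff, rJ, rTmp, rSum])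
    (Y' := [aItem, aSorted, aCount]) (by decide) (by decide)).trans
    (f3.mono (by decide) (by decide))
  obtain ⟨t4, s4, e4, b4, ⟨π₂, hπ₂, p4⟩, f4⟩ := sortBy_run h3 w3 1 (by omega)
    (src := fun x => samplePos m (π₁ x)) hcm
    (by rw [f13.var _ (by decide), ho]) (by rw [f3.var _ (by decide), f2.var _ (by decide), q1])
    (by rw [f3.var _ (by decide), f2.var _ (by decide), r1])
    (fun x hx => samplePos_le (hπ₁.lt x hx)) p3
  have h4 := h3.frame f4 (by decide)
  have w4 := w3.frame f4
  have f14 := f13.trans (f4.mono (by decide) (by decide))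
  obtain ⟨t5, s5, e5, b5, ⟨π₃, hπ₃, p5⟩, f5⟩ := sortBy_run h4 w4 0 (by omega)
    (src := fun x => samplePos m (π₁ (π₂ x))) hcm
    (by rw [f14.var _ (by decide), ho])
    (by rw [f4.var _ (by decide), f3.var _ (by decide), f2.var _ (by decide), q1])
    (by rw [f4.var _ (by decide), f3.var _ (by decide), f2.var _ (by decide), r1])
    (fun x hx => samplePos_le (hπ₁.lt _ (hπ₂.lt x hx))) p4
  have hg := sortsTriples_of_stableSort hπ₁ hπ₂ hπ₃
  have h5 := h4.frame f5 (by decide)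
  have f15 := f14.trans (f5.mono (by decide) (by decide))
  have f25 := ((f3.mono (X' := [rOff, rJ, rTmp, rSum])
    (Y' := [aItem, aSorted, aCount]) (by decide) (by decide)).trans f4).trans f5
  obtain ⟨t6, s6, e6, b6, ⟨p6, p7, p8, p9, p10, p11, p12, p13⟩, f6⟩ := pushLevel_run h5 (d := d)
    (by rw [f15.var _ (by decide), ho]) (by rw [f15.var _ (by decide), hm])
    (by rw [f15.var _ (by decide), hd]) (by rwa [f15.size]) (by rwa [f15.size]) hdW (by omega)
  have h6 := h5.frame f6 (by decide)
  obtain ⟨t7, s7, e7, b7, ⟨p14, p15⟩, f7⟩ := nameTriples_run h6 (by omega) hg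
    (by rw [f6.var _ (by decide), f15.var _ (by decide), ho])
    (by rw [f6.var _ (by decide), f25.var _ (by decide), f2.var _ (by decide), p1])
    (by rw [f6.var _ (by decide), f25.var _ (by decide), f2.var _ (by decide), q1])
    (by rw [f6.size, f15.size]; exact hcm.trans hw.item)
    (by rw [f6.size, f15.size]; omega)
    (by rw [f6.arr _ (by decide)]; exact p5) p7 p8 p9 p10 p11
  have hsize : s7.size = s.size := by rw [f7.size, f6.size, f15.size]
  have c7 : s7.var rCnt = sampleCard m := by
    rw [f7.var _ (by decide), f6.var _ (by decide), f25.var _ (by decide), f2.var _ (by decide), q1]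
  have n7 : s7.var rNext = (o + m + 3 : ℕ) := by rw [f7.var _ (by decide), p7]
  have arr6 : s6.arr aStr = s.arr aStr := by rw [f6.arr _ (by decide), f15.arr _ (by decide)]
  obtain ⟨t8, s8, e8, b8, p16⟩ := (Ter.run (W := W) (s := s7)
    (c := block [assign rO (.var rNext), assign rM (.var rCnt)])
    (Q := fun t => t = (s7.setVar rO (o + m + 3 : ℕ)).setVar rM (sampleCard m : ℕ))
    (by
      simp [c7, n7]
      omega) rfl)
  refine ⟨_, _, .seq _ _ _ _ _ _ _ e1 <| .seq _ _ _ _ _ _ _ e2 <| .seq _ _ _ _ _ _ _ e3 <|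
    .seq _ _ _ _ _ _ _ e4 <| .seq _ _ _ _ _ _ _ e5 <| .seq _ _ _ _ _ _ _ e6 <|
    .seq _ _ _ _ _ _ _ e7 e8, ?_, ?_⟩
  · have : maxCost (block [assign rO (.var rNext), assign rM (.var rCnt)]) = 4 := rfl
    omega
  subst p16
  set str' : ℕ → ℕ := fun k => if k < sampleCard m then
    (s7.arr aStr ((o : ℤ) + m + 3 + k)).toNat else 0 with hstr'
  have hred : Reduces str m str' := by
    refine hg.reduces (fun k hk => if_neg (by omega)) (fun x hx => ?_)
    have hlt : sampleIdx m (samplePos m (π₁ (π₂ (π₃ x)))) < sampleCard m := by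
      rw [sampleIdx_samplePos]
      exact hπ₁.lt _ (hπ₂.lt _ (hπ₃.lt x hx))
    have := p14 x hx
    simp only [hstr', if_pos hlt, this, Int.toNat_natCast]
  have hrest : ∀ i : ℤ, (o + m + 3 : ℕ) + (sampleCard m : ℤ) ≤ i → s7.arr aStr i = 0 := by
    intro i hi
    rw [p15 i (by omega), arr6, hzero i (by omega)]
  refine ⟨str', hred, ⟨hred.str, hred.le, fun i hi => ?_, ?_, ?_⟩, by simp, by simp, ?_, hrest,
    fun i hi => ?_, fun i => ?_, fun i => ?_, hsize, ?_⟩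
  · simp only [Store.setVar_arr, hstr']
    split_ifs with hlt
    · obtain ⟨x, hx, he⟩ := hg.exists_eq i hlt
      have := p14 x hx
      rw [he, sampleIdx_samplePos] at this
      push_cast
      rw [this]
      simp
    · push_cast
      exact hrest _ (by push_cast; omega)
  · simp only [Store.setVar_size, hsize]
    omega
  · simp only [Store.setVar_size, hsize]
    exact hfit
  · simp only [Store.setVar_var, f7.var rD (by decide), p6]
    simp
  · simp only [Store.setVar_arr]
    rw [p15 i (by omega), arr6]
  · simp only [Store.setVar_arr]
    rw [f7.arr _ (by decide), p12, f15.arr _ (by decide)]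
  · simp only [Store.setVar_arr]
    rw [f7.arr _ (by decide), p13, f15.arr _ (by decide)]
  · simp only [Store.setVar_used]
    rw [f7.used, f6.used, f15.used]

end


/-! ### Lists of the suffixes in the residue classes -/

theorem exists_of_lt_count (p : ℕ → Prop) [DecidablePred p] {a j : ℕ} (h : a < Nat.count p j) :
    ∃ x < j, p x ∧ Nat.count p x = a := by
  induction j with
  | zero => simp at h
  | succ j ih =>
    rw [Nat.count_succ] at h
    by_cases hlt : a < Nat.count p j
    · obtain ⟨x, hx, hx'⟩ := ih hlt
      exact ⟨x, by omega, hx'⟩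
    · split_ifs at h with hp
      · exact ⟨j, by omega, hp, by omega⟩
      · omega

theorem count_comp_perm (p : ℕ → Prop) [DecidablePred p] {s f : ℕ → ℕ} {m : ℕ}
    (hf : IsSorted s m f) : Nat.count (fun x => p (f x)) m = Nat.count p m := by
  rw [Nat.count_eq_card_filter_range, Nat.count_eq_card_filter_range]
  refine Finset.card_nbij f (fun x hx => ?_) (fun x hx y hy he => ?_) (fun i hi => ?_)
  · simp only [Finset.mem_coe, Finset.mem_filter, Finset.mem_range] at hx ⊢
    exact ⟨hf.lt x hx.1, hx.2⟩
  · simp only [Finset.coe_filter, Set.mem_ofPred_eq, Finset.mem_range] at hx hy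
    exact hf.inj hx.1 hy.1 he
  · simp only [Finset.coe_filter, Set.mem_ofPred_eq, Finset.mem_range] at hi
    obtain ⟨x, hx, rfl⟩ := hf.exists hi.1
    exact ⟨x, by simp [hx, hi.2], rfl⟩

theorem count_lt_half (m : ℕ) : Nat.count (fun k => k < (m + 2) / 3) (sampleCard m) =
    (m + 2) / 3 := by
  have : (Finset.range (sampleCard m)).filter (fun k => k < (m + 2) / 3) =
      Finset.range ((m + 2) / 3) := by
    ext k
    simp only [Finset.mem_filter, Finset.mem_range, sampleCard]
    omega
  rw [Nat.count_eq_card_filter_range, this, Finset.card_range]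

theorem count_samplePos_lt (m : ℕ) (hm : 1 ≤ m) :
    Nat.count (fun k => samplePos m k < m) (sampleCard m) = m - (m + 2) / 3 := by
  rw [Nat.count_eq_card_filter_range]
  by_cases h1 : m % 3 = 1
  · have : (Finset.range (sampleCard m)).filter (fun k => samplePos m k < m) =
        (Finset.range (sampleCard m)).erase ((m + 2) / 3 - 1) := by
      ext k
      simp only [Finset.mem_filter, Finset.mem_range, Finset.mem_erase]
      unfold sampleCard samplePos
      split_ifs <;> omega
    rw [this, Finset.card_erase_of_mem, Finset.card_range]
    · unfold sampleCard
      omega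
    · simp only [Finset.mem_range, sampleCard]
      omega
  · have : (Finset.range (sampleCard m)).filter (fun k => samplePos m k < m) =
        Finset.range (sampleCard m) := by
      ext k
      simp only [Finset.mem_filter, Finset.mem_range]
      unfold sampleCard samplePos
      split_ifs <;> omega
    rw [this, Finset.card_range]
    unfold sampleCard
    omega

theorem count_lt_of_lt (p : ℕ → Prop) [DecidablePred p] {x y : ℕ} (h : Nat.count p x < Nat.count p y) :
    x < y := by
  by_contra hcon
  exact absurd (Nat.count_monotone p (not_lt.1 hcon)) (by omega)

theorem count_lt_count (p : ℕ → Prop) [DecidablePred p] {x y : ℕ} (hp : p x) (h : x < y) :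
    Nat.count p x < Nat.count p y := by
  have := Nat.count_monotone p (show x + 1 ≤ y from h)
  rw [Nat.count_succ, if_pos hp] at this
  omega

/-! ### Returning from the string of names -/

/-- Next item of the first list. -/
notation "rIdxA" => (26 : ℕ)
/-- Next item of the second list. -/
notation "rIdxB" => (27 : ℕ)
/-- Length of the second list. -/
notation "rLenB" => (28 : ℕ)
/-- Result of a comparison. -/
notation "rFlag" => (29 : ℕ)
/-- Current sample index. -/
notation "rIdx" => (30 : ℕ)
/-- Current position in the second list. -/
notation "rPosB" => (31 : ℕ)

/-- Ranks of the sample suffixes. -/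
notation "aRank" => (26 : ℕ)
/-- Sorted sample positions. -/
notation "aSample" => (27 : ℕ)
/-- Sorted suffixes. -/
notation "aSuf" => (28 : ℕ)

/-- Restore the string on top of the stack. -/
def popLevel : Cmd := block [
  assign rD (.sub (.var rD) (.lit 1)),
  assign rO (.get aOffs (.var rD)),
  assign rM (.get aLens (.var rD)),
  sampleSizes,
  assign rIdxA (.lit 0),
  assign rLenB (.lit 0)]

/-- Set all ranks to zero. -/
def clearRanks : Cmd := forLt rJ (.add (.var rM) (.lit 2)) (put aRank (.var rJ) (.lit 0))

/-- Rank the sample suffixes and list the positions congruent to `0` in the order of their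
successors. -/
def spreadRanks : Cmd := forLt rJ (.var rCnt) (block [
  assign rIdx (.get aSuf (.var rJ)),
  ite (.lt (.var rIdx) (.var rHalf))
    (assign rPos (.add (.mul (.lit 3) (.var rIdx)) (.lit 1)))
    (assign rPos (.add (.mul (.lit 3) (.sub (.var rIdx) (.var rHalf))) (.lit 2))),
  put aRank (.var rPos) (.add (.var rJ) (.lit 1)),
  whenever (.lt (.var rIdx) (.var rHalf)) (block [
    put aItem (.var rIdxA) (.mul (.lit 3) (.var rIdx)),
    assign rIdxA (.add (.var rIdxA) (.lit 1))]),
  whenever (.lt (.var rPos) (.var rM)) (block [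
    put aSample (.var rLenB) (.var rPos),
    assign rLenB (.add (.var rLenB) (.lit 1))])])

section

variable {W : ℕ} {s : Store} {o m : ℕ} {str : ℕ → ℕ}

theorem popLevel_run (h : StrAt W s o m str) {d : ℕ} (hd : s.var rD = (d + 1 : ℕ))
    (hd1 : d < s.size aOffs) (hd2 : d < s.size aLens) (hdW : (d : ℤ) + 1 < W)
    (ho : s.arr aOffs d = o) (hm : s.arr aLens d = m) :
    Run W popLevel s 50 (fun s' => (s'.var rD = d ∧ s'.var rO = o ∧ s'.var rM = m ∧
      s'.var rHalf = ((m + 2) / 3 : ℕ) ∧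
      s'.var rCnt = (sampleCard m : ℕ) ∧ s'.var rKb = m ∧ s'.var rIdxA = 0 ∧ s'.var rLenB = 0) ∧
      Frame [rD, rO, rM, rHalf, rCnt, rKb, rIdxA, rLenB] [] s s') := by
  have h1 := h.size
  have h2 := h.fit
  refine (Ter.run (c := popLevel) ?_ rfl).frame rfl |>.mono (by decide) (fun _ h => h)
  simp [popLevel, sampleSizes, hm, ho, hd, sampleCard]
  omega

theorem clearRanks_run (h : StrAt W s o m str) (hm : s.var rM = m) (hz : m + 2 ≤ s.size aRank) :
    Run W clearRanks s ((m + 2) * 20 + 20) (fun s' =>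
      (∀ p < m + 2, s'.arr aRank (p : ℕ) = 0) ∧ Frame [rJ] [aRank] s s') := by
  have h1 := h.size
  have h2 := h.fit
  refine (Run.forLt 20 (m + 2) (fun j s' => ∀ p < j, s'.arr aRank (p : ℕ) = 0)
    (by push_cast; omega) (by decide) rfl (by decide) ?_ ?_ ?_).mono le_rfl
    (fun s' h => ⟨h.1, h.2.2⟩)
  · intro v s' hv f hs _
    simp [f.var, hm]
    omega
  · simp
  · intro v s' hv f hs hI
    simp [hs, f.size]
    refine ⟨by omega, by omega, fun u hu hne => hI u (by omega)⟩

theorem spreadRanks_run (h : StrAt W s o m str) (h1m : 1 ≤ m) {str' f : ℕ → ℕ}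
    (hf : IsSorted str' (sampleCard m) f) (hm : s.var rM = m)
    (hhalf : s.var rHalf = ((m + 2) / 3 : ℕ)) (hcnt : s.var rCnt = (sampleCard m : ℕ))
    (hA : s.var rIdxA = 0) (hB : s.var rLenB = 0)
    (hz1 : m + 2 ≤ s.size aRank) (hz2 : m ≤ s.size aItem) (hz3 : m ≤ s.size aSample)
    (hz4 : m ≤ s.size aSuf) (hsuf : ∀ x < sampleCard m, s.arr aSuf (x : ℕ) = f x)
    (hr : ∀ p < m + 2, s.arr aRank (p : ℕ) = 0) :
    Run W spreadRanks s (sampleCard m * 120 + 120) (fun s' =>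
      ((∀ p < m + 2, (∀ x < sampleCard m, p ≠ samplePos m (f x)) → s'.arr aRank (p : ℕ) = 0) ∧
      (∀ x < sampleCard m, s'.arr aRank (samplePos m (f x) : ℕ) = (x + 1 : ℕ)) ∧
      (∀ x < sampleCard m, f x < (m + 2) / 3 →
        s'.arr aItem (Nat.count (fun x => f x < (m + 2) / 3) x : ℕ) = (3 * f x : ℕ)) ∧
      (∀ x < sampleCard m, samplePos m (f x) < m →
        s'.arr aSample (Nat.count (fun x => samplePos m (f x) < m) x : ℕ) = samplePos m (f x)) ∧
      s'.var rIdxA = Nat.count (fun x => f x < (m + 2) / 3) (sampleCard m) ∧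
      s'.var rLenB = Nat.count (fun x => samplePos m (f x) < m) (sampleCard m)) ∧
      Frame [rJ, rIdx, rPos, rIdxA, rLenB] [aRank, aItem, aSample] s s') := by
  have h1 := h.size
  have h2 := h.fit
  have h3 := sampleCard_le m h1m
  refine (Run.forLt 120 (sampleCard m) (fun j s' =>
    (∀ p < m + 2, (∀ x < j, p ≠ samplePos m (f x)) → s'.arr aRank (p : ℕ) = 0) ∧
      (∀ x < j, s'.arr aRank (samplePos m (f x) : ℕ) = (x + 1 : ℕ)) ∧
      (∀ x < j, f x < (m + 2) / 3 →
        s'.arr aItem (Nat.count (fun x => f x < (m + 2) / 3) x : ℕ) = (3 * f x : ℕ)) ∧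
      (∀ x < j, samplePos m (f x) < m →
        s'.arr aSample (Nat.count (fun x => samplePos m (f x) < m) x : ℕ) = samplePos m (f x)) ∧
      s'.var rIdxA = Nat.count (fun x => f x < (m + 2) / 3) j ∧
      s'.var rLenB = Nat.count (fun x => samplePos m (f x) < m) j)
    (by omega) (by decide) rfl (by decide) ?_ ?_ ?_).mono le_rfl
    (fun s' h => ⟨h.1, h.2.2.mono (by decide) (by decide)⟩)
  · intro v s' hv f hs _
    simp [f.var, hcnt]
    omega
  · simpa [hA, hB] using hr
  · rintro v s' hv fr hs ⟨i1, i2, i3, i4, i5, i6⟩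
    have hfv := hf.lt v hv
    have hpm := samplePos_le hfv
    have cA := Nat.count_le (p := fun x => f x < (m + 2) / 3) (n := v)
    have cB := Nat.count_le (p := fun x => samplePos m (f x) < m) (n := v)
    have hinj : ∀ x < v, samplePos m (f x) ≠ samplePos m (f v) := by
      intro x hx he
      have := congrArg (sampleIdx m) he
      rw [sampleIdx_samplePos, sampleIdx_samplePos] at this
      have := hf.inj (hx.trans hv) hv this
      omega
    simp only [block]
    rw [Ter_seq, Ter_assign]
    refine ⟨?_, ?_⟩
    · simp [hs, fr.arr, fr.size, hsuf v hv]
      omega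
    rw [Ter_seq]
    refine Ter.mono (Q := fun t => t.var rPos = samplePos m (f v) ∧ t.var rIdx = f v ∧
      t.var rJ = v ∧ t.var rHalf = ((m + 2) / 3 : ℕ) ∧ t.var rM = m ∧
      t.var rIdxA = s'.var rIdxA ∧ t.var rLenB = s'.var rLenB ∧
      t.arr = s'.arr ∧ t.size = s.size) ?_ ?_
    · have hsp : (f v < (m + 2) / 3 ∧ samplePos m (f v) = 3 * f v + 1) ∨
          ((m + 2) / 3 ≤ f v ∧ samplePos m (f v) = 3 * (f v - (m + 2) / 3) + 2) := by
        unfold samplePos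
        split_ifs <;> omega
      simp [hs, fr.arr, fr.size, fr.var, hsuf v hv, hhalf, hm]
      omega
    rintro t ⟨t1, t2, t3, t4, t5, t6, t7, t8, t9⟩
    rw [Ter_seq, Ter_put]
    refine ⟨?_, ?_, ?_, ?_⟩
    · simp [t1]
      omega
    · simp [t3]
      omega
    · simp [t1, t9]
      omega
    have hv1 : ∀ u : Store, u.arr aRank = (t.setCell aRank (samplePos m (f v)) (v + 1)).arr aRank →
        (∀ p < m + 2, (∀ x < v + 1, p ≠ samplePos m (f x)) → u.arr aRank (p : ℕ) = 0) ∧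
        (∀ x < v + 1, u.arr aRank (samplePos m (f x) : ℕ) = (x + 1 : ℕ)) := by
      intro u hu
      rw [hu]
      refine ⟨fun p hp hne => ?_, fun x hx => ?_⟩
      · have := hne v (by omega)
        simp [this, t8, i1 p hp (fun x hx => hne x (by omega))]
      · rcases Nat.lt_succ_iff_lt_or_eq.1 hx with hx | rfl
        · simp [t8, hinj x hx, i2 x hx]
        · simp
    rw [Ter_seq]
    refine Ter.mono (Q := fun u => u.arr aRank = (t.setCell aRank (samplePos m (f v)) (v + 1)).arr
      aRank ∧ u.arr aSample = s'.arr aSample ∧ u.size = s.size ∧ u.var rPos = samplePos m (f v) ∧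
      u.var rM = m ∧ u.var rLenB = s'.var rLenB ∧
      (∀ x < v + 1, f x < (m + 2) / 3 →
        u.arr aItem (Nat.count (fun x => f x < (m + 2) / 3) x : ℕ) = (3 * f x : ℕ)) ∧
      u.var rIdxA = Nat.count (fun x => f x < (m + 2) / 3) (v + 1)) ?_ ?_
    · have hnew : ∀ x < v, f x < (m + 2) / 3 → Nat.count (fun x => f x < (m + 2) / 3) x ≠
          Nat.count (fun x => f x < (m + 2) / 3) v := fun x hx hp =>
        (count_lt_count (fun x => f x < (m + 2) / 3) hp hx).ne
      rw [Nat.count_succ]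
      simp only [whenever, Ter_ite, Ter_skip, Ter_seq, Ter_put, Ter_assign, Expr.ok,
        Expr.val, Cond.ok, Cond.holds, Store.setCell_var, Store.setVar_var, Store.setCell_size,
        Store.setVar_arr, Store.setVar_size, t1, t2, t3, t4, t5, t6, t7, t9, i5]
      constructor
      · omega
      constructor
      · intro hlt
        have hlt' : f v < (m + 2) / 3 := by exact_mod_cast hlt
        rw [if_pos hlt']
        and_intros
        any_goals omega
        · funext i
          simp
        · funext i
          simp [t8]
        · simp
        · intro x hx hp
          rcases Nat.lt_succ_iff_lt_or_eq.1 hx with hx | rfl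
          · simp [t8, hnew x hx hp, i3 x hx hp]
          · simp
        · simp
      · intro hlt
        have hlt' : ¬ f v < (m + 2) / 3 := by exact_mod_cast hlt
        rw [if_neg hlt']
        refine ⟨trivial, by funext i; simp [t8], trivial, trivial, trivial, trivial,
          fun x hx hp => ?_, by simp⟩
        rcases Nat.lt_succ_iff_lt_or_eq.1 hx with hx | rfl
        · simp [t8, i3 x hx hp]
        · exact absurd hp hlt'
    rintro u ⟨u1, u2, u3, u4, u5, u6, u7, u8⟩
    obtain ⟨w1, w2⟩ := hv1 u u1
    have hnew : ∀ x < v, samplePos m (f x) < m → Nat.count (fun x => samplePos m (f x) < m) x ≠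
        Nat.count (fun x => samplePos m (f x) < m) v := fun x hx hp =>
      (count_lt_count (fun x => samplePos m (f x) < m) hp hx).ne
    rw [Nat.count_succ (fun x => samplePos m (f x) < m)]
    simp only [whenever, Ter_ite, Ter_skip, Ter_seq, Ter_put, Ter_assign, Expr.ok,
      Expr.val, Cond.ok, Cond.holds, Store.setCell_var, Store.setVar_var,
      Store.setVar_arr, u3, u4, u5, u6, i6]
    constructor
    · omega
    constructor
    · intro hlt
      have hlt' : samplePos m (f v) < m := by exact_mod_cast hlt
      rw [if_pos hlt']
      and_intros
      any_goals omega
      · simpa using w1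
      · simpa using w2
      · simpa using u7
      · intro x hx hp
        rcases Nat.lt_succ_iff_lt_or_eq.1 hx with hx | rfl
        · simp [u2, hnew x hx hp, i4 x hx hp]
        · simp
      · simp
    · intro hlt
      have hlt' : ¬ samplePos m (f v) < m := by exact_mod_cast hlt
      rw [if_neg hlt']
      refine ⟨w1, w2, u7, fun x hx hp => ?_, by simp [u8], by simp⟩
      rcases Nat.lt_succ_iff_lt_or_eq.1 hx with hx | rfl
      · simp [u2, i4 x hx hp]
      · exact absurd hp hlt'

end


/-- The letter at distance `d` from the position in the second list. -/
def letterExprB (d : ℤ) : Expr := .get aStr (.add (.add (.var rO) (.var rPosB)) (.lit d))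

/-- Compare the suffixes at the heads of the two lists. -/
def compareHeads : Cmd := block [
  assign rFlag (.lit 0),
  ite (.eq (.mod (.var rPosB) (.lit 3)) (.lit 1))
    (ite (.lt (letterExpr 0) (letterExprB 0)) (assign rFlag (.lit 1))
      (whenever (.and (.eq (letterExpr 0) (letterExprB 0))
          (.lt (.get aRank (.add (.var rPos) (.lit 1))) (.get aRank (.add (.var rPosB) (.lit 1)))))
        (assign rFlag (.lit 1))))
    (ite (.lt (letterExpr 0) (letterExprB 0)) (assign rFlag (.lit 1))
      (whenever (.eq (letterExpr 0) (letterExprB 0))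
        (ite (.lt (letterExpr 1) (letterExprB 1)) (assign rFlag (.lit 1))
          (whenever (.and (.eq (letterExpr 1) (letterExprB 1))
              (.lt (.get aRank (.add (.var rPos) (.lit 2)))
                (.get aRank (.add (.var rPosB) (.lit 2)))))
            (assign rFlag (.lit 1))))))]

/-- Choose the list with the smaller head. -/
def chooseList : Cmd :=
  ite (.eq (.var rIdxB) (.var rLenB)) (assign rFlag (.lit 1))
    (ite (.eq (.var rIdxA) (.var rHalf)) (assign rFlag (.lit 0)) (block [
      assign rPos (.get aItem (.var rIdxA)),
      assign rPosB (.get aSample (.var rIdxB)),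
      compareHeads]))

/-- Merge the two lists. -/
def mergeLists : Cmd := forLt rJ (.var rM) (block [
  chooseList,
  ite (.eq (.var rFlag) (.lit 1))
    (block [put aSuf (.var rJ) (.get aItem (.var rIdxA)),
      assign rIdxA (.add (.var rIdxA) (.lit 1))])
    (block [put aSuf (.var rJ) (.get aSample (.var rIdxB)),
      assign rIdxB (.add (.var rIdxB) (.lit 1))])])

section

variable {W : ℕ} {s : Store} {o m : ℕ} {str : ℕ → ℕ}

theorem compareHeads_ter (h : StrAt W s o m str) (ho : s.var rO = o) {p q : ℕ}
    (hp : s.var rPos = p) (hq : s.var rPosB = q) (hpm : p < m) (hqm : q < m) (hp3 : p % 3 = 0)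
    (hq3 : q % 3 ≠ 0) {str' f r : ℕ → ℕ} (hr : Reduces str m str')
    (hf : IsSorted str' (sampleCard m) f) (hrk : IsSampleRank m f r)
    (hrW : ∀ x, (r x : ℤ) ≤ W) (hz : m + 2 ≤ s.size aRank)
    (hrarr : ∀ x < m + 2, s.arr aRank (x : ℕ) = r x) :
    Ter W compareHeads s (fun s' => ((s'.var rFlag = 1 ∧ Slt str p q) ∨
      (s'.var rFlag = 0 ∧ ¬ Slt str p q))) := by
  have h1 := h.size
  have h2 := h.fit
  obtain ⟨l0, l1, l2⟩ := h.letter hpm.le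
  obtain ⟨k0, k1, k2⟩ := h.letter hqm.le
  have b0 := h.le p
  have b1 := h.le (p + 1)
  have c0 := h.le q
  have c1 := h.le (q + 1)
  have r1 := hrarr (p + 1) (by omega)
  have r2 := hrarr (p + 2) (by omega)
  have r3 := hrarr (q + 1) (by omega)
  have r4 := hrarr (q + 2) (by omega)
  have w1 := hrW (p + 1)
  have w2 := hrW (p + 2)
  have w3 := hrW (q + 1)
  have w4 := hrW (q + 2)
  push_cast at r1 r2 r3 r4
  have hne : p ≠ q := by
    rintro rfl
    exact hq3 hp3
  have key1 : q % 3 = 1 → (Slt str p q ↔ str p < str q ∨ str p = str q ∧ r (p + 1) < r (q + 1)) :=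
    fun hq1 => hrk.slt_iff_pair h.isStr hr hf hne hpm hqm (by omega) (by omega)
  have key2 : q % 3 ≠ 1 → (Slt str p q ↔ str p < str q ∨ str p = str q ∧
      (str (p + 1) < str (q + 1) ∨ str (p + 1) = str (q + 1) ∧ r (p + 2) < r (q + 2))) :=
    fun hq1 => hrk.slt_iff_triple h.isStr hr hf hne hpm hqm (by omega) (by omega)
  have hmod : ((q : ℤ) % 3 = 1) ↔ q % 3 = 1 := by omega
  simp [compareHeads, letterExpr, letterExprB, ho, hp, hq, l0, l1, k0, k1, r1, r2, r3, r4, hmod]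
  refine ⟨by omega, fun hq1 => ?_, fun hq1 => ?_⟩
  · simp only [key1 hq1]
    omega
  · simp only [key2 hq1]
    omega

/-- Two sorted lists, `ga` and `gb`, of the positions below `m`. -/
structure MergeInput (W : ℕ) (s : Store) (m : ℕ) (str : ℕ → ℕ) (na nb : ℕ) (ga gb : ℕ → ℕ) :
    Prop where
  add : na + nb = m
  lt_a : ∀ x < na, ga x < m ∧ ga x % 3 = 0
  lt_b : ∀ x < nb, gb x < m ∧ gb x % 3 ≠ 0
  slt_a : ∀ x y, x < y → y < na → Slt str (ga x) (ga y)
  slt_b : ∀ x y, x < y → y < nb → Slt str (gb x) (gb y)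
  half_eq : s.var rHalf = na
  len_eq : s.var rLenB = nb
  size_a : na ≤ s.size aItem
  size_b : nb ≤ s.size aSample
  arr_a : ∀ x < na, s.arr aItem (x : ℕ) = ga x
  arr_b : ∀ x < nb, s.arr aSample (x : ℕ) = gb x

theorem chooseList_ter (h : StrAt W s o m str) (ho : s.var rO = o) {str' f r : ℕ → ℕ}
    (hr : Reduces str m str')
    (hf : IsSorted str' (sampleCard m) f) (hrk : IsSampleRank m f r)
    (hrW : ∀ x, (r x : ℤ) ≤ W) (hz : m + 2 ≤ s.size aRank)
    (hrarr : ∀ x < m + 2, s.arr aRank (x : ℕ) = r x) {na nb a b : ℕ} {ga gb : ℕ → ℕ}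
    (hin : MergeInput W s m str na nb ga gb) (ha : s.var rIdxA = a) (hb : s.var rIdxB = b)
    (ham : a ≤ na) (hbm : b ≤ nb) (hab : a + b < m) :
    Ter W chooseList s (fun s' =>
      (s'.var rFlag = 1 ∧ a < na ∧ (b < nb → Slt str (ga a) (gb b))) ∨
      (s'.var rFlag = 0 ∧ b < nb ∧ (a < na → Slt str (gb b) (ga a)))) := by
  have h1 := h.size
  have h2 := h.fit
  obtain ⟨g1, g2, g3, g4, g5, g6, g7, g8, g9, g10, g11⟩ := hin
  rw [chooseList, Ter_ite]
  refine ⟨?_, fun hcond => ?_, fun hcond => ?_⟩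
  · simp [hb, g7]
    omega
  · simp only [Cond.holds, Expr.val, hb, g7] at hcond
    simp
    omega
  simp only [Cond.holds, Expr.val, hb, g7] at hcond
  rw [Ter_ite]
  refine ⟨?_, fun hcond' => ?_, fun hcond' => ?_⟩
  · simp [ha, g6]
    omega
  · simp only [Cond.holds, Expr.val, ha, g6] at hcond'
    simp
    omega
  simp only [Cond.holds, Expr.val, ha, g6] at hcond'
  have ha' : a < na := by omega
  have hb' : b < nb := by omega
  obtain ⟨ma, ma3⟩ := g2 a ha'
  obtain ⟨mb, mb3⟩ := g3 b hb'
  simp only [block, Ter_seq, Ter_assign]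
  refine ⟨?_, ?_, ?_⟩
  · simp [ha, g10 a ha']
    omega
  · simp [hb, g11 b hb']
    omega
  refine (compareHeads_ter (s := (s.setVar rPos _).setVar rPosB _) (o := o) (m := m) (str := str) ⟨h.isStr, h.le, h.arr, h.size, h.fit⟩
    ?_ (p := ga a) (q := gb b) ?_ ?_ ma mb ma3 mb3 hr hf hrk hrW hz hrarr).mono ?_
  · simp [ho]
  · simp [ha, g10 a ha']
  · simp [hb, g11 b hb']
  · rintro s' (⟨hfl, hs⟩ | ⟨hfl, hs⟩)
    · exact .inl ⟨hfl, ha', fun _ => hs⟩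
    · refine .inr ⟨hfl, hb', fun _ => ?_⟩
      have hne : ga a ≠ gb b := by
        intro he
        rw [he] at ma3
        exact mb3 ma3
      exact (h.isStr.total hne ma.le mb.le).resolve_left hs

theorem mergeLists_run (h : StrAt W s o m str) (ho : s.var rO = o) (hm : s.var rM = m)
    {str' f r : ℕ → ℕ} (hr : Reduces str m str')
    (hf : IsSorted str' (sampleCard m) f) (hrk : IsSampleRank m f r)
    (hrW : ∀ x, (r x : ℤ) ≤ W) (hz : m + 2 ≤ s.size aRank) (hz' : m ≤ s.size aSuf)
    (hrarr : ∀ x < m + 2, s.arr aRank (x : ℕ) = r x) {na nb : ℕ} {ga gb : ℕ → ℕ}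
    (hin : MergeInput W s m str na nb ga gb) (ha : s.var rIdxA = 0) (hb : s.var rIdxB = 0) :
    Run W mergeLists s (m * 150 + 150) (fun s' =>
      (∃ f', IsSorted str m f' ∧ ∀ x < m, s'.arr aSuf (x : ℕ) = f' x) ∧
      Frame [rJ, rFlag, rPos, rPosB, rIdxA, rIdxB] [aSuf] s s') := by
  have h1 := h.size
  have h2 := h.fit
  refine (Run.forLt 150 m (fun j s' => ∃ (a b : ℕ) (out : ℕ → ℕ), s'.var rIdxA = a ∧ s'.var rIdxB = b ∧
    a ≤ na ∧ b ≤ nb ∧ a + b = j ∧ (∀ x < j, s'.arr aSuf (x : ℕ) = (out x : ℕ)) ∧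
    (∀ x < j, out x < m) ∧ (∀ x y, x < y → y < j → Slt str (out x) (out y)) ∧
    (∀ x < j, ∀ y, a ≤ y → y < na → Slt str (out x) (ga y)) ∧
    (∀ x < j, ∀ y, b ≤ y → y < nb → Slt str (out x) (gb y)))
    (by omega) (by decide) rfl (by decide) ?_ ?_ ?_).mono le_rfl ?_
  · intro v s' hv f hs _
    have hm' := f.var rM (by decide)
    simp [hm', hm]
    omega
  · exact ⟨0, 0, fun _ => 0, by simpa using ha, by simpa using hb, by simp, by simp, rfl, by simp,
      by simp, by simp, by simp, by simp⟩
  · rintro v s' hv fr hs ⟨a, b, out, i1, i2, i3, i4, i5, i6, i7, i8, i9, i10⟩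
    have fr' := fr.mono (X' := [rJ, rFlag, rPos, rPosB, rIdxA, rIdxB]) (Y' := [aSuf])
      (by decide) (by decide)
    obtain ⟨g1, g2, g3, g4, g5, g6, g7, g8, g9, g10, g11⟩ := hin
    have hin' : MergeInput W s' m str na nb ga gb :=
      ⟨g1, g2, g3, g4, g5, by rw [fr'.var _ (by decide), g6], by rw [fr'.var _ (by decide), g7],
        by rwa [fr'.size], by rwa [fr'.size], by rwa [fr'.arr _ (by decide)],
        by rwa [fr'.arr _ (by decide)]⟩
    have hch := chooseList_ter (h.frame fr' (by decide)) (by rw [fr'.var _ (by decide), ho]) hr hf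
      hrk hrW (by rwa [fr'.size]) (by rwa [fr'.arr _ (by decide)]) hin' i1 i2 i3 i4 (by omega)
    simp only [block]
    rw [Ter_seq]
    obtain ⟨t, u, hex, hu⟩ := hch
    refine ⟨t, u, hex, ?_⟩
    have fu := (hex.frame rfl).mono (X' := [rFlag, rPos, rPosB]) (Y' := []) (by decide) (by decide)
    have usize : u.size = s.size := by rw [fu.size, fr'.size]
    have uarr : u.arr = s'.arr := by
      funext i
      rw [fu.arr i (by simp)]
    have ua : u.var rIdxA = a := by rw [fu.var _ (by decide), i1]
    have ub : u.var rIdxB = b := by rw [fu.var _ (by decide), i2]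
    have uj : u.var rJ = v := by rw [fu.var _ (by decide), hs]
    have aA : ∀ x < na, s'.arr aItem (x : ℕ) = ga x := hin'.arr_a
    have aB : ∀ x < nb, s'.arr aSample (x : ℕ) = gb x := hin'.arr_b
    rcases hu with ⟨hfl, ha', hlt⟩ | ⟨hfl, hb', hlt⟩
    · have hga := g2 a ha'
      simp [hfl, ua, uj, usize, uarr, aA a ha']
      and_intros
      any_goals omega
      refine ⟨a + 1, by simp, b, by simp [ub], by omega, i4, by omega, Function.update out v (ga a),
        fun x hx => ?_, fun x hx => ?_, fun x y hxy hy => ?_, fun x hx y hay hy => ?_,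
        fun x hx y hby hy => ?_⟩
      · rcases Nat.eq_or_lt_of_le hx with rfl | hx
        · simp
        · rw [if_neg (by omega), Function.update_of_ne (by omega), i6 x hx]
      · rcases Nat.eq_or_lt_of_le hx with rfl | hx
        · simpa using hga.1
        · rw [Function.update_of_ne (by omega)]
          exact i7 x hx
      · rw [Function.update_of_ne (show x ≠ v by omega)]
        rcases Nat.eq_or_lt_of_le hy with rfl | hy
        · rw [Function.update_self]
          exact i9 x hxy a le_rfl ha'
        · rw [Function.update_of_ne (by omega)]
          exact i8 x y hxy hy
      · rcases Nat.eq_or_lt_of_le hx with rfl | hx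
        · rw [Function.update_self]
          exact g4 a y hay hy
        · rw [Function.update_of_ne (by omega)]
          exact i9 x hx y (by omega) hy
      · rcases Nat.eq_or_lt_of_le hx with rfl | hx
        · rw [Function.update_self]
          have h0 := hlt (by omega)
          rcases Nat.eq_or_lt_of_le hby with rfl | hby
          · exact h0
          · exact h0.trans (g5 b y hby hy)
        · rw [Function.update_of_ne (by omega)]
          exact i10 x hx y hby hy
    · have hgb := g3 b hb'
      simp [hfl, ub, uj, usize, uarr, aB b hb']
      and_intros
      any_goals omega
      refine ⟨a, by simp [ua], b + 1, by simp, i3, by omega, by omega, Function.update out v (gb b),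
        fun x hx => ?_, fun x hx => ?_, fun x y hxy hy => ?_, fun x hx y hay hy => ?_,
        fun x hx y hby hy => ?_⟩
      · rcases Nat.eq_or_lt_of_le hx with rfl | hx
        · simp
        · rw [if_neg (by omega), Function.update_of_ne (by omega), i6 x hx]
      · rcases Nat.eq_or_lt_of_le hx with rfl | hx
        · simpa using hgb.1
        · rw [Function.update_of_ne (by omega)]
          exact i7 x hx
      · rw [Function.update_of_ne (show x ≠ v by omega)]
        rcases Nat.eq_or_lt_of_le hy with rfl | hy
        · rw [Function.update_self]
          exact i10 x hxy b le_rfl hb'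
        · rw [Function.update_of_ne (by omega)]
          exact i8 x y hxy hy
      · rcases Nat.eq_or_lt_of_le hx with rfl | hx
        · rw [Function.update_self]
          have h0 := hlt (by omega)
          rcases Nat.eq_or_lt_of_le hay with rfl | hay
          · exact h0
          · exact h0.trans (g4 a y hay hy)
        · rw [Function.update_of_ne (by omega)]
          exact i9 x hx y hay hy
      · rcases Nat.eq_or_lt_of_le hx with rfl | hx
        · rw [Function.update_self]
          exact g5 b y hby hy
        · rw [Function.update_of_ne (by omega)]
          exact i10 x hx y (by omega) hy
  · rintro s' ⟨⟨a, b, out, i1, i2, i3, i4, i5, i6, i7, i8, i9, i10⟩, -, fr⟩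
    exact ⟨⟨out, ⟨i7, i8⟩, i6⟩, fr.mono (by decide) (by decide)⟩

end


/-- From the sorted suffixes of the string of names to those of the string on top of the stack. -/
def ascend : Cmd := block [popLevel, clearRanks, spreadRanks, assign rCnt (.var rHalf), sortBy 0,
  assign rIdxA (.lit 0), assign rIdxB (.lit 0), mergeLists]

theorem Exec.assign_val {W : ℕ} {s : Store} (x : ℕ) (e : Expr) {v : ℤ} (h : e.ok W s)
    (hv : e.val s = v) : Exec W (.assign x e) s (e.cost + 1) (s.setVar x v) :=
  .assign s x e v (e.eval_eq_some_iff.2 ⟨h, hv.symm⟩)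

theorem Frame.setVar (s : Store) (x : ℕ) (v : ℤ) : Frame [x] [] s (s.setVar x v) :=
  ⟨fun y hy => by simp at hy; simp [hy], fun _ _ => rfl, rfl, rfl⟩

/-- The arrays for the sorted suffixes are large enough for strings of length `N`. -/
structure SufSpace (s : Store) (N : ℕ) : Prop where
  work : WorkSpace s N
  rank : N + 2 ≤ s.size aRank
  sample : N ≤ s.size aSample
  suf : N ≤ s.size aSuf

theorem SufSpace.frame {s s' : Store} {N : ℕ} (h : SufSpace s N) {X Y : List ℕ}
    (f : Frame X Y s s') : SufSpace s' N := by
  obtain ⟨h1, h2, h3, h4⟩ := h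
  exact ⟨h1.frame f, by rwa [f.size], by rwa [f.size], by rwa [f.size]⟩

theorem SufSpace.mono {s : Store} {N M : ℕ} (h : SufSpace s N) (hM : M ≤ N) : SufSpace s M := by
  obtain ⟨⟨h1, h2, h3⟩, h4, h5, h6⟩ := h
  exact ⟨⟨by omega, by omega, by omega⟩, by omega, by omega, by omega⟩

/-- Registers changed by `ascend`. -/
def ascendRegs : List ℕ := [rD, rO, rM, rHalf, rCnt, rKb, rIdxA, rLenB, rJ, rIdx, rPos, rOff, rTmp,
  rSum, rIdxB, rFlag, rPosB]

/-- Arrays changed by `ascend`. -/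
def ascendArrs : List ℕ := [aRank, aItem, aSample, aSorted, aCount, aSuf]

section

variable {W : ℕ} {s : Store} {o m : ℕ} {str : ℕ → ℕ}

theorem ascend_run (h : StrAt W s o m str) (hw : SufSpace s m) (h1m : 1 ≤ m) {d : ℕ}
    (hd : s.var rD = (d + 1 : ℕ)) (hd1 : d < s.size aOffs) (hd2 : d < s.size aLens)
    (hdW : (d : ℤ) + 1 < W) (ho : s.arr aOffs d = o) (hm : s.arr aLens d = m) {str' f : ℕ → ℕ}
    (hr : Reduces str m str') (hf : IsSorted str' (sampleCard m) f)
    (hsuf : ∀ x < sampleCard m, s.arr aSuf (x : ℕ) = f x) :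
    Run W ascend s (2000 * m) (fun s' =>
      (s'.var rD = d ∧ ∃ f', IsSorted str m f' ∧ ∀ x < m, s'.arr aSuf (x : ℕ) = f' x) ∧
      Frame ascendRegs ascendArrs s s') := by
  have hsz := h.size
  have hfit := h.fit
  have hcm := sampleCard_le m h1m
  obtain ⟨t1, s1, e1, b1, ⟨p1, p2, p3, p4, p5, p6, p7, p8⟩, f1⟩ := popLevel_run h hd hd1 hd2 hdW ho hm
  have h1 := h.frame f1 (by decide)
  have w1 := hw.frame f1
  obtain ⟨t2, s2, e2, b2, p9, f2⟩ := clearRanks_run h1 p3 w1.rank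
  have h2 := h1.frame f2 (by decide)
  have w2 := w1.frame f2
  obtain ⟨t3, s3, e3, b3, ⟨p10, p11, p12, p13, p14, p15⟩, f3⟩ := spreadRanks_run h2 h1m hf
    (by rw [f2.var _ (by decide), p3]) (by rw [f2.var _ (by decide), p4])
    (by rw [f2.var _ (by decide), p5]) (by rw [f2.var _ (by decide), p7])
    (by rw [f2.var _ (by decide), p8]) w2.rank w2.work.item w2.sample w2.suf
    (by rw [f2.arr _ (by decide), f1.arr _ (by decide)]; exact hsuf) p9
  have h3 := h2.frame f3 (by decide)
  have w3 := w2.frame f3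
  have f23 := (f2.mono (X' := [rJ, rIdx, rPos, rIdxA, rLenB]) (Y' := [aRank, aItem, aSample])
    (by decide) (by decide)).trans f3
  have hhalf3 : s3.var rHalf = ((m + 2) / 3 : ℕ) := by rw [f23.var _ (by decide), p4]
  have hcA : Nat.count (fun x => f x < (m + 2) / 3) (sampleCard m) = (m + 2) / 3 := by
    rw [count_comp_perm (fun k => k < (m + 2) / 3) hf, count_lt_half]
  have hcB : Nat.count (fun x => samplePos m (f x) < m) (sampleCard m) = m - (m + 2) / 3 := by
    rw [count_comp_perm (fun k => samplePos m k < m) hf, count_samplePos_lt m h1m]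
  have hxa : ∀ a < (m + 2) / 3, ∃ x < sampleCard m, f x < (m + 2) / 3 ∧
      Nat.count (fun x => f x < (m + 2) / 3) x = a := fun a ha =>
    exists_of_lt_count (fun x => f x < (m + 2) / 3) (by rw [hcA]; exact ha)
  have hxb : ∀ b < m - (m + 2) / 3, ∃ x < sampleCard m, samplePos m (f x) < m ∧
      Nat.count (fun x => samplePos m (f x) < m) x = b := fun b hb =>
    exists_of_lt_count (fun x => samplePos m (f x) < m) (by rw [hcB]; exact hb)
  choose! xa hxa1 hxa2 hxa3 using hxa
  choose! xb hxb1 hxb2 hxb3 using hxb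
  have e4 : Exec W (assign rCnt (.var rHalf)) s3 2 (s3.setVar rCnt ((m + 2) / 3 : ℕ)) :=
    .assign_val rCnt (.var rHalf) (by simp only [Expr.ok, hhalf3]; omega) hhalf3
  have f4 := Frame.setVar s3 rCnt ((m + 2) / 3 : ℕ)
  have h4 := h3.frame f4 (by decide)
  have w4 := w3.frame f4
  obtain ⟨t5, s5, e5, b5, ⟨π, hπ, p16⟩, f5⟩ := sortBy_run h4 w4.work 0 (by omega)
    (cnt := (m + 2) / 3) (src := fun a => 3 * f (xa a)) (by omega)
    (by rw [f4.var _ (by decide), f23.var _ (by decide), p2]) (by simp)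
    (by rw [f4.var _ (by decide), f23.var _ (by decide), p6])
    (fun a ha => by have := hxa2 a ha; omega)
    (fun a ha => by
      rw [f4.arr _ (by decide), ← p12 _ (hxa1 a ha) (hxa2 a ha), hxa3 a ha])
  have h5 := h4.frame f5 (by decide)
  have w5 := w4.frame f5
  have e6 : Exec W (assign rIdxA (.lit 0)) s5 2 (s5.setVar rIdxA 0) :=
    .assign_val rIdxA (.lit 0) (by simp) rfl
  have f6 := Frame.setVar s5 rIdxA 0
  have e7 : Exec W (assign rIdxB (.lit 0)) (s5.setVar rIdxA 0) 2
      ((s5.setVar rIdxA 0).setVar rIdxB 0) :=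
    .assign_val rIdxB (.lit 0) (by simp) rfl
  have f7 := Frame.setVar (s5.setVar rIdxA 0) rIdxB 0
  have f67 := (f6.mono (X' := [rIdxA, rIdxB]) (Y' := []) (by decide) (by decide)).trans
    (f7.mono (by decide) (by decide))
  set s7 := (s5.setVar rIdxA 0).setVar rIdxB 0 with hs7
  have h7 := h5.frame f67 (by decide)
  have w7 := w5.frame f67
  have f47 := ((f4.mono (X' := [rCnt, rOff, rJ, rTmp, rSum, rIdxA, rIdxB])
    (Y' := [aItem, aSorted, aCount]) (by decide) (by decide)).trans
    (f5.mono (by decide) (by decide))).trans (f67.mono (by decide) (by decide))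
  set r : ℕ → ℕ := fun p => if p < m + 2 then (s3.arr aRank (p : ℕ)).toNat else 0 with hrdef
  have hple : ∀ x < sampleCard m, samplePos m (f x) < m + 2 := fun x hx => by
    have := samplePos_le (hf.lt x hx)
    omega
  have hrk : IsSampleRank m f r := by
    refine ⟨fun x hx => ?_, fun p hp => ?_⟩
    · simp only [hrdef, if_pos (hple x hx), p11 x hx, Int.toNat_natCast]
    · simp only [hrdef]
      split_ifs with hlt
      · rw [p10 p hlt hp]
        rfl
      · rfl
  have hrarr : ∀ x < m + 2, s3.arr aRank (x : ℕ) = r x := by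
    intro p hp
    simp only [hrdef, if_pos hp]
    by_cases hex : ∃ x < sampleCard m, p = samplePos m (f x)
    · obtain ⟨x, hx, rfl⟩ := hex
      rw [p11 x hx]
      simp
    · push Not at hex
      rw [p10 p hp hex]
      rfl
  have hrW : ∀ x, (r x : ℤ) ≤ W := by
    intro p
    by_cases hex : ∃ x < sampleCard m, p = samplePos m (f x)
    · obtain ⟨x, hx, rfl⟩ := hex
      rw [hrk.sample x hx]
      push_cast
      omega
    · push Not at hex
      rw [hrk.other p hex]
      omega
  have hposA : ∀ a < (m + 2) / 3, samplePos m (f (xa a)) = 3 * f (xa a) + 1 := fun a ha =>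
    if_pos (hxa2 a ha)
  have hin : MergeInput W s7 m str ((m + 2) / 3) (m - (m + 2) / 3) (fun x => 3 * f (xa (π x)))
      (fun x => samplePos m (f (xb x))) := by
    refine ⟨by omega, fun x hx => ?_, fun x hx => ⟨hxb2 x hx, samplePos_mod⟩,
      fun x y hxy hy => ?_, fun x y hxy hy => ?_, ?_, ?_, ?_, ?_, fun x hx => ?_, fun x hx => ?_⟩
    · have := hxa2 _ (hπ.lt x hx)
      omega
    · have hx := hxy.trans hy
      refine Suffixient.slt_iff.2 ?_
      rcases hπ.sorted x y hxy hy with hk | ⟨hk, h'⟩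
      · exact .inl hk
      · refine .inr ⟨hk, ?_⟩
        rw [← hposA _ (hπ.lt x hx), ← hposA _ (hπ.lt y hy),
          ← hr.slt_iff h.isStr (hf.lt _ (hxa1 _ (hπ.lt x hx))) (hf.lt _ (hxa1 _ (hπ.lt y hy)))]
        refine hf.slt _ _ (count_lt_of_lt (fun x => f x < (m + 2) / 3) ?_) (hxa1 _ (hπ.lt y hy))
        rw [hxa3 _ (hπ.lt x hx), hxa3 _ (hπ.lt y hy)]
        exact h'
    · have hx := hxy.trans hy
      rw [← hr.slt_iff h.isStr (hf.lt _ (hxb1 x hx)) (hf.lt _ (hxb1 y hy))]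
      refine hf.slt _ _ (count_lt_of_lt (fun x => samplePos m (f x) < m) ?_) (hxb1 y hy)
      rw [hxb3 x hx, hxb3 y hy]
      exact hxy
    · rw [f47.var _ (by decide), hhalf3]
    · rw [f47.var _ (by decide), p15, hcB]
    · exact (show (m + 2) / 3 ≤ m by omega).trans w7.work.item
    · exact (show m - (m + 2) / 3 ≤ m by omega).trans w7.sample
    · rw [f67.arr _ (by decide), p16 x hx]
    · rw [f47.arr _ (by decide), ← p13 _ (hxb1 x hx) (hxb2 x hx), hxb3 x hx]
  obtain ⟨t8, s8, e8, b8, p17, f8⟩ := mergeLists_run h7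
    (by rw [f47.var _ (by decide), f23.var _ (by decide), p2])
    (by rw [f47.var _ (by decide), f23.var _ (by decide), p3]) hr hf hrk hrW w7.rank w7.suf
    (by rw [f47.arr _ (by decide)]; exact hrarr) hin (by simp [hs7]) (by simp [hs7])
  refine ⟨_, _, .seq _ _ _ _ _ _ _ e1 <| .seq _ _ _ _ _ _ _ e2 <| .seq _ _ _ _ _ _ _ e3 <|
    .seq _ _ _ _ _ _ _ e4 <| .seq _ _ _ _ _ _ _ e5 <| .seq _ _ _ _ _ _ _ e6 <|
    .seq _ _ _ _ _ _ _ e7 e8, by omega, ⟨?_, p17⟩, ?_⟩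
  · rw [f8.var _ (by decide), f47.var _ (by decide), f23.var _ (by decide), p1]
  · exact (f1.mono (by decide) (by decide)).trans <| (f23.mono (by decide) (by decide)).trans <|
      (f47.mono (by decide) (by decide)).trans (f8.mono (by decide) (by decide))

end

/-- The stack has depth `d`, its strings have total length `c`, and the current string `str`, of
length `m`, is to be stored at the offset `o`. -/
inductive Stack (W : ℕ) (s : Store) (n : ℕ) (str₀ : ℕ → ℕ) : ℕ → ℕ → ℕ → ℕ → (ℕ → ℕ) → Prop
  | nil : Stack W s n str₀ 0 0 0 n str₀
  | push {d c o m : ℕ} {str str' : ℕ → ℕ} (h : Stack W s n str₀ d c o m str) (hm : 2 ≤ m)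
      (hstr : StrAt W s o m str) (ho : s.arr aOffs d = o) (hm' : s.arr aLens d = m)
      (hr : Reduces str m str') :
      Stack W s n str₀ (d + 1) (c + m) (o + m + 3) (sampleCard m) str'

section

variable {W : ℕ} {s s' : Store} {n : ℕ} {str₀ : ℕ → ℕ} {d c o m : ℕ} {str : ℕ → ℕ}

theorem Stack.bounds (h : Stack W s n str₀ d c o m str) (hn : 1 ≤ n) :
    c + 6 * m ≤ 6 * n ∧ o + 24 * m ≤ 24 * n ∧ d + m ≤ n ∧ 1 ≤ m := by
  induction h with
  | nil => omega
  | push h hm hstr ho hm' hr ih =>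
    unfold sampleCard
    omega

theorem Stack.transfer (h : Stack W s n str₀ d c o m str) (hsize : s'.size = s.size)
    (hstr : ∀ i : ℤ, i < o → s'.arr aStr i = s.arr aStr i)
    (ho : ∀ e < d, s'.arr aOffs (e : ℕ) = s.arr aOffs e)
    (hl : ∀ e < d, s'.arr aLens (e : ℕ) = s.arr aLens e) : Stack W s' n str₀ d c o m str := by
  induction h with
  | nil => exact .nil
  | @push d c o m str str' h hm hs ho' hm' hr ih =>
    refine .push (ih (fun i hi => hstr i (by push_cast; omega)) (fun e he => ho e (by omega))
      (fun e he => hl e (by omega))) hm ?_ ?_ ?_ hr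
    · exact ⟨hs.isStr, hs.le, fun i hi => by rw [hstr _ (by push_cast; omega), hs.arr i hi],
        by rw [hsize]; exact hs.size, by rw [hsize]; exact hs.fit⟩
    · rw [ho d (by omega), ho']
    · rw [hl d (by omega), hm']

/-- Sort the suffixes of the string of length `rM` at the offset zero. -/
def sortSuffixes : Cmd := block [
  .while (.lt (.lit 1) (.var rM)) descend,
  put aSuf (.lit 0) (.lit 0),
  .while (.lt (.lit 0) (.var rD)) ascend]

theorem sampleCard_lt (hm : 2 ≤ m) : sampleCard m < m := by
  unfold sampleCard
  omega

theorem sortSuffixes_run (h : StrAt W s 0 n str) (hn : 1 ≤ n) (hw : SufSpace s n)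
    (hO : s.var rO = 0) (hM : s.var rM = n) (hD : s.var rD = 0) (hz1 : n ≤ s.size aOffs)
    (hz2 : n ≤ s.size aLens) (hz3 : 24 * n + 10 ≤ s.size aStr)
    (hzero : ∀ i : ℤ, (n : ℤ) ≤ i → s.arr aStr i = 0) :
    Run W sortSuffixes s (40000 * n) (fun s' =>
      (∃ f, IsSorted str n f ∧ ∀ x < n, s'.arr aSuf (x : ℕ) = f x) ∧
      (∀ i : ℤ, i < n + 3 → s'.arr aStr i = s.arr aStr i)) := by
  have hfit := h.fit
  have hdown := Run.loop (W := W) (b := .lt (.lit 1) (.var rM)) (c := descend)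
    (fun m s' => ∃ d c o st, Stack W s' n str d c o m st ∧ StrAt W s' o m st ∧
      s'.var rO = (o : ℕ) ∧ s'.var rM = (m : ℕ) ∧ s'.var rD = (d : ℕ) ∧ s'.size = s.size ∧
      (∀ i : ℤ, (o : ℤ) + m ≤ i → s'.arr aStr i = 0) ∧
      (∀ i : ℤ, i < n + 3 → s'.arr aStr i = s.arr aStr i) ∧ (o = 0 → m = n) ∧
      (0 < o → n + 3 ≤ o))
    (fun m => 24012 * m) ?_ ?_ n s
    ⟨0, 0, 0, str, .nil, h, by simpa using hO, hM, by simpa using hD, rfl, by simpa using hzero,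
      fun _ _ => rfl, fun _ => rfl, by simp⟩
  · obtain ⟨t1, s1, e1, b1, m, ⟨d, c, o, st, hst, hs1, ho1, hm1, hd1, hz, hzer, heq, -⟩, hb⟩ := hdown
    have hbd := hst.bounds hn
    have hm : m = 1 := by
      simp only [Cond.holds, Expr.val, hm1] at hb
      omega
    subst hm
    have e2 : Exec W (put aSuf (.lit 0) (.lit 0)) s1 3 (s1.setCell aSuf 0 0) := by
      have := hw.suf
      refine .put s1 aSuf (.lit 0) (.lit 0) 0 0 ((Expr.eval_eq_some_iff _).2 ⟨by simp, rfl⟩)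
        ((Expr.eval_eq_some_iff _).2 ⟨by simp, rfl⟩) le_rfl ?_
      rw [hz]
      omega
    have harr : ∀ a, a ≠ aSuf → (s1.setCell aSuf 0 0).arr a = s1.arr a := by
      intro a ha
      funext i
      simp [ha]
    have hst2 : Stack W (s1.setCell aSuf 0 0) n str d c o 1 st :=
      hst.transfer rfl (fun i _ => by rw [harr _ (by decide)])
        (fun i _ => by rw [harr _ (by decide)]) (fun i _ => by rw [harr _ (by decide)])
    have hup := Run.loop (W := W) (b := .lt (.lit 0) (.var rD)) (c := ascend)
      (fun c s' => ∃ d o m st f, Stack W s' n str d c o m st ∧ s'.var rD = (d : ℕ) ∧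
        s'.size = s.size ∧ IsSorted st m f ∧ (∀ x < m, s'.arr aSuf (x : ℕ) = (f x : ℕ)) ∧
        (∀ i : ℤ, i < n + 3 → s'.arr aStr i = s.arr aStr i))
      (fun c => 2004 * c) ?_ ?_ c (s1.setCell aSuf 0 0)
      ⟨d, o, 1, st, fun _ => 0, hst2, hd1, hz, ⟨by simp, fun x y hxy hy => by omega⟩, by simp,
        fun i hi => by rw [harr _ (by decide), heq i hi]⟩
    · obtain ⟨t3, s3, e3, b3, c', ⟨d', o', m', st', f, hst', hd', hz', hf, hsuf, heq'⟩, hb'⟩ := hup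
      refine ⟨_, _, .seq _ _ _ _ _ _ _ e1 <| .seq _ _ _ _ _ _ _ e2 e3, ?_, ?_, heq'⟩
      · simp only [Cond.cost, Expr.cost] at b1 b3
        omega
      · simp only [Cond.holds, Expr.val, hd'] at hb'
        have : d' = 0 := by omega
        subst this
        cases hst'
        exact ⟨f, hf, hsuf⟩
    · rintro c' s' ⟨d', o', m', st', f, hst', hd', -⟩
      have := hst'.bounds hn
      simp [hd']
      omega
    · rintro c' s' ⟨d', o', m', st', f, hst', hd', hz', hf, hsuf, heq'⟩ hb'
      simp only [Cond.holds, Expr.val, hd'] at hb'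
      cases hst' with
      | nil => simp at hb'
      | @push d c o m str₁ str₂ hst' hm hstr ho hm' hr =>
        have hbd := hst'.bounds hn
        refine ⟨2000 * m, (ascend_run hstr ((SufSpace.mono (s := s') ?_ (show m ≤ n by omega)))
          (by omega) hd' (by rw [hz']; omega) (by rw [hz']; omega) (by omega) ho hm' hr hf
          hsuf).mono le_rfl ?_⟩
        · obtain ⟨⟨w1, w2, w3⟩, w4, w5, w6⟩ := hw
          exact ⟨⟨by rwa [hz'], by rwa [hz'], by rwa [hz']⟩, by rwa [hz'], by rwa [hz'], by rwa [hz']⟩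
        rintro s'' ⟨⟨q1, f', q2, q3⟩, fr⟩
        refine ⟨c, ⟨d, o, m, str₁, f', hst'.transfer fr.size ?_ ?_ ?_, q1, ?_, q2, q3, ?_⟩, ?_⟩
        · intro i _
          rw [fr.arr _ (by decide)]
        · intro i _
          rw [fr.arr _ (by decide)]
        · intro i _
          rw [fr.arr _ (by decide)]
        · rw [fr.size, hz']
        · intro i hi
          rw [fr.arr _ (by decide), heq' i hi]
        · simp only [Cond.cost, Expr.cost]
          omega
  · rintro m s' ⟨d, c, o, st, hst, -, -, hm, -⟩
    have := hst.bounds hn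
    simp [hm]
    omega
  · rintro m s' ⟨d, c, o, st, hst, hs1, ho1, hm1, hd1, hz, hzer, heq, h0, h0'⟩ hb
    have hbd := hst.bounds hn
    simp only [Cond.holds, Expr.val, hm1] at hb
    have hm2 : 2 ≤ m := by omega
    have hlt := sampleCard_lt hm2
    refine ⟨4000 * m, (descend_run hs1 (SufSpace.mono (s := s') ?_ (show m ≤ n by omega)).work hm2 ho1 hm1
      hd1 (by rw [hz]; omega) (by rw [hz]; omega) (by omega) (by rw [hz]; omega) hzer).mono le_rfl ?_⟩
    · obtain ⟨⟨w1, w2, w3⟩, w4, w5, w6⟩ := hw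
      exact ⟨⟨by rwa [hz], by rwa [hz], by rwa [hz]⟩, by rwa [hz], by rwa [hz], by rwa [hz]⟩
    rintro s'' ⟨str', q1, q2, q3, q4, q5, q6, q7, q8, q9, q10, q11⟩
    refine ⟨sampleCard m, ⟨d + 1, c + m, o + m + 3, str', .push (hst.transfer q10 ?_ ?_ ?_) hm2 ?_ ?_ ?_ q1,
      q2, q3, q4, q5, q10.trans hz, q6, ?_, by omega, by omega⟩, ?_⟩
    · intro i hi
      exact q7 i (by omega)
    · intro e he
      rw [q8, if_neg (by omega)]
    · intro e he
      rw [q9, if_neg (by omega)]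
    · exact ⟨hs1.isStr, hs1.le, fun i hi => by rw [q7 _ (by omega), hs1.arr i hi],
        by rw [q10]; exact hs1.size, by rw [q10]; exact hs1.fit⟩
    · rw [q8, if_pos rfl]
    · rw [q9, if_pos rfl]
    · intro i hi
      rw [q7 i (by omega), heq i hi]
    · have : 6 * sampleCard m ≤ 5 * m := by
        unfold sampleCard
        omega
      simp only [Cond.cost, Expr.cost]
      omega

end


/-! ## The arrays of the reversed text -/

/-- The first mismatch of the suffixes at `p` and `q` is at distance `k`. -/
def HasLcp (str : ℕ → ℕ) (p q k : ℕ) : Prop :=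
  (∀ l < k, str (p + l) = str (q + l)) ∧ str (p + k) ≠ str (q + k)

theorem Slt.between {str : ℕ → ℕ} {a b c h : ℕ} (hab : Slt str a b) (hbc : Slt str b c)
    (hac : ∀ l < h, str (a + l) = str (c + l)) : ∀ l < h, str (b + l) = str (c + l) := by
  obtain ⟨k, h1, h2⟩ := hbc
  have hk : h ≤ k := by
    by_contra hcon
    refine hab.asymm ⟨k, fun l hl => ?_, ?_⟩
    · rw [h1 l hl, hac l (by omega)]
    · rw [hac k (by omega)]
      exact h2
  exact fun l hl => h1 l (by omega)

/-- Inverse of the suffix array. -/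
notation "aInv" => (29 : ℕ)
/-- Position in the computation of longest common prefixes. -/
notation "rAt" => (32 : ℕ)
/-- Length of the common prefix found so far. -/
notation "rLcp" => (33 : ℕ)
/-- Rank of the current suffix. -/
notation "rRow" => (34 : ℕ)
/-- Preceding suffix in the suffix array. -/
notation "rPrev" => (35 : ℕ)

/-- One step in the computation of longest common prefixes. -/
def lcpStep : Cmd := block [
  assign rRow (.get aInv (.var rAt)),
  ite (.eq (.var rRow) (.lit 0))
    (assign rAt (.add (.var rAt) (.lit 1)))
    (block [
      assign rPrev (.get aSuf (.sub (.var rRow) (.lit 1))),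
      ite (.eq (.get aStr (.add (.var rAt) (.var rLcp))) (.get aStr (.add (.var rPrev) (.var rLcp))))
        (assign rLcp (.add (.var rLcp) (.lit 1)))
        (block [
          put aLCP (.add (.var rRow) (.lit 1)) (.var rLcp),
          assign rAt (.add (.var rAt) (.lit 1)),
          whenever (.lt (.lit 0) (.var rLcp)) (assign rLcp (.sub (.var rLcp) (.lit 1)))])])]

/-- Compute the longest common prefixes of neighbours in the suffix array. -/
def lcpLoop : Cmd := block [
  assign rAt (.lit 0),
  assign rLcp (.lit 0),
  .while (.lt (.var rAt) (.var xN)) lcpStep]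

section

variable {W : ℕ} {s : Store} {n : ℕ} {str f : ℕ → ℕ}

/-- The state of the computation of longest common prefixes. -/
structure LcpInv (s₀ : Store) (n : ℕ) (str f : ℕ → ℕ) (i h : ℕ) (s : Store) : Prop where
  le : i + h ≤ n
  at_eq : s.var rAt = i
  lcp_eq : s.var rLcp = h
  n_eq : s.var xN = n
  size : s.size = s₀.size
  arr : ∀ a, a ≠ aLCP → s.arr a = s₀.arr a
  common : 0 < h → i < n ∧ ∃ j < n, Slt str j i ∧ ∀ l < h, str (j + l) = str (i + l)
  done : ∀ x, 0 < x → x < n → f x < i → ∃ k : ℕ, HasLcp str (f x) (f (x - 1)) k ∧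
    s.arr aLCP ((x : ℤ) + 1) = k

theorem lcpStep_ter (hs : StrAt W s 0 n str) (hf : IsSorted str n f)
    (hsuf : ∀ x < n, s.arr aSuf (x : ℕ) = f x) (hinv : ∀ x < n, s.arr aInv (f x : ℕ) = x)
    (hz1 : n ≤ s.size aSuf) (hz2 : n ≤ s.size aInv) (hz3 : n < s.size aLCP) {i h : ℕ} {u : Store}
    (hu : LcpInv s n str f i h u) (hi : i < n) :
    Ter W lcpStep u (fun v => ∃ i' h', LcpInv s n str f i' h' v ∧ 2 * i + h < 2 * i' + h') := by
  obtain ⟨u1, u2, u3, u4, u5, u6, u7, u8⟩ := hu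
  have h1 := hs.size
  have h2 := hs.fit
  obtain ⟨x, hx, hfx⟩ := hf.exists hi
  have ainv : u.arr aInv (i : ℕ) = x := by rw [u6 _ (by decide), ← hfx, hinv x hx]
  simp only [lcpStep, block]
  rw [Ter_seq, Ter_assign, Ter_ite]
  refine ⟨?_, ?_, fun hc => ?_, fun hc => ?_⟩
  · simp [u2, u5, ainv]
    omega
  · simp [u2, ainv]
    omega
  · simp only [Cond.holds, Expr.val, Store.setVar_var, u2, ainv, if_true] at hc
    have hx0 : x = 0 := by omega
    subst hx0
    have hh : h = 0 := by
      by_contra hne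
      obtain ⟨-, j, hj, hji, -⟩ := u7 (by omega)
      obtain ⟨y, hy, rfl⟩ := hf.exists hj
      rw [← hfx] at hji
      exact absurd (hf.lt_of_slt hy hji) (by omega)
    subst hh
    simp [u2, ainv]
    refine ⟨by omega, i + 1, 0, ⟨by omega, by simp, by simp [u3], by simpa using u4, u5, u6, by simp, ?_⟩,
      by omega⟩
    intro y hy0 hy hlt
    refine u8 y hy0 hy ?_
    have : f y ≠ i := by
      rw [← hfx]
      intro he
      have := hf.inj hy hx he
      omega
    omega
  · simp only [Cond.holds, Expr.val, Store.setVar_var, u2, ainv, if_true] at hc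
    have hx0 : 0 < x := by omega
    have asuf : u.arr aSuf ((x : ℤ) - 1) = f (x - 1) := by
      rw [u6 _ (by decide), ← hsuf (x - 1) (by omega)]
      congr 1
      omega
    have hp := hf.lt (x - 1) (by omega)
    have hslt : Slt str (f (x - 1)) i := by
      rw [← hfx]
      exact hf.slt _ _ (by omega) hx
    have hcom : ∀ l < h, str (f (x - 1) + l) = str (i + l) := by
      intro l hl
      obtain ⟨-, j, hj, hji, hc'⟩ := u7 (by omega)
      obtain ⟨y, hy, rfl⟩ := hf.exists hj
      have hyx : y < x := by
        refine hf.lt_of_slt hy ?_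
        rw [hfx]
        exact hji
      rcases Nat.eq_or_lt_of_le (show y ≤ x - 1 by omega) with hyx | hyx
      · rw [← hyx]
        exact hc' l hl
      · exact (hf.slt y (x - 1) hyx (by omega)).between hslt hc' l hl
    obtain ⟨k, k1, k2, k3, k4⟩ := hs.isStr.exists_ne (i := i) (j := f (x - 1))
      (fun he => Slt.irrefl (he ▸ hslt)) hi.le hp.le
    have hhk : h ≤ k := by
      by_contra hcon
      exact k4 (hcom k (by omega)).symm
    have a1 : u.arr aStr ((i : ℤ) + h) = str (i + h) := by
      rw [u6 _ (by decide), ← hs.arr (i + h) (by omega)]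
      simp
    have a2 : u.arr aStr ((f (x - 1) : ℤ) + h) = str (f (x - 1) + h) := by
      rw [u6 _ (by decide), ← hs.arr (f (x - 1) + h) (by omega)]
      simp
    have b1 := hs.le (i + h)
    have b2 := hs.le (f (x - 1) + h)
    rw [Ter_seq, Ter_assign, Ter_ite]
    refine ⟨?_, ?_, fun hc' => ?_, fun hc' => ?_⟩
    · simp [u2, u5, ainv, asuf]
      omega
    · simp [u2, u3, u5, ainv, asuf, a1, a2]
      omega
    · simp [u2, u3, ainv, asuf, a1, a2] at hc'
      have hhk' : h ≠ k := by
        rintro rfl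
        exact k4 hc'
      simp [u2, u3, ainv, asuf]
      refine ⟨by omega, i, h + 1, ⟨by omega, by simp [u2], by simp, by simpa using u4, u5, u6,
        fun _ => ⟨hi, f (x - 1), hp, hslt, fun l hl => ?_⟩, u8⟩, by omega⟩
      rcases Nat.lt_succ_iff_lt_or_eq.1 hl with hl | rfl
      · exact hcom l hl
      · exact hc'.symm
    · simp [u2, u3, ainv, asuf, a1, a2] at hc'
      have hhk' : h = k := by
        by_contra hne
        exact hc' (k3 h (by omega))
      subst hhk'
      have hdone : ∀ v : Store, (v.arr aLCP = fun y => if y = (x : ℤ) + 1 then (h : ℤ) else u.arr aLCP y) →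
          ∀ y, 0 < y → y < n → f y < i + 1 → ∃ k : ℕ, HasLcp str (f y) (f (y - 1)) k ∧
            v.arr aLCP ((y : ℤ) + 1) = k := by
        intro v hv y hy0 hy hlt
        rw [hv]
        by_cases hyx : y = x
        · subst hyx
          refine ⟨h, ⟨fun l hl => ?_, ?_⟩, by simp⟩
          · rw [hfx]
            exact (hcom l hl).symm
          · rw [hfx]
            exact hc'
        · have : f y ≠ i := by
            rw [← hfx]
            intro he
            exact hyx (hf.inj hy hx he)
          obtain ⟨k, hk, hk'⟩ := u8 y hy0 hy (by omega)
          refine ⟨k, hk, ?_⟩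
          simp only [Nat.cast_inj, add_left_inj, hyx, if_false]
          exact hk'
      have hcom' : 1 < h → i + 1 < n ∧ ∃ j < n, Slt str j (i + 1) ∧
          ∀ l < h - 1, str (j + l) = str (i + 1 + l) := by
        intro hh
        refine ⟨by omega, f (x - 1) + 1, by omega, ?_, fun l hl => ?_⟩
        · rcases slt_iff.1 hslt with hlt | ⟨-, hlt⟩
          · have := hcom 0 (by omega)
            simp only [add_zero] at this
            omega
          · exact hlt
        · have := hcom (1 + l) (by omega)
          rwa [← add_assoc, ← add_assoc] at this
      have harr : ∀ a, a ≠ aLCP → (u.setCell aLCP ((x : ℤ) + 1) h).arr a = s.arr a := by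
        intro a ha
        rw [← u6 a ha]
        funext y
        have : a ≠ 2 := ha
        simp [this]
      have hlcp : (u.setCell aLCP ((x : ℤ) + 1) h).arr aLCP =
          fun y => if y = (x : ℤ) + 1 then (h : ℤ) else u.arr aLCP y := by
        funext y
        simp
      simp only [whenever, Ter_seq, Ter_put, Ter_assign, Ter_ite, Ter_skip]
      refine ⟨?_, ?_, ?_, ?_, ?_, ?_, ?_⟩
      · simp [u2, ainv]
        omega
      · simp [u3]
        omega
      · simp [u2, ainv, u5]
        simp at hz3
        omega
      · simp [u2]
        omega
      · simp [u3]
        omega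
      · intro hh
        simp [u3] at hh
        refine ⟨?_, ?_⟩
        · simp [u3]
          omega
        · refine ⟨i + 1, h - 1, ⟨by omega, ?_, ?_, ?_, u5, ?_, ?_, ?_⟩, by omega⟩
          · simp [u2]
          · simp [u3]
            omega
          · simpa using u4
          · intro a ha
            rw [← harr a ha]
            simp [u2, u3, ainv]
            rfl
          · intro h0
            exact hcom' (by omega)
          · refine hdone _ ?_
            rw [← hlcp]
            simp [u2, u3, ainv]
            rfl
      · intro hh
        simp [u3] at hh
        subst hh
        refine ⟨i + 1, 0, ⟨by omega, ?_, ?_, ?_, u5, ?_, by simp, ?_⟩, by omega⟩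
        · simp [u2]
        · simp [u3]
        · simpa using u4
        · intro a ha
          rw [← harr a ha]
          simp [u2, u3, ainv]
          rfl
        · refine hdone _ ?_
          rw [← hlcp]
          simp [u2, u3, ainv]
          rfl

theorem lcpLoop_run (hs : StrAt W s 0 n str) (hf : IsSorted str n f)
    (hsuf : ∀ x < n, s.arr aSuf (x : ℕ) = f x) (hinv : ∀ x < n, s.arr aInv (f x : ℕ) = x)
    (hz1 : n ≤ s.size aSuf) (hz2 : n ≤ s.size aInv) (hz3 : n < s.size aLCP)
    (hn : s.var xN = n) :
    Run W lcpLoop s (300 * n + 20) (fun s' =>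
      (∀ x, 0 < x → x < n → ∃ k : ℕ, HasLcp str (f x) (f (x - 1)) k ∧
        s'.arr aLCP ((x : ℤ) + 1) = k) ∧
      Frame [rAt, rLcp, rRow, rPrev] [aLCP] s s') := by
  have h1 := hs.size
  have h2 := hs.fit
  have hcost : lcpStep.maxCost ≤ 90 := by decide
  have e1 : Exec W (assign rAt (.lit 0)) s 2 (s.setVar rAt 0) :=
    .assign_val rAt (.lit 0) (by simp) rfl
  have e2 : Exec W (assign rLcp (.lit 0)) (s.setVar rAt 0) 2 ((s.setVar rAt 0).setVar rLcp 0) :=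
    .assign_val rLcp (.lit 0) (by simp) rfl
  have hw := Run.loop (W := W) (b := .lt (.var rAt) (.var xN)) (c := lcpStep)
    (fun (g : ℕ × ℕ) u => LcpInv s n str f g.1 g.2 u) (fun g => 100 * (3 * n - (2 * g.1 + g.2)))
    ?_ ?_ (0, 0) ((s.setVar rAt 0).setVar rLcp 0)
    ⟨by simp, by simp, by simp, by simpa using hn, rfl, fun _ _ => rfl, by simp, by simp⟩
  · obtain ⟨t, s', e, b, ⟨i, h⟩, hI, hb⟩ := hw
    have ef : Exec W lcpLoop s _ s' := .seq _ _ _ _ _ _ _ e1 <| .seq _ _ _ _ _ _ _ e2 e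
    refine ⟨_, _, ef, ?_, ?_, (ef.frame rfl).mono (by decide) (by decide)⟩
    · simp only [Cond.cost, Expr.cost] at b
      omega
    · simp only [Cond.holds, Expr.val, hI.at_eq, hI.n_eq] at hb
      exact fun x hx0 hx => hI.done x hx0 hx (by have := hf.lt x hx; omega)
  · rintro ⟨i, h⟩ u hu
    have g1 := hu.at_eq
    have g2 := hu.n_eq
    have g3 := hu.le
    simp only [Cond.ok, Expr.ok, g1, g2]
    omega
  · rintro ⟨i, h⟩ u hu hb
    simp only [Cond.holds, Expr.val, hu.at_eq, hu.n_eq] at hb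
    refine ⟨90, ((lcpStep_ter hs hf hsuf hinv hz1 hz2 hz3 hu (by omega)).run rfl).mono hcost ?_⟩
    rintro v ⟨i', h', hv, hlt⟩
    refine ⟨(i', h'), hv, ?_⟩
    have := hv.le
    have := hu.le
    simp only [Cond.cost, Expr.cost]
    omega

end


section Lists

variable {A : Type*}

theorem IsText.two_le [LinearOrder A] {T : List A} (h : IsText T) : 2 ≤ T.length := by
  obtain ⟨w, d, rfl, hw, -⟩ := h
  have := List.length_pos_iff.2 hw
  simp
  omega

theorem IsText.length_revText [LinearOrder A] {T : List A} (h : IsText T) :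
    (revText T).length = T.length := by
  obtain ⟨w, d, rfl, hw, -⟩ := h
  simp [revText]

theorem IsText.revText_getElem? [LinearOrder A] {T : List A} (h : IsText T) {j : ℕ}
    (hj : j + 1 < T.length) : (revText T)[j]? = T[T.length - 2 - j]? := by
  obtain ⟨w, d, rfl, hw, -⟩ := h
  simp only [List.length_append, List.length_singleton] at hj
  simp only [revText, List.dropLast_concat, List.length_append, List.length_singleton]
  rw [List.getElem?_append_left (by simp; omega), List.getElem?_append_left (by omega),
    List.getElem?_reverse (by omega)]
  congr 1

theorem IsText.revText_getElem?_last [LinearOrder A] {T : List A} (h : IsText T) {j : ℕ}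
    (hj : j + 1 = T.length) : (revText T)[j]? = T[j]? := by
  obtain ⟨w, d, rfl, hw, -⟩ := h
  simp only [List.length_append, List.length_singleton] at hj
  simp only [revText, List.dropLast_concat]
  rw [List.getElem?_append_right (by simp; omega), List.getElem?_append_right (by omega)]
  simp

theorem lcpLen_eq [DecidableEq A] {u v : List A} {k : ℕ} (h : ∀ l < k, u[l]? = v[l]?)
    (hk : u[k]? ≠ v[k]?) : lcpLen u v = k := by
  induction k generalizing u v with
  | zero => cases u <;> cases v <;> simp_all [lcpLen]
  | succ k ih =>
    have h0 := h 0 (by omega)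
    cases u with
    | nil => cases v <;> simp_all
    | cons a u =>
      cases v with
      | nil => simp at h0
      | cons b v =>
        simp only [List.getElem?_cons_zero, Option.some.injEq] at h0
        simp only [lcpLen, h0, if_true, Nat.add_right_cancel_iff]
        exact ih (fun l hl => by simpa using h (l + 1) (by omega)) (by simpa using hk)

variable [Fintype A] [LinearOrder A]

theorem rank_pos (c : A) : 1 ≤ rank c := by
  have : 0 < (Finset.univ.filter (· ≤ c)).card := Finset.card_pos.2 ⟨c, by simp⟩
  unfold rank
  omega

theorem rank_le (c : A) : rank c ≤ Fintype.card A := by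
  unfold rank
  exact_mod_cast Finset.card_le_univ _

theorem rank_lt {c d : A} (h : c < d) : rank c < rank d := by
  unfold rank
  refine Nat.cast_lt.2 (Finset.card_lt_card ?_)
  rw [Finset.ssubset_iff_of_subset]
  · exact ⟨d, by simp, by simpa using h⟩
  · intro x
    simp only [Finset.mem_filter, Finset.mem_univ, true_and]
    exact fun hx => hx.trans h.le

theorem rank_lt_iff {c d : A} : rank c < rank d ↔ c < d := by
  refine ⟨fun h => ?_, rank_lt⟩
  by_contra hcon
  rcases (not_lt.1 hcon).eq_or_lt with rfl | h'
  · exact lt_irrefl _ h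
  · exact lt_asymm h (rank_lt h')

@[simp] theorem code_none : code (none : Option A) = 0 := rfl

@[simp] theorem code_some (c : A) : code (some c) = rank c := rfl

theorem code_nonneg (c : Option A) : 0 ≤ code c := by
  cases c with
  | none => simp
  | some c => exact zero_le_one.trans (rank_pos c)

theorem code_le (c : Option A) : code c ≤ Fintype.card A := by
  cases c with
  | none => simp
  | some c => exact rank_le c

theorem code_inj {c d : Option A} : code c = code d ↔ c = d := by
  refine ⟨fun h => ?_, fun h => h ▸ rfl⟩
  cases c with
  | none =>
    cases d with
    | none => rfl
    | some d => have := rank_pos d; simp at h; omega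
  | some c =>
    cases d with
    | none => have := rank_pos c; simp at h; omega
    | some d =>
      simp only [code_some] at h
      rcases lt_trichotomy c d with h' | rfl | h'
      · have := rank_lt h'; omega
      · rfl
      · have := rank_lt h'; omega

theorem lt_of_code_lt {u v : List A} {k : ℕ} (h : ∀ l < k, u[l]? = v[l]?)
    (hk : code u[k]? < code v[k]?) : u < v := by
  induction k generalizing u v with
  | zero =>
    cases v with
    | nil => have := code_nonneg u[0]?; simp at hk; omega
    | cons b v =>
      cases u with
      | nil => exact List.nil_lt_cons _ _
      | cons a u =>
        simp only [List.getElem?_cons_zero, code_some, rank_lt_iff] at hk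
        exact List.Lex.rel hk
  | succ k ih =>
    have h0 := h 0 (by omega)
    cases v with
    | nil => have := code_nonneg u[k + 1]?; simp at hk; omega
    | cons b v =>
      cases u with
      | nil => simp at h0
      | cons a u =>
        simp only [List.getElem?_cons_zero, Option.some.injEq] at h0
        subst h0
        have := ih (u := u) (v := v) (fun l hl => by simpa using h (l + 1) (by omega))
          (by simpa using hk)
        exact List.Lex.cons this

/-- The string of letter numbers of a list. -/
def letters (R : List A) (i : ℕ) : ℕ := (code R[i]?).toNat

theorem letters_cast (R : List A) (i : ℕ) : (letters R i : ℤ) = code R[i]? :=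
  Int.toNat_of_nonneg (code_nonneg _)

theorem letters_eq_iff {R : List A} {i j : ℕ} : letters R i = letters R j ↔ R[i]? = R[j]? := by
  rw [← code_inj, ← letters_cast, ← letters_cast]
  omega

theorem letters_isStr (R : List A) : IsStr (letters R) R.length where
  pos i hi := by
    have h := letters_cast R i
    rw [List.getElem?_eq_getElem hi, code_some] at h
    have := rank_pos R[i]
    omega
  zero i hi := by
    have h := letters_cast R i
    rw [List.getElem?_eq_none hi, code_none] at h
    omega

theorem letters_le (R : List A) (i : ℕ) : letters R i ≤ Fintype.card A := by
  have := letters_cast R i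
  have := code_le R[i]?
  omega

theorem HasLcp.lcpLen_eq {R : List A} {p q k : ℕ} (h : HasLcp (letters R) p q k) :
    lcpLen (R.drop p) (R.drop q) = k := by
  refine Suffixient.lcpLen_eq (fun l hl => ?_) ?_
  · simpa [letters_eq_iff] using h.1 l hl
  · simpa [letters_eq_iff] using h.2

theorem Slt.drop_lt {R : List A} {p q : ℕ} (h : Slt (letters R) p q) : R.drop p < R.drop q := by
  obtain ⟨k, h1, h2⟩ := h
  refine lt_of_code_lt (k := k) (fun l hl => ?_) ?_
  · simpa [letters_eq_iff] using h1 l hl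
  · simp only [List.getElem?_drop, ← letters_cast]
    omega

theorem IsSorted.isSuffixArray {R : List A} {f : ℕ → ℕ} (h : IsSorted (letters R) R.length f) :
    IsSuffixArray R (fun i => f (i - 1) + 1) := by
  refine ⟨⟨fun i hi => ?_, fun i hi j hj hij => ?_, fun p hp => ?_⟩, fun i j h1 hij hj => ?_⟩
  · simp only [Set.mem_Icc] at hi ⊢
    have := h.lt (i - 1) (by omega)
    omega
  · simp only [Set.mem_Icc, Nat.add_right_cancel_iff] at hi hj hij
    have := h.inj (show i - 1 < _ by omega) (show j - 1 < _ by omega) hij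
    omega
  · simp only [Set.mem_Icc] at hp
    obtain ⟨x, hx, hfx⟩ := h.exists (show p - 1 < R.length by omega)
    refine ⟨x + 1, by simp only [Set.mem_Icc]; omega, ?_⟩
    simp only [Nat.add_sub_cancel, hfx]
    omega
  · simpa using (h.slt (i - 1) (j - 1) (by omega) (by omega)).drop_lt

end Lists

/-- Allocate the given arrays. -/
def allocAll : List ℕ → Cmd
  | [] => skip
  | a :: as => seq (alloc a (.add (.mul (.lit 24) (.var xN)) (.lit 10))) (allocAll as)

theorem allocAll_run {W n : ℕ} (hW : (24 * n + 40 : ℤ) < W) (as : List ℕ) (s : Store)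
    (hn : s.var xN = n) : Run W (allocAll as) s (as.length * (24 * n + 20) + 1) (fun s' =>
      s'.var = s.var ∧ (∀ a, s'.size a = if a ∈ as then 24 * n + 10 else s.size a) ∧
      (∀ a, s'.arr a = if a ∈ as then (fun _ => 0) else s.arr a) ∧
      s'.used = s.used + as.length * (24 * n + 10)) := by
  induction as generalizing s with
  | nil => exact ⟨_, _, .skip s, by simp, by simp⟩
  | cons a as ih =>
    have hn' : s.var 0 = n := hn
    have := Run.seq (W := W) (Run.alloc (a := a) (e := .add (.mul (.lit 24) (.var xN)) (.lit 10))
      (k := 24 * n + 10) (s := s) (by simp [hn']; omega) (by simp [hn'])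
      (ih (s.newArray a (24 * n + 10)) hn))
    refine this.mono ?_ ?_
    · simp only [Expr.cost, List.length_cons]
      ring_nf
      omega
    · rintro s' ⟨h1, h2, h3, h4⟩
      refine ⟨h1, fun b => ?_, fun b => ?_, ?_⟩
      · rw [h2]
        by_cases hb : b = a <;> simp [hb]
      · rw [h3]
        funext j
        by_cases hb : b = a
        · simp only [hb, List.mem_cons, true_or, if_true]
          split_ifs <;> simp
        · simp only [List.mem_cons, hb, false_or]
          split_ifs <;> simp [hb]
      · rw [h4]
        simp
        ring

/-- Write the reversed text. -/
def loadText : Cmd := forLt rJ (.var xN)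
  (ite (.eq (.add (.var rJ) (.lit 1)) (.var xN))
    (put aStr (.var rJ) (.get aT (.var xN)))
    (put aStr (.var rJ) (.get aT (.sub (.sub (.var xN) (.lit 1)) (.var rJ)))))

/-- Write the suffix array, its inverse and the Burrows-Wheeler transform. -/
def writeRows : Cmd := forLt rJ (.var xN) (block [
  assign rTmp (.get aSuf (.var rJ)),
  put aSA (.add (.var rJ) (.lit 1)) (.add (.var rTmp) (.lit 1)),
  put aInv (.var rTmp) (.var rJ),
  ite (.eq (.var rTmp) (.lit 0))
    (put aBWT (.add (.var rJ) (.lit 1)) (.get aStr (.sub (.var xN) (.lit 1))))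
    (put aBWT (.add (.var rJ) (.lit 1)) (.get aStr (.sub (.var rTmp) (.lit 1))))])

/-- Compute the suffix array, the longest common prefixes and the Burrows-Wheeler transform of the
reversed text. -/
def buildArrays : Cmd := block [
  allocAll [aStr, aItem, aSorted, aCount, aOffs, aLens, aRank, aSample, aSuf, aInv, aSA, aLCP, aBWT],
  loadText, assign rM (.var xN), sortSuffixes, writeRows, lcpLoop]

section

variable {W : ℕ} {s : Store} {n : ℕ} {str f : ℕ → ℕ}

theorem loadText_run (hn : s.var xN = n) (hW : (n : ℤ) + 10 < W) (hz : n ≤ s.size aStr)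
    (hT : n < s.size aT) (hle : ∀ i, str i ≤ n)
    (h1 : ∀ i : ℕ, i + 1 < n → s.arr aT ((n : ℤ) - 1 - i) = str i)
    (h2 : ∀ i : ℕ, i + 1 = n → s.arr aT (n : ℤ) = str i) (h0 : s.arr aStr = fun _ => 0) :
    Run W loadText s (n * 30 + 30) (fun s' =>
      (∀ i : ℕ, i < n → s'.arr aStr i = str i) ∧ (∀ i : ℤ, n ≤ i → s'.arr aStr i = 0) ∧
      Frame [rJ] [aStr] s s') := by
  have hn' : s.var 0 = n := hn
  have hT' : n < s.size 0 := hT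
  refine (Run.forLt 30 n (fun v s' => (∀ i : ℕ, i < v → s'.arr aStr i = str i) ∧
    (∀ i : ℤ, v ≤ i → s'.arr aStr i = 0)) (by omega) (by decide) rfl (by decide) ?_ ?_ ?_).mono
      le_rfl ?_
  · intro v s' hv fr hj _
    have := fr.var 0 (by decide)
    simp [this, hn']
    omega
  · simp [h0]
  · rintro v s' hv fr hj ⟨i1, i2⟩
    have e0 : s'.var 0 = n := by rw [fr.var 0 (by decide), hn']
    have e1 : s'.arr 0 = s.arr 0 := fr.arr _ (by decide)
    have e2 : s'.size = s.size := fr.size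
    have b := hle v
    have key : ∀ i : ℕ, i ≤ v → (if i = v then (str v : ℤ) else s'.arr aStr i) = str i := by
      intro i hi
      by_cases h : i = v
      · simp [h]
      · simp [h, i1 i (by omega)]
    have key' : ∀ i : ℤ, (v : ℤ) + 1 ≤ i → (if (i : ℤ) = v then (str v : ℤ) else s'.arr aStr i) = 0 := by
      intro i hi
      rw [if_neg (by omega), i2 i (by omega)]
    simp only [Ter_ite, Ter_put]
    refine ⟨?_, fun hc => ?_, fun hc => ?_⟩
    · simp [hj, e0]
      omega
    · simp [hj, e0] at hc
      have a := h2 v (by omega)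
      simp only [aT] at a
      simp [hj, e0, e1, e2, a]
      refine ⟨?_, ?_, ?_, key, key'⟩ <;> omega
    · simp [hj, e0] at hc
      have a := h1 v (by omega)
      simp only [aT] at a
      simp [hj, e0, e1, e2, a]
      refine ⟨?_, ?_, ?_, key, key'⟩ <;> omega
  · rintro s' ⟨⟨i1, i2⟩, -, fr⟩
    exact ⟨i1, i2, fr.mono (by decide) (by decide)⟩

theorem writeRows_run (hs : StrAt W s 0 n str) (hf : IsSorted str n f)
    (hsuf : ∀ x < n, s.arr aSuf (x : ℕ) = f x) (hn : s.var xN = n)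
    (hz1 : n ≤ s.size aSuf) (hz2 : n ≤ s.size aInv) (hz3 : n < s.size aSA) (hz4 : n < s.size aBWT) :
    Run W writeRows s (n * 80 + 80) (fun s' =>
      (∀ x < n, s'.arr aInv (f x : ℕ) = x) ∧
      (∀ x < n, s'.arr aSA ((x : ℤ) + 1) = f x + 1) ∧
      (∀ x < n, s'.arr aBWT ((x : ℤ) + 1) = if f x = 0 then str (n - 1) else str (f x - 1)) ∧
      Frame [rJ, rTmp] [aSA, aInv, aBWT] s s') := by
  have h1 := hs.size
  have h2 := hs.fit
  have hn' : s.var 0 = n := hn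
  have hz3' : n < s.size 1 := hz3
  have hz4' : n < s.size 3 := hz4
  refine (Run.forLt 80 n (fun v s' => (∀ x < v, s'.arr aInv (f x : ℕ) = x) ∧
      (∀ x < v, s'.arr 1 ((x : ℤ) + 1) = f x + 1) ∧
      (∀ x < v, s'.arr 3 ((x : ℤ) + 1) = if f x = 0 then str (n - 1) else str (f x - 1)))
      (by omega) (by decide) rfl (by decide) ?_ ?_ ?_).mono le_rfl ?_
  · intro v s' hv fr hj _
    have := fr.var 0 (by decide)
    simp [this, hn']
    omega
  · simp
  · rintro v s' hv fr hj ⟨i1, i2, i3⟩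
    have e0 : s'.var 0 = n := by rw [fr.var 0 (by decide), hn']
    have e1 : s'.arr aSuf v = f v := by rw [fr.arr aSuf (by decide), hsuf v hv]
    have e2 : s'.size = s.size := fr.size
    have e3 : s'.arr aStr = s.arr aStr := fr.arr _ (by decide)
    have hfv := hf.lt v hv
    have k1 : ∀ x ≤ v, (if f x = f v then (v : ℤ) else s'.arr aInv (f x)) = x := by
      intro x hx
      by_cases h : x = v
      · simp [h]
      · have : f x ≠ f v := fun he => h (hf.inj (by omega) hv he)
        simp [this, i1 x (by omega)]
    have k2 : ∀ x ≤ v, (if x = v then (f v : ℤ) + 1 else s'.arr 1 (x + 1)) = f x + 1 := by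
      intro x hx
      by_cases h : x = v
      · simp [h]
      · simp [h, i2 x (by omega)]
    have k3 : ∀ z : ℤ, z = (if f v = 0 then str (n - 1) else str (f v - 1) : ℕ) → ∀ x ≤ v,
        (if x = v then z else s'.arr 3 (x + 1)) =
          if f x = 0 then (str (n - 1) : ℤ) else str (f x - 1) := by
      intro z hz x hx
      by_cases h : x = v
      · simp [h, hz]
      · simp [h, i3 x (by omega)]
    simp only [block, Ter_seq, Ter_ite, Ter_put, Ter_assign]
    refine ⟨?_, ?_, ?_, ?_, ?_, ?_, ?_, ?_, fun hc => ?_, fun hc => ?_⟩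
    · simp [hj, e1, e2]
      omega
    · simp [hj]
      omega
    · simp [e1, hj]
      omega
    · simp [hj, e2]
      omega
    · simp [hj, e1]
      omega
    · simp [hj]
      omega
    · simp [hj, e1, e2]
      omega
    · simp [hj, e1]
      omega
    · simp [hj, e1] at hc
      have a : s.arr aStr ((n : ℤ) - 1) = str (n - 1) := by
        rw [← hs.arr (n - 1) (by omega)]
        congr 1
        push_cast
        omega
      have b := hs.le (n - 1)
      simp [hj, e0, e1, e2, e3, a]
      refine ⟨by omega, by omega, by omega, k1, k2, k3 _ ?_⟩
      simp [hc]
    · simp [hj, e1] at hc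
      have a : s.arr aStr ((f v : ℤ) - 1) = str (f v - 1) := by
        rw [← hs.arr (f v - 1) (by omega)]
        congr 1
        push_cast
        omega
      have b := hs.le (f v - 1)
      simp [hj, e1, e2, e3, a]
      refine ⟨by omega, by omega, by omega, k1, k2, k3 _ ?_⟩
      simp [hc]
  · rintro s' ⟨⟨i1, i2, i3⟩, -, fr⟩
    exact ⟨i1, i2, i3, fr.mono (by decide) (by decide)⟩

end

theorem buildArrays_run {A : Type*} [Fintype A] [LinearOrder A] {W : ℕ} {T : List A} (hT : IsText T)
    (hA : Fintype.card A ≤ T.length) (hW : (24 * T.length + 40 : ℤ) < W) :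
    Run W buildArrays (inputStore T) (60000 * T.length) (fun s =>
      HoldsArrays T s ∧ s.used ≤ 1000 * T.length) := by
  have h2 := hT.two_le
  set n := T.length with hn
  set R := revText T with hR
  have hRn : R.length = n := hT.length_revText
  obtain ⟨t₁, s₁, x₁, b₁, v₁, z₁, a₁, u₁⟩ := allocAll_run (n := n) hW [aStr, aItem, aSorted, aCount,
    aOffs, aLens, aRank, aSample, aSuf, aInv, aSA, aLCP, aBWT] (inputStore T) (by simp [inputStore, hn])
  have n₁ : s₁.var 0 = n := by rw [v₁]; simp [inputStore, hn]
  have szT : s₁.size aT = n + 1 := by rw [z₁]; simp [inputStore, hn]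
  have arT : ∀ i : ℤ, 1 ≤ i → s₁.arr aT i = code T[(i - 1).toNat]? := by
    intro i hi
    rw [a₁]
    simp [inputStore, hi]
  have hcell : ∀ i : ℕ, i + 1 < n → s₁.arr aT ((n : ℤ) - 1 - i) = letters R i := by
    intro i hi
    rw [arT _ (by omega), letters_cast, hT.revText_getElem? hi]
    congr 2
    omega
  have hlast : ∀ i : ℕ, i + 1 = n → s₁.arr aT (n : ℤ) = letters R i := by
    intro i hi
    rw [arT _ (by omega), letters_cast, hT.revText_getElem?_last hi]
    congr 2
    omega
  obtain ⟨t₂, s₂, x₂, b₂, c₂, d₂, f₂⟩ := loadText_run (W := W) (s := s₁) (n := n) (str := letters R) n₁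
    (by omega) (by rw [z₁]; simp; omega) (by omega) (fun i => (letters_le R i).trans hA) hcell hlast
    (by rw [a₁]; simp)
  have n₂ : s₂.var 0 = n := by rw [f₂.var _ (by decide), n₁]
  have x₃ : Exec W (assign rM (.var xN)) s₂ 2 (s₂.setVar rM n) :=
    .assign_val rM (.var xN) (by simp [n₂]; omega) n₂
  set s₃ := s₂.setVar rM n with hs₃
  have z₃ : ∀ a, a ∈ [aStr, aItem, aSorted, aCount, aOffs, aLens, aRank, aSample, aSuf, aInv, aSA,
      aLCP, aBWT] → s₃.size a = 24 * n + 10 := by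
    intro a ha
    rw [hs₃, Store.setVar_size, f₂.size, z₁, if_pos ha]
  have hstr : StrAt W s₃ 0 n (letters R) := by
    refine ⟨hRn ▸ letters_isStr R, fun i => (letters_le R i).trans hA, fun i hi => ?_, ?_, ?_⟩
    · rw [hs₃, Store.setVar_arr]
      simp only [Nat.cast_zero, zero_add]
      by_cases h : i < n
      · exact c₂ i h
      · rw [d₂ i (by omega), (letters_isStr R).zero i (by omega), Nat.cast_zero]
    · rw [z₃ _ (by simp)]
      omega
    · rw [z₃ _ (by simp)]
      omega
  have v₃ : ∀ x, x ∉ [rJ, rM] → s₃.var x = (inputStore T).var x := by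
    intro x hx
    simp only [List.mem_cons, List.not_mem_nil, or_false, not_or] at hx
    rw [hs₃, Store.setVar_var, if_neg hx.2, f₂.var x (by simp [hx.1]), v₁]
  obtain ⟨t₄, s₄, x₄, b₄, ⟨⟨f, hf, hsuf⟩, c₄⟩, f₄⟩ := (sortSuffixes_run hstr (by omega)
    ⟨⟨by rw [z₃ _ (by simp)]; omega, by rw [z₃ _ (by simp)]; omega, by rw [z₃ _ (by simp)]; omega⟩,
      by rw [z₃ _ (by simp)]; omega, by rw [z₃ _ (by simp)]; omega, by rw [z₃ _ (by simp)]; omega⟩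
    (by rw [v₃ _ (by decide)]; simp [inputStore]) (by rw [hs₃]; simp)
    (by rw [v₃ _ (by decide)]; simp [inputStore]) (by rw [z₃ _ (by simp)]; omega)
    (by rw [z₃ _ (by simp)]; omega) (by rw [z₃ _ (by simp)])
    (by rw [hs₃, Store.setVar_arr]; exact d₂)).frame rfl
  have z₄ : ∀ a, a ∈ [aStr, aItem, aSorted, aCount, aOffs, aLens, aRank, aSample, aSuf, aInv, aSA,
      aLCP, aBWT] → s₄.size a = 24 * n + 10 := by
    intro a ha
    rw [f₄.size, z₃ a ha]
  have n₄ : s₄.var 0 = n := by rw [f₄.var _ (by decide), v₃ _ (by decide)]; simp [inputStore, hn]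
  have hstr₄ : StrAt W s₄ 0 n (letters R) :=
    ⟨hstr.isStr, hstr.le, fun i hi => by rw [c₄ _ (by omega), hstr.arr i hi],
      by rw [f₄.size]; exact hstr.size, by rw [f₄.size]; exact hstr.fit⟩
  obtain ⟨t₅, s₅, x₅, b₅, i₅, sa₅, bw₅, f₅⟩ := writeRows_run hstr₄ hf hsuf n₄
    (by rw [z₄ _ (by simp)]; omega) (by rw [z₄ _ (by simp)]; omega) (by rw [z₄ _ (by simp)]; omega)
    (by rw [z₄ _ (by simp)]; omega)
  obtain ⟨t₆, s₆, x₆, b₆, l₆, f₆⟩ := lcpLoop_run (hstr₄.frame f₅ (by decide)) hf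
    (by rw [f₅.arr aSuf (by decide)]; exact hsuf) i₅ (by rw [f₅.size, z₄ _ (by simp)]; omega)
    (by rw [f₅.size, z₄ _ (by simp)]; omega) (by rw [f₅.size, z₄ _ (by simp)]; omega)
    (by rw [f₅.var xN (by decide)]; exact n₄)
  have z₆ : s₆.size = s₄.size := by rw [f₆.size, f₅.size]
  refine ⟨_, s₆, .seq _ _ _ _ _ _ _ x₁ <| .seq _ _ _ _ _ _ _ x₂ <| .seq _ _ _ _ _ _ _ x₃ <|
    .seq _ _ _ _ _ _ _ x₄ <| .seq _ _ _ _ _ _ _ x₅ x₆, ?_, ⟨?_, ?_, ⟨?_, ?_⟩, fun i => f (i - 1) + 1, ?_,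
      ⟨?_, ?_⟩, ⟨?_, ?_⟩, ⟨?_, ?_⟩⟩, ?_⟩
  · simp only [List.length_cons, List.length_nil] at b₁
    omega
  · rw [f₆.var _ (by decide), f₅.var _ (by decide)]
    exact n₄
  · rw [f₆.var _ (by decide), f₅.var _ (by decide), f₄.var _ (by decide), v₃ _ (by decide)]
    simp [inputStore]
  · rw [z₆, f₄.size, hs₃, Store.setVar_size, f₂.size, szT]
    omega
  · intro i h1 hi
    rw [f₆.arr _ (by decide), f₅.arr _ (by decide), f₄.arr _ (by decide), hs₃, Store.setVar_arr,
      f₂.arr _ (by decide), arT _ (by omega)]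
    simp only [charAt, if_neg (show i ≠ 0 by omega)]
    congr 2
    omega
  · exact IsSorted.isSuffixArray (by rw [hRn]; exact hf)
  · rw [z₆, z₄ _ (by simp)]
    omega
  · intro i h1 hi
    rw [f₆.arr _ (by decide)]
    have := sa₅ (i - 1) (by omega)
    rw [show ((i - 1 : ℕ) : ℤ) + 1 = i by omega] at this
    rw [this]
    simp
  · rw [z₆, z₄ _ (by simp)]
    omega
  · intro i h1 hi
    obtain ⟨k, hk, hk'⟩ := l₆ (i - 1) (by omega) (by omega)
    rw [show ((i - 1 : ℕ) : ℤ) + 1 = i by omega] at hk'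
    rw [hk']
    simp only [lcpArray, Nat.add_sub_cancel]
    rw [hk.lcpLen_eq]
  · rw [z₆, z₄ _ (by simp)]
    omega
  · intro i h1 hi
    rw [f₆.arr _ (by decide)]
    have := bw₅ (i - 1) (by omega)
    rw [show ((i - 1 : ℕ) : ℤ) + 1 = i by omega] at this
    rw [this]
    simp only [bwtArray, charAt, Nat.add_sub_cancel]
    split_ifs
    · rw [letters_cast, List.getLast?_eq_getElem?, hRn]
    · rw [letters_cast]
  · rw [f₆.used, f₅.used, f₄.used, hs₃, Store.setVar_used, f₂.used, u₁]
    simp [inputStore]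
    omega

theorem mul_le_pow {n C : ℕ} (hn : 2 ≤ n) (hC : 8 ≤ C) : n * 128 ≤ n ^ C :=
  calc n * 128 = n * 2 ^ 7 := by norm_num
    _ ≤ n * n ^ 7 := Nat.mul_le_mul_left _ (Nat.pow_le_pow_left hn 7)
    _ = n ^ 8 := (pow_succ' _ _).symm
    _ ≤ n ^ C := Nat.pow_le_pow_right (by omega) hC

theorem buildArrays_spec : BuildsArrays.{u} buildArrays := by
  refine ⟨60000, fun A _ _ T hT hA => ?_⟩
  have h2 := hT.two_le
  have h3 : T.length * 128 ≤ T.length ^ 60000 := mul_le_pow h2 (by norm_num)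
  obtain ⟨t, s, h, ht, hs, hu⟩ := buildArrays_run (W := T.length ^ 60000) hT hA (by omega)
  exact ⟨t, s, h, ht, by omega, hs⟩


/-! ## The scan over the rows of the suffix array -/

/-- Rows `1, …, n` in lexicographic order, where `L i j` is the length of the longest common prefix of
the rows `i` and `j`. -/
structure Rows (n : ℕ) (L : ℕ → ℕ → ℤ) : Prop where
  nonneg : ∀ i j, 0 ≤ L i j
  le : ∀ i j, L i j ≤ n
  symm : ∀ i j, L i j = L j i
  ultra : ∀ i j k, min (L i j) (L j k) ≤ L i k
  left : ∀ i j k, 1 ≤ i → i ≤ j → j ≤ k → k ≤ n → L i k ≤ L i j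
  right : ∀ i j k, 1 ≤ i → i ≤ j → j ≤ k → k ≤ n → L i k ≤ L j k

section Rows

variable {n : ℕ} {L : ℕ → ℕ → ℤ} {i j k l : ℕ} {v : ℤ}

theorem Rows.trans (hL : Rows n L) (h1 : v ≤ L i j) (h2 : v ≤ L j k) : v ≤ L i k :=
  (le_min h1 h2).trans (hL.ultra i j k)

theorem Rows.nested (hL : Rows n L) (hi : 1 ≤ i) (hij : i ≤ j) (hjk : j ≤ k) (hkl : k ≤ l) (hl : l ≤ n) :
    L i l ≤ L j k :=
  (hL.left i k l hi (hij.trans hjk) hkl hl).trans (hL.right i j k hi hij hjk (hkl.trans hl))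

theorem Rows.eq_min (hL : Rows n L) (hi : 1 ≤ i) (hij : i ≤ j) (hjk : j ≤ k) (hk : k ≤ n) :
    L i k = min (L i j) (L j k) :=
  le_antisymm (le_min (hL.left i j k hi hij hjk hk) (hL.right i j k hi hij hjk hk)) (hL.ultra i j k)

theorem Rows.self (hL : Rows n L) (h : v ≤ L i j) : v ≤ L i i :=
  hL.trans h (hL.symm i j ▸ h)

end Rows

/-- The candidate kept for a letter. -/
structure Cell where
  len : ℤ
  pos : ℕ
  act : Bool

/-- The set after evaluating a candidate. -/
def Cell.evalSet (r : Cell) (l : ℤ) (S : Set ℕ) : Set ℕ :=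
  {y | y ∈ S ∨ (l < r.len ∧ r.act = true ∧ y = r.pos)}

/-- The candidate after its evaluation. -/
def Cell.eval (r : Cell) (l : ℤ) : Cell := if l < r.len then ⟨l, 0, false⟩ else r

/-- The candidate after the offer of the row `p` with length `v`. -/
def Cell.offer (r : Cell) (v : ℤ) (p : ℕ) : Cell := if r.len < v then ⟨v, p, true⟩ else r

/-- The row `z` has a letter other than `c`. -/
def Other (n : ℕ) (b : ℕ → ℤ) (c : ℤ) (z : ℕ) : Prop := 1 ≤ z ∧ z ≤ n ∧ b z ≠ c

/-- The state of the scan for the letter `c`, where `cand` are the candidates seen so far, `cur` is the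
last of them and `F` is the first row still to come. -/
structure LetterInv (n : ℕ) (b : ℕ → ℤ) (L : ℕ → ℕ → ℤ) (c : ℤ) (cand : Set (ℕ × ℤ)) (S : Set ℕ)
    (r : Cell) (cur F : ℕ) : Prop where
  nonneg : 0 ≤ r.len
  mem : ∀ y ∈ S, 1 ≤ y ∧ y ≤ cur ∧ b y = c
  pos : r.act = true → 1 ≤ r.pos ∧ r.pos ≤ cur ∧ b r.pos = c
  other : r.act = true → ∃ z, Other n b c z ∧ r.len ≤ L r.pos z
  near : r.act = true → r.len ≤ L r.pos cur
  apart : r.act = true → ∀ y ∈ S, L r.pos y < r.len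
  idle : r.act = false → ∃ x ∈ S, r.len ≤ L x cur
  covered : ∀ d ∈ cand, (∃ y ∈ S, d.2 ≤ L y d.1) ∨
    (r.act = true ∧ d.2 ≤ L r.pos d.1 ∧ d.2 ≤ r.len)
  bound : ∀ y ∈ S, ∀ k, F ≤ k → k ≤ n → L y k ≤ r.len
  sep : ∀ y ∈ S, ∃ z, Other n b c z ∧ (∀ k, F ≤ k → k ≤ n → L y k < L y z) ∧
    (∀ y' ∈ S, y' ≠ y → L y y' < L y z) ∧ (r.act = true → L y r.pos < L y z)

section

variable {n : ℕ} {b : ℕ → ℤ} {L : ℕ → ℕ → ℤ} {c : ℤ} {cand : Set (ℕ × ℤ)} {S : Set ℕ} {r : Cell}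
  {cur F : ℕ}

theorem LetterInv.init (hL : Rows n L) {row : ℕ} {v : ℤ} (hrow : 1 ≤ row) (hb : b row = c)
    (hz : ∃ z, Other n b c z ∧ v ≤ L row z) (hv : 0 ≤ v) :
    LetterInv n b L c {(row, v)} ∅ ⟨v, row, true⟩ row F := by
  obtain ⟨z, hz, hzv⟩ := hz
  have hs : v ≤ L row row := hL.self hzv
  refine ⟨hv, by simp, fun _ => ⟨hrow, le_rfl, hb⟩, fun _ => ⟨z, hz, hzv⟩, fun _ => hs, by simp,
    by simp, ?_, by simp, by simp⟩
  rintro d rfl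
  exact Or.inr ⟨rfl, hs, le_rfl⟩

/-- The effect of evaluating the candidate. -/
theorem LetterInv.eval (hL : Rows n L) (h : LetterInv n b L c cand S r cur F) {row F' : ℕ} {l : ℤ}
    (hF : F ≤ F') (hcur : cur ≤ row) (hl0 : 0 ≤ l) (hl : l ≤ L cur row)
    (hfut : ∀ x k, 1 ≤ x → x ≤ cur → F' ≤ k → k ≤ n → L x k ≤ l) :
    LetterInv n b L c cand (r.evalSet l S) (r.eval l) row F' := by
  by_cases hlt : l < r.len
  · have hS : r.evalSet l S = {y | y ∈ S ∨ (r.act = true ∧ y = r.pos)} := by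
      ext y
      simp [Cell.evalSet, hlt]
    rw [hS, Cell.eval, if_pos hlt]
    have hmem : ∀ y, (y ∈ S ∨ (r.act = true ∧ y = r.pos)) → 1 ≤ y ∧ y ≤ cur ∧ b y = c := by
      rintro y (hy | ⟨ha, rfl⟩)
      · exact h.mem y hy
      · exact h.pos ha
    refine ⟨hl0, ?_, by simp, by simp, by simp, by simp, fun _ => ?_, ?_, ?_, ?_⟩
    · intro y hy
      have := hmem y hy
      exact ⟨this.1, by omega, this.2.2⟩
    · by_cases ha : r.act = true
      · exact ⟨r.pos, Or.inr ⟨ha, rfl⟩, hL.trans (hlt.le.trans (h.near ha)) hl⟩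
      · obtain ⟨x, hx, hx'⟩ := h.idle (by simpa using ha)
        exact ⟨x, Or.inl hx, hL.trans (hlt.le.trans hx') hl⟩
    · intro d hd
      rcases h.covered d hd with ⟨y, hy, hd⟩ | ⟨ha, hd, -⟩
      · exact Or.inl ⟨y, Or.inl hy, hd⟩
      · exact Or.inl ⟨r.pos, Or.inr ⟨ha, rfl⟩, hd⟩
    · intro y hy k hk hkn
      have := hmem y hy
      exact hfut y k this.1 this.2.1 hk hkn
    · rintro y (hy | ⟨ha, rfl⟩)
      · obtain ⟨z, hz, h1, h2, h3⟩ := h.sep y hy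
        refine ⟨z, hz, fun k hk => h1 k (hF.trans hk), ?_, by simp⟩
        rintro y' (hy' | ⟨ha', rfl⟩) hne
        · exact h2 y' hy' hne
        · exact h3 ha'
      · obtain ⟨z, hz, hzv⟩ := h.other ha
        refine ⟨z, hz, fun k hk hkn => ?_, ?_, by simp⟩
        · have := h.pos ha
          have := hfut r.pos k this.1 this.2.1 hk hkn
          omega
        · rintro y' (hy' | ⟨ha', rfl⟩) hne
          · exact (h.apart ha y' hy').trans_le hzv
          · exact absurd rfl hne
  · have hS : r.evalSet l S = S := by
      ext y
      simp [Cell.evalSet, hlt]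
    rw [hS, Cell.eval, if_neg hlt]
    push Not at hlt
    refine ⟨h.nonneg, fun y hy => ?_, fun ha => ?_, h.other, fun ha => ?_, h.apart, fun ha => ?_, h.covered,
      fun y hy k hk => h.bound y hy k (hF.trans hk), fun y hy => ?_⟩
    · obtain ⟨h1, h2, h3⟩ := h.mem y hy
      exact ⟨h1, by omega, h3⟩
    · obtain ⟨h1, h2, h3⟩ := h.pos ha
      exact ⟨h1, by omega, h3⟩
    · exact hL.trans (h.near ha) (hlt.trans hl)
    · obtain ⟨x, hx, hx'⟩ := h.idle ha
      exact ⟨x, hx, hL.trans hx' (hlt.trans hl)⟩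
    · obtain ⟨z, hz, h1, h2, h3⟩ := h.sep y hy
      exact ⟨z, hz, fun k hk => h1 k (hF.trans hk), h2, h3⟩

/-- The effect of offering a new candidate. -/
theorem LetterInv.offer (hL : Rows n L) {row : ℕ} (h : LetterInv n b L c cand S r row F) {v : ℤ}
    (hrow : 1 ≤ row) (hb : b row = c) (hz : ∃ z, Other n b c z ∧ v ≤ L row z) (hv : r.len ≤ v)
    (hbd : r.len < v → ∀ y ∈ S, L row y ≤ r.len)
    (hsep : r.len < v → ∀ y ∈ S, ∃ z, Other n b c z ∧ (∀ k, F ≤ k → k ≤ n → L y k < L y z) ∧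
      (∀ y' ∈ S, y' ≠ y → L y y' < L y z) ∧ L y row < L y z) :
    LetterInv n b L c (insert (row, v) cand) S (r.offer v row) row F := by
  obtain ⟨z, hz, hzv⟩ := hz
  have hs : v ≤ L row row := hL.self hzv
  rcases hv.lt_or_eq with hlt | rfl
  · rw [Cell.offer, if_pos hlt]
    refine ⟨h.nonneg.trans hlt.le, h.mem, fun _ => ⟨hrow, le_rfl, hb⟩, fun _ => ⟨z, hz, hzv⟩, fun _ => hs,
      fun _ y hy => (hbd hlt y hy).trans_lt hlt, by simp, ?_,
      fun y hy k hk hkn => (h.bound y hy k hk hkn).trans hlt.le, fun y hy => ?_⟩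
    · rintro d (rfl | hd)
      · exact Or.inr ⟨rfl, hs, le_rfl⟩
      · rcases h.covered d hd with hd | ⟨ha, h1, h2⟩
        · exact Or.inl hd
        · refine Or.inr ⟨rfl, ?_, h2.trans hlt.le⟩
          exact hL.trans (hL.symm r.pos row ▸ h2.trans (h.near ha)) h1
    · obtain ⟨z, hz, h1, h2, h3⟩ := hsep hlt y hy
      exact ⟨z, hz, h1, h2, fun _ => h3⟩
  · rw [Cell.offer, if_neg (lt_irrefl _)]
    refine { h with covered := ?_ }
    rintro d (rfl | hd)
    · by_cases ha : r.act = true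
      · exact Or.inr ⟨ha, h.near ha, le_rfl⟩
      · exact Or.inl (h.idle (by simpa using ha))
    · exact h.covered d hd

/-- The effect of processing a candidate. -/
theorem LetterInv.step (hL : Rows n L) (h : LetterInv n b L c cand S r cur F) {row F' : ℕ} {l v : ℤ}
    (hF : F ≤ F') (hFr : F ≤ row) (hrown : row ≤ n) (hcur : cur ≤ row) (hrow : 1 ≤ row) (hb : b row = c)
    (hl0 : 0 ≤ l) (hl : l ≤ L cur row) (hlv : l ≤ v)
    (hfut : ∀ x k, 1 ≤ x → x ≤ cur → F' ≤ k → k ≤ n → L x k ≤ l)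
    (hpast : l < v → ∀ x, 1 ≤ x → x ≤ cur → L x row ≤ l)
    (hz : ∃ z, Other n b c z ∧ v ≤ L row z) :
    LetterInv n b L c (insert (row, v) cand) (r.evalSet l S) ((r.eval l).offer v row) row F' := by
  have he := h.eval hL hF hcur hl0 hl hfut
  by_cases hlt : l < r.len
  · have hlen : (r.eval l).len = l := by simp [Cell.eval, hlt]
    have hmem : ∀ y ∈ r.evalSet l S, 1 ≤ y ∧ y ≤ cur := by
      rintro y (hy | ⟨-, ha, rfl⟩)
      · exact ⟨(h.mem y hy).1, (h.mem y hy).2.1⟩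
      · exact ⟨(h.pos ha).1, (h.pos ha).2.1⟩
    refine he.offer hL hrow hb hz (hlen.le.trans hlv) (fun hv y hy => ?_) (fun hv y hy => ?_)
    · rw [hlen] at hv ⊢
      rw [hL.symm]
      exact hpast hv y (hmem y hy).1 (hmem y hy).2
    · rw [hlen] at hv
      rcases hy with hy | ⟨-, ha, rfl⟩
      · obtain ⟨z, hz, h1, h2, h3⟩ := h.sep y hy
        refine ⟨z, hz, fun k hk => h1 k (hF.trans hk), ?_, h1 row hFr hrown⟩
        rintro y' (hy' | ⟨-, ha', rfl⟩) hne
        · exact h2 y' hy' hne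
        · exact h3 ha'
      · obtain ⟨z, hz, hzv⟩ := h.other ha
        have hp := h.pos ha
        refine ⟨z, hz, fun k hk hkn => ?_, ?_, ?_⟩
        · have := hfut r.pos k hp.1 hp.2.1 hk hkn
          omega
        · rintro y' (hy' | ⟨-, ha', rfl⟩) hne
          · exact (h.apart ha y' hy').trans_le hzv
          · exact absurd rfl hne
        · have := hpast hv r.pos hp.1 hp.2.1
          omega
  · have hev : r.eval l = r := by simp [Cell.eval, hlt]
    have hS : r.evalSet l S = S := by
      ext y
      simp [Cell.evalSet, hlt]
    rw [hev, hS] at he ⊢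
    refine he.offer hL hrow hb hz (by omega) (fun hv y hy => ?_) (fun hv y hy => ?_)
    · rw [hL.symm]
      exact h.bound y hy row hFr hrown
    · obtain ⟨z, hz, h1, h2, h3⟩ := h.sep y hy
      exact ⟨z, hz, fun k hk => h1 k (hF.trans hk), h2, h1 row hFr hrown⟩

end


/-- No candidate for `c` arises from the first `i` rows. -/
def Fresh (b : ℕ → ℤ) (i : ℕ) (c : ℤ) : Prop :=
  (∀ k, 1 ≤ k → k ≤ i → b k ≠ c) ∨ (∀ k, 1 ≤ k → k ≤ i → b k = c)

/-- The candidates for `c` which arise from the first `i` rows: rows next to a row with another letter,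
together with the length of the prefix that they share with it. -/
def Seen (b : ℕ → ℤ) (L : ℕ → ℕ → ℤ) (i : ℕ) (c : ℤ) : Set (ℕ × ℤ) :=
  {d | b d.1 = c ∧ ((2 ≤ d.1 ∧ d.1 ≤ i ∧ b (d.1 - 1) ≠ c ∧ d.2 = L (d.1 - 1) d.1) ∨
    (1 ≤ d.1 ∧ d.1 + 1 ≤ i ∧ b (d.1 + 1) ≠ c ∧ d.2 = L d.1 (d.1 + 1)))}

/-- `q` is the last of the first `i` rows with letter `c`. -/
structure IsLast (b : ℕ → ℤ) (i : ℕ) (c : ℤ) (q : ℕ) : Prop where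
  pos : 1 ≤ q
  le : q ≤ i
  eq : b q = c
  ne : ∀ k, q < k → k ≤ i → b k ≠ c

/-- `p` is the first row of the run which contains row `i`. -/
structure RunStart (b : ℕ → ℤ) (i p : ℕ) : Prop where
  pos : 1 ≤ p
  le : p ≤ i
  eq : ∀ k, p ≤ k → k ≤ i → b k = b i
  ne : p = 1 ∨ b (p - 1) ≠ b i

theorem RunStart.unique {b : ℕ → ℤ} {i p q : ℕ} (hp : RunStart b i p) (hq : RunStart b i q) :
    p = q := by
  have key : ∀ {p q : ℕ}, RunStart b i p → RunStart b i q → p ≤ q := by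
    intro p q hp hq
    by_contra hlt
    have := hq.pos
    have := hp.le
    rcases hp.ne with h | h
    · omega
    · exact h (hq.eq (p - 1) (by omega) (by omega))
  exact le_antisymm (key hp hq) (key hq hp)

/-- Last candidate and first future row for the letter `c` after `i` rows. -/
def Last (b : ℕ → ℤ) (i : ℕ) (c : ℤ) (cur F : ℕ) : Prop :=
  (b i ≠ c ∧ IsLast b i c cur ∧ F = cur + 1) ∨ (b i = c ∧ RunStart b i cur ∧ 2 ≤ cur ∧ F = cur)

/-- The state of the scan after `i` rows. -/
structure Stage (n : ℕ) (b : ℕ → ℤ) (L : ℕ → ℕ → ℤ) (i : ℕ) (S : Set ℕ) (R : ℤ → Cell) (m : ℤ) :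
    Prop where
  fresh : ∀ c, Fresh b i c → (R c).len = -1 ∧ ∀ y ∈ S, b y ≠ c
  inv : ∀ c, ¬ Fresh b i c → ∃ cur F, LetterInv n b L c (Seen b L i c) {y | y ∈ S ∧ b y = c} (R c) cur F ∧
    Last b i c cur F
  runMin : ∃ p, RunStart b i p ∧ (i < n → min m (L i (i + 1)) = L p (i + 1))

section

variable {n : ℕ} {b : ℕ → ℤ} {L : ℕ → ℕ → ℤ} {c : ℤ} {S : Set ℕ} {R : ℤ → Cell} {m : ℤ} {i : ℕ}

theorem Stage.init (hL : Rows n L) : Stage n b L 1 ∅ (fun _ => ⟨-1, 0, false⟩) (n + 1) := by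
  have hf : ∀ c, Fresh b 1 c := by
    intro c
    by_cases h : b 1 = c
    · right
      intro k h1 h2
      rwa [show k = 1 by omega]
    · left
      intro k h1 h2
      rwa [show k = 1 by omega]
  refine ⟨fun c _ => ⟨rfl, by simp⟩, fun c hc => absurd (hf c) hc, 1, ⟨le_rfl, le_rfl, ?_, Or.inl rfl⟩, ?_⟩
  · intro k h1 h2
    rw [show k = 1 by omega]
  · intro _
    have := hL.le 1 (1 + 1)
    exact min_eq_right (by omega)

theorem seen_succ_of_eq (hi : 1 ≤ i) (hb : b (i + 1) = b i) (c : ℤ) :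
    Seen b L (i + 1) c = Seen b L i c := by
  ext ⟨z, v⟩
  simp only [Seen, Set.mem_ofPred_eq]
  refine and_congr_right fun hz => or_congr ?_ ?_
  · constructor
    · rintro ⟨h1, h2, h3, h4⟩
      refine ⟨h1, ?_, h3, h4⟩
      by_contra hcon
      obtain rfl : z = i + 1 := by omega
      rw [Nat.add_sub_cancel, ← hb] at h3
      exact h3 hz
    · rintro ⟨h1, h2, h3, h4⟩
      exact ⟨h1, by omega, h3, h4⟩
  · constructor
    · rintro ⟨h1, h2, h3, h4⟩
      refine ⟨h1, ?_, h3, h4⟩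
      by_contra hcon
      obtain rfl : z = i := by omega
      rw [hb] at h3
      exact h3 hz
    · rintro ⟨h1, h2, h3, h4⟩
      exact ⟨h1, by omega, h3, h4⟩

theorem seen_succ_of_ne (h1 : b i ≠ c) (h2 : b (i + 1) ≠ c) :
    Seen b L (i + 1) c = Seen b L i c := by
  ext ⟨z, v⟩
  simp only [Seen, Set.mem_ofPred_eq]
  refine and_congr_right fun hz => or_congr (and_congr_right fun _ => and_congr_left fun _ => ?_)
    (and_congr_right fun _ => and_congr_left fun _ => ?_)
  · have : z ≠ i + 1 := by
      rintro rfl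
      exact h2 hz
    omega
  · have : z ≠ i := by
      rintro rfl
      exact h1 hz
    omega

theorem seen_succ_left (hi : 1 ≤ i) (h1 : b i = c) (h2 : b (i + 1) ≠ c) :
    Seen b L (i + 1) c = insert (i, L i (i + 1)) (Seen b L i c) := by
  ext ⟨z, v⟩
  simp only [Seen, Set.mem_ofPred_eq, Set.mem_insert_iff, Prod.mk.injEq]
  constructor
  · rintro ⟨hz, ⟨h3, h4, h5, h6⟩ | ⟨h3, h4, h5, h6⟩⟩
    · have : z ≠ i + 1 := by
        rintro rfl
        exact h2 hz
      exact Or.inr ⟨hz, Or.inl ⟨h3, by omega, h5, h6⟩⟩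
    · by_cases h : z = i
      · subst h
        exact Or.inl ⟨rfl, h6⟩
      · exact Or.inr ⟨hz, Or.inr ⟨h3, by omega, h5, h6⟩⟩
  · rintro (⟨rfl, rfl⟩ | ⟨hz, ⟨h3, h4, h5, h6⟩ | ⟨h3, h4, h5, h6⟩⟩)
    · exact ⟨h1, Or.inr ⟨hi, le_rfl, h2, rfl⟩⟩
    · exact ⟨hz, Or.inl ⟨h3, by omega, h5, h6⟩⟩
    · exact ⟨hz, Or.inr ⟨h3, by omega, h5, h6⟩⟩

theorem seen_succ_right (hi : 1 ≤ i) (h1 : b i ≠ c) (h2 : b (i + 1) = c) :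
    Seen b L (i + 1) c = insert (i + 1, L i (i + 1)) (Seen b L i c) := by
  ext ⟨z, v⟩
  simp only [Seen, Set.mem_ofPred_eq, Set.mem_insert_iff, Prod.mk.injEq]
  constructor
  · rintro ⟨hz, ⟨h3, h4, h5, h6⟩ | ⟨h3, h4, h5, h6⟩⟩
    · by_cases h : z = i + 1
      · subst h
        exact Or.inl ⟨rfl, h6⟩
      · exact Or.inr ⟨hz, Or.inl ⟨h3, by omega, h5, h6⟩⟩
    · have : z ≠ i := by
        rintro rfl
        exact h1 hz
      exact Or.inr ⟨hz, Or.inr ⟨h3, by omega, h5, h6⟩⟩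
  · rintro (⟨rfl, rfl⟩ | ⟨hz, ⟨h3, h4, h5, h6⟩ | ⟨h3, h4, h5, h6⟩⟩)
    · exact ⟨h2, Or.inl ⟨by omega, le_rfl, h1, rfl⟩⟩
    · exact ⟨hz, Or.inl ⟨h3, by omega, h5, h6⟩⟩
    · exact ⟨hz, Or.inr ⟨h3, by omega, h5, h6⟩⟩

theorem seen_of_fresh (h : Fresh b i c) : Seen b L i c = ∅ := by
  ext ⟨z, v⟩
  simp only [Seen, Set.mem_ofPred_eq, Set.mem_empty_iff_false, iff_false]
  rintro ⟨hz, ⟨h3, h4, h5, h6⟩ | ⟨h3, h4, h5, h6⟩⟩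
  · rcases h with h | h
    · exact h z (by omega) (by omega) hz
    · exact h5 (h _ (by omega) (by omega))
  · rcases h with h | h
    · exact h z (by omega) (by omega) hz
    · exact h5 (h _ (by omega) (by omega))

theorem evalSet_same {r : Cell} {l : ℤ} (h : l < r.len → r.act = true → b r.pos = c) :
    {y | y ∈ r.evalSet l S ∧ b y = c} = r.evalSet l {y | y ∈ S ∧ b y = c} := by
  ext y
  simp only [Cell.evalSet, Set.mem_ofPred_eq]
  constructor
  · rintro ⟨h1 | h1, h2⟩
    · exact Or.inl ⟨h1, h2⟩
    · exact Or.inr h1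
  · rintro (⟨h1, h2⟩ | ⟨h1, h2, rfl⟩)
    · exact ⟨Or.inl h1, h2⟩
    · exact ⟨Or.inr ⟨h1, h2, rfl⟩, h h1 h2⟩

theorem evalSet_other {r : Cell} {l : ℤ} (h : l < r.len → r.act = true → b r.pos ≠ c) :
    {y | y ∈ r.evalSet l S ∧ b y = c} = {y | y ∈ S ∧ b y = c} := by
  ext y
  simp only [Cell.evalSet, Set.mem_ofPred_eq]
  constructor
  · rintro ⟨h1 | ⟨h1, h2, rfl⟩, h3⟩
    · exact ⟨h1, h3⟩
    · exact absurd h3 (h h1 h2)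
  · rintro ⟨h1, h2⟩
    exact ⟨Or.inl h1, h2⟩

theorem Stage.pos_letter (h : Stage n b L i S R m) {l : ℤ} (hl : -1 ≤ l) (c : ℤ) :
    l < (R c).len → (R c).act = true → b (R c).pos = c := by
  intro h1 h2
  by_cases hf : Fresh b i c
  · have := (h.fresh c hf).1
    omega
  · obtain ⟨cur, F, hI, -⟩ := h.inv c hf
    exact (hI.pos h2).2.2

theorem RunStart.succ {p : ℕ} (h : RunStart b i p) (hb : b (i + 1) = b i) : RunStart b (i + 1) p := by
  refine ⟨h.pos, by have := h.le; omega, fun k h1 h2 => ?_, by rw [hb]; exact h.ne⟩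
  by_cases hk : k = i + 1
  · rw [hk]
  · rw [hb, h.eq k h1 (by omega)]

theorem IsLast.succ {q : ℕ} (h : IsLast b i c q) (hb : b (i + 1) ≠ c) : IsLast b (i + 1) c q := by
  refine ⟨h.pos, by have := h.le; omega, h.eq, fun k h1 h2 => ?_⟩
  by_cases hk : k = i + 1
  · rwa [hk]
  · exact h.ne k h1 (by omega)

theorem Stage.succ_of_eq (hL : Rows n L) (h : Stage n b L i S R m) (hi : 1 ≤ i) (hin : i < n)
    (hb : b (i + 1) = b i) : Stage n b L (i + 1) S R (min m (L i (i + 1))) := by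
  have hf : ∀ c, Fresh b (i + 1) c → Fresh b i c := by
    rintro c (h | h)
    · exact Or.inl fun k h1 h2 => h k h1 (by omega)
    · exact Or.inr fun k h1 h2 => h k h1 (by omega)
  have hf' : ∀ c, Fresh b i c → Fresh b (i + 1) c := by
    rintro c (h | h)
    · refine Or.inl fun k h1 h2 => ?_
      by_cases hk : k = i + 1
      · rw [hk, hb]
        exact h i hi le_rfl
      · exact h k h1 (by omega)
    · refine Or.inr fun k h1 h2 => ?_
      by_cases hk : k = i + 1
      · rw [hk, hb]
        exact h i hi le_rfl
      · exact h k h1 (by omega)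
  obtain ⟨p, hp, hm⟩ := h.runMin
  refine ⟨fun c hc => h.fresh c (hf c hc), fun c hc => ?_, p, hp.succ hb, fun hin' => ?_⟩
  · obtain ⟨cur, F, hI, hw⟩ := h.inv c (fun hc' => hc (hf' c hc'))
    refine ⟨cur, F, by rwa [seen_succ_of_eq hi hb], ?_⟩
    rcases hw with ⟨h1, h2, h3⟩ | ⟨h1, h2, h3⟩
    · exact Or.inl ⟨by rwa [hb], h2.succ (by rwa [hb]), h3⟩
    · exact Or.inr ⟨by rwa [hb], h2.succ hb, h3⟩
  · rw [hm hin, ← hL.eq_min hp.pos (by have := hp.le; omega) (by omega) (by omega)]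

theorem Stage.succ_of_ne (hL : Rows n L) (h : Stage n b L i S R m) (hi : 1 ≤ i) (hin : i < n)
    (hb : b (i + 1) ≠ b i) {l : ℤ} (hl0 : -1 ≤ l)
    (hl : ∀ q, IsLast b i (b (i + 1)) q → l = L q (i + 1)) {R₁ R₂ : ℤ → Cell}
    (hR₁ : R₁ = Function.update R (b i)
      (((R (b i)).eval (min m (L i (i + 1)))).offer (L i (i + 1)) i))
    (hR₂ : R₂ = Function.update R₁ (b (i + 1)) (((R₁ (b (i + 1))).eval l).offer (L i (i + 1)) (i + 1))) :
    Stage n b L (i + 1)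
      ((R₁ (b (i + 1))).evalSet l ((R (b i)).evalSet (min m (L i (i + 1))) S)) R₂ (n + 1) := by
  obtain ⟨p, hp, hm⟩ := h.runMin
  replace hm := hm hin
  rw [hm] at hR₁ ⊢
  have hR₁' : R₁ (b (i + 1)) = R (b (i + 1)) := by rw [hR₁, Function.update_of_ne hb]
  rw [hR₁'] at hR₂ ⊢
  have hm0 : 0 ≤ L p (i + 1) := hL.nonneg _ _
  have hv0 : 0 ≤ L i (i + 1) := hL.nonneg _ _
  have hpos₁ := h.pos_letter (l := L p (i + 1)) (by omega) (b i)
  have hpos₂ := h.pos_letter hl0 (b (i + 1))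
  have hpi := hp.le
  refine ⟨fun c hc => ?_, fun c hc => ?_, i + 1, ⟨by omega, le_rfl, ?_, Or.inr ?_⟩, fun _ => ?_⟩
  · have c1 : b i ≠ c := by
      rcases hc with hc | hc
      · exact hc i hi (by omega)
      · intro h'
        exact hb ((hc (i + 1) (by omega) le_rfl).trans h'.symm)
    have c2 : b (i + 1) ≠ c := by
      rcases hc with hc | hc
      · exact hc (i + 1) (by omega) (by omega)
      · exact absurd (hc i (by omega) (by omega)) c1
    have hf : Fresh b i c := by
      rcases hc with hc | hc
      · exact Or.inl fun k h1 h2 => hc k h1 (by omega)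
      · exact Or.inr fun k h1 h2 => hc k h1 (by omega)
    rw [hR₂, Function.update_of_ne c2.symm, hR₁, Function.update_of_ne c1.symm]
    refine ⟨(h.fresh c hf).1, ?_⟩
    rintro y ((hy | ⟨h1, h2, rfl⟩) | ⟨h1, h2, rfl⟩)
    · exact (h.fresh c hf).2 y hy
    · rwa [hpos₁ h1 h2]
    · rwa [hpos₂ h1 h2]
  · by_cases c1 : b i = c
    · subst c1
      rw [hR₂, Function.update_of_ne hb.symm, hR₁, Function.update_self,
        evalSet_other (fun h1 h2 => by rw [hpos₂ h1 h2]; exact hb), evalSet_same hpos₁,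
        seen_succ_left hi rfl hb]
      have hother : ∃ z, Other n b (b i) z ∧ L i (i + 1) ≤ L i z :=
        ⟨i + 1, ⟨by omega, by omega, hb⟩, le_rfl⟩
      refine ⟨i, i + 1, ?_, Or.inl ⟨hb, ⟨hi, by omega, rfl, fun k h1 h2 => ?_⟩, rfl⟩⟩
      · by_cases hf : Fresh b i (b i)
        · have hlen := (h.fresh _ hf).1
          have e1 : (R (b i)).evalSet (L p (i + 1)) {y | y ∈ S ∧ b y = b i} = ∅ := by
            ext y
            simp only [Cell.evalSet, Set.mem_ofPred_eq, Set.mem_empty_iff_false, iff_false]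
            rintro (hy | hy)
            · exact (h.fresh _ hf).2 y hy.1 hy.2
            · omega
          have e2 : ((R (b i)).eval (L p (i + 1))).offer (L i (i + 1)) i = ⟨L i (i + 1), i, true⟩ := by
            rw [Cell.eval, if_neg (by omega), Cell.offer, if_pos (by omega)]
          rw [e1, e2, seen_of_fresh hf, insert_empty_eq]
          exact LetterInv.init hL hi rfl hother hv0
        · obtain ⟨cur, F, hI, hw⟩ := h.inv _ hf
          rcases hw with ⟨h1, -⟩ | ⟨-, h2, h3, rfl⟩
          · exact absurd rfl h1
          · obtain rfl := h2.unique hp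
            refine hI.step hL (by omega) hpi (by omega) hpi hi rfl hm0
              (hL.left _ _ _ hp.pos hpi (by omega) (by omega))
              (hL.right _ _ _ hp.pos hpi (by omega) (by omega))
              (fun x k h1 h2 h3 h4 => hL.nested h1 h2 (by omega) h3 h4) (fun hlt x h1 h2 => ?_) hother
            have e := hL.eq_min hp.pos hpi (show i ≤ i + 1 by omega) (by omega)
            have e' := hL.right x F i h1 h2 hpi (by omega)
            have : L F (i + 1) = L F i := by
              rcases min_choice (L F i) (L i (i + 1)) with h' | h'
              · rw [e, h']
              · rw [h'] at e
                omega
            omega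
      · rwa [show k = i + 1 by omega]
    · by_cases c2 : b (i + 1) = c
      · subst c2
        rw [hR₂, Function.update_self, evalSet_same hpos₂,
          evalSet_other (fun h1 h2 => by rw [hpos₁ h1 h2]; exact hb.symm),
          seen_succ_right hi c1 rfl]
        have hother : ∃ z, Other n b (b (i + 1)) z ∧ L i (i + 1) ≤ L (i + 1) z :=
          ⟨i, ⟨by omega, by omega, c1⟩, (hL.symm _ _).le⟩
        refine ⟨i + 1, i + 1, ?_, Or.inr ⟨rfl, ⟨by omega, le_rfl, fun k h1 h2 => ?_, Or.inr c1⟩, by omega, rfl⟩⟩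
        · by_cases hf : Fresh b i (b (i + 1))
          · have hlen := (h.fresh _ hf).1
            have e1 : (R (b (i + 1))).evalSet l {y | y ∈ S ∧ b y = b (i + 1)} = ∅ := by
              ext y
              simp only [Cell.evalSet, Set.mem_ofPred_eq, Set.mem_empty_iff_false, iff_false]
              rintro (hy | hy)
              · exact (h.fresh _ hf).2 y hy.1 hy.2
              · omega
            have e2 : ((R (b (i + 1))).eval l).offer (L i (i + 1)) (i + 1) = ⟨L i (i + 1), i + 1, true⟩ := by
              rw [Cell.eval, if_neg (by omega), Cell.offer, if_pos (by omega)]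
            rw [e1, e2, seen_of_fresh hf, insert_empty_eq]
            exact LetterInv.init hL (by omega) rfl hother hv0
          · obtain ⟨cur, F, hI, hw⟩ := h.inv _ hf
            rcases hw with ⟨-, h2, rfl⟩ | ⟨h1, -⟩
            · have hq := h2.pos
              have hqi := h2.le
              rw [hl cur h2]
              exact hI.step hL (by omega) (by omega) (by omega) (by omega) (by omega) rfl
                (hL.nonneg _ _) le_rfl (hL.right _ _ _ hq hqi (by omega) (by omega))
                (fun x k h1 h2 h3 h4 => hL.nested h1 h2 (by omega) h3 h4)
                (fun _ x h1 h2 => hL.right _ _ _ h1 h2 (by omega) (by omega)) hother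
            · exact absurd h1 c1
        · rw [show k = i + 1 by omega]
      · rw [hR₂, Function.update_of_ne (Ne.symm c2), hR₁, Function.update_of_ne (Ne.symm c1),
          evalSet_other (fun h1 h2 => by rw [hpos₂ h1 h2]; exact c2),
          evalSet_other (fun h1 h2 => by rw [hpos₁ h1 h2]; exact c1), seen_succ_of_ne c1 c2]
        have hf : ¬ Fresh b i c := by
          rintro (hf | hf)
          · refine hc (Or.inl fun k h1 h2 => ?_)
            by_cases hk : k = i + 1
            · rwa [hk]
            · exact hf k h1 (by omega)
          · exact c1 (hf i hi le_rfl)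
        obtain ⟨cur, F, hI, hw⟩ := h.inv c hf
        refine ⟨cur, F, hI, ?_⟩
        rcases hw with ⟨-, h2, h3⟩ | ⟨h1, -⟩
        · exact Or.inl ⟨c2, h2.succ c2, h3⟩
        · exact absurd h1 c1
  · intro k h1 h2
    rw [show k = i + 1 by omega]
  · simpa using hb.symm
  · have := hL.le (i + 1) (i + 1 + 1)
    exact min_eq_right (by omega)

/-- The set returned by the scan: every row next to a row with another letter is covered, and no
element of the set covers another one. -/
structure Optimal (n : ℕ) (b : ℕ → ℤ) (L : ℕ → ℕ → ℤ) (S : Set ℕ) : Prop where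
  mem : ∀ y ∈ S, 1 ≤ y ∧ y ≤ n
  covers : ∀ k k', 1 ≤ k → k ≤ n → 1 ≤ k' → k' ≤ n → b k ≠ b k' →
    ∃ y ∈ S, b y = b k ∧ L k k' ≤ L y k
  sep : ∀ y ∈ S, ∃ z, Other n b (b y) z ∧ ∀ y' ∈ S, y' ≠ y → b y' = b y → L y y' < L y z

theorem exists_break {b : ℕ → ℤ} {k k' : ℕ} (hk : k ≤ k') (hb : b k ≠ b k') :
    ∃ q, k ≤ q ∧ q < k' ∧ b q = b k ∧ b (q + 1) ≠ b k := by
  induction k', hk using Nat.le_induction with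
  | base => exact absurd rfl hb
  | succ k' hk ih =>
    by_cases h : b k = b k'
    · exact ⟨k', hk, by omega, h.symm, hb.symm⟩
    · obtain ⟨q, h1, h2, h3⟩ := ih h
      exact ⟨q, h1, by omega, h3⟩

theorem exists_break_left {b : ℕ → ℤ} {k k' : ℕ} (hk : k' ≤ k) (hb : b k ≠ b k') :
    ∃ q, k' < q ∧ q ≤ k ∧ b q = b k ∧ b (q - 1) ≠ b k := by
  induction k, hk using Nat.le_induction with
  | base => exact absurd rfl hb
  | succ k hk ih =>
    by_cases h : b (k + 1) = b k
    · obtain ⟨q, h1, h2, h3, h4⟩ := ih (h ▸ hb)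
      exact ⟨q, h1, by omega, by rw [h, h3], by rwa [h]⟩
    · exact ⟨k + 1, by omega, le_rfl, rfl, Ne.symm h⟩

/-- The state after the last row, with the active candidates included in the set. -/
theorem Stage.optimal (hL : Rows n L) (h : Stage n b L n S R m)
    (hne : ∃ k k', 1 ≤ k ∧ k ≤ n ∧ 1 ≤ k' ∧ k' ≤ n ∧ b k ≠ b k') {C : Set ℤ}
    (hC : ∀ k, 1 ≤ k → k ≤ n → b k ∈ C) :
    Optimal n b L {y | y ∈ S ∨ ∃ c ∈ C, (R c).act = true ∧ -1 < (R c).len ∧ y = (R c).pos} := by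
  obtain ⟨k₁, k₂, a1, a2, a3, a4, hne⟩ := hne
  have hnf : ∀ k, 1 ≤ k → k ≤ n → ¬ Fresh b n (b k) := by
    rintro k h1 h2 (hf | hf)
    · exact hf k h1 h2 rfl
    · exact hne ((hf k₁ a1 a2).trans (hf k₂ a3 a4).symm)
  have hS : ∀ y ∈ S, ¬ Fresh b n (b y) := fun y hy hf => (h.fresh _ hf).2 y hy rfl
  have hpos : ∀ c, -1 < (R c).len → ¬ Fresh b n c := by
    intro c hc hf
    have := (h.fresh c hf).1
    omega
  have hcur : ∀ {c cur F}, Last b n c cur F → cur ≤ n := by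
    rintro c cur F (⟨-, h2, -⟩ | ⟨-, h2, -⟩)
    · exact h2.le
    · exact h2.le
  have hcov : ∀ q v, 1 ≤ q → q ≤ n → (q, v) ∈ Seen b L n (b q) →
      ∃ y, (y ∈ S ∨ ∃ c ∈ C, (R c).act = true ∧ -1 < (R c).len ∧ y = (R c).pos) ∧ b y = b q ∧ v ≤ L y q := by
    intro q v h1 h2 hq
    obtain ⟨cur, F, hI, -⟩ := h.inv _ (hnf q h1 h2)
    rcases hI.covered _ hq with ⟨y, hy, hv⟩ | ⟨ha, hv, -⟩
    · exact ⟨y, Or.inl hy.1, hy.2, hv⟩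
    · exact ⟨_, Or.inr ⟨b q, hC q h1 h2, ha, by have := hI.nonneg; omega, rfl⟩, (hI.pos ha).2.2, hv⟩
  refine ⟨?_, fun k k' h1 h2 h3 h4 hb => ?_, ?_⟩
  · rintro y (hy | ⟨c, -, ha, hlen, rfl⟩)
    · obtain ⟨cur, F, hI, hw⟩ := h.inv _ (hS y hy)
      have := hI.mem y ⟨hy, rfl⟩
      exact ⟨this.1, this.2.1.trans (hcur hw)⟩
    · obtain ⟨cur, F, hI, hw⟩ := h.inv c (hpos c hlen)
      have := hI.pos ha
      exact ⟨this.1, this.2.1.trans (hcur hw)⟩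
  · rcases le_total k k' with hk | hk
    · obtain ⟨q, q1, q2, q3, q4⟩ := exists_break hk hb
      obtain ⟨y, hy, hyb, hv⟩ := hcov q (L q (q + 1)) (by omega) (by omega)
        ⟨rfl, Or.inr ⟨by simp only; omega, by simp only; omega, by rwa [q3], rfl⟩⟩
      refine ⟨y, hy, hyb.trans q3, ?_⟩
      refine hL.trans ((hL.nested h1 q1 (by omega) (by omega) h4).trans hv) ?_
      rw [hL.symm q k]
      exact hL.left k q k' h1 q1 q2.le h4
    · obtain ⟨q, q1, q2, q3, q4⟩ := exists_break_left hk hb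
      obtain ⟨y, hy, hyb, hv⟩ := hcov q (L (q - 1) q) (by omega) (by omega)
        ⟨rfl, Or.inl ⟨by simp only; omega, by simp only; omega, by rwa [q3], rfl⟩⟩
      refine ⟨y, hy, hyb.trans q3, ?_⟩
      rw [hL.symm k k']
      exact hL.trans ((hL.nested h3 (show k' ≤ q - 1 by omega) (by omega) q2 h2).trans hv)
        (hL.right k' q k h3 q1.le q2 h2)
  · rintro y (hy | ⟨c, -, ha, hlen, rfl⟩)
    · obtain ⟨cur, F, hI, hw⟩ := h.inv _ (hS y hy)
      obtain ⟨z, hz, -, z2, z3⟩ := hI.sep y ⟨hy, rfl⟩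
      refine ⟨z, hz, ?_⟩
      rintro y' (hy' | ⟨c', -, ha', hlen', rfl⟩) hyy hb
      · exact z2 y' ⟨hy', hb⟩ hyy
      · obtain ⟨cur', F', hI', -⟩ := h.inv c' (hpos c' hlen')
        have hc' : b y = c' := by rw [← hb, (hI'.pos ha').2.2]
        rw [hc'] at z3
        exact z3 ha'
    · obtain ⟨cur, F, hI, hw⟩ := h.inv c (hpos c hlen)
      have hbc := (hI.pos ha).2.2
      obtain ⟨z, hz, hzv⟩ := hI.other ha
      rw [hbc]
      refine ⟨z, hz, ?_⟩
      rintro y' (hy' | ⟨c', -, ha', hlen', rfl⟩) hyy hb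
      · exact (hI.apart ha y' ⟨hy', hb⟩).trans_le hzv
      · obtain ⟨cur', F', hI', -⟩ := h.inv c' (hpos c' hlen')
        rw [(hI'.pos ha').2.2] at hb
        exact absurd (by rw [hb]) hyy

end


section Lcp

variable {A : Type*}

theorem lcpLen_comm [DecidableEq A] (u v : List A) : lcpLen u v = lcpLen v u := by
  induction u generalizing v with
  | nil => cases v <;> rfl
  | cons a u ih =>
    cases v with
    | nil => rfl
    | cons b v => simp only [lcpLen, ih v, eq_comm]

theorem le_lcpLen_iff [DecidableEq A] {u v : List A} {l : ℕ} :
    l ≤ lcpLen u v ↔ l ≤ u.length ∧ l ≤ v.length ∧ u.take l = v.take l := by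
  induction u generalizing v l with
  | nil =>
    cases l with
    | zero => simp
    | succ l => cases v <;> simp [lcpLen]
  | cons a u ih =>
    cases l with
    | zero => simp
    | succ l =>
      cases v with
      | nil => simp [lcpLen]
      | cons b v =>
        simp only [lcpLen, List.length_cons, List.take_succ_cons, List.cons.injEq]
        split_ifs with h
        · simp [ih, h]
        · simp [h]

theorem lcpLen_le_left [DecidableEq A] (u v : List A) : lcpLen u v ≤ u.length :=
  (le_lcpLen_iff.1 le_rfl).1

theorem min_lcpLen_le [DecidableEq A] (u v w : List A) :
    min (lcpLen u v) (lcpLen v w) ≤ lcpLen u w := by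
  obtain ⟨h1, h2, h3⟩ := le_lcpLen_iff.1 (min_le_left (lcpLen u v) (lcpLen v w))
  obtain ⟨h4, h5, h6⟩ := le_lcpLen_iff.1 (min_le_right (lcpLen u v) (lcpLen v w))
  exact le_lcpLen_iff.2 ⟨h1, h5, h3.trans h6⟩

theorem cons_le_cons_iff' [LinearOrder A] {a b : A} {u v : List A} :
    a :: u ≤ b :: v ↔ a < b ∨ a = b ∧ u ≤ v := by
  rw [← not_lt, List.cons_lt_cons_iff, ← not_lt]
  constructor
  · intro h
    push Not at h
    rcases h.1.lt_or_eq with h' | h'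
    · exact Or.inl h'
    · exact Or.inr ⟨h', fun hlt => absurd hlt (not_lt.2 (h.2 h'.symm))⟩
  · rintro (h | ⟨rfl, h⟩)
    · simp [h.le, h.ne']
    · simp [h]

theorem lcpLen_le_of_le [LinearOrder A] {u v w : List A} (h1 : u ≤ v) (h2 : v ≤ w) :
    lcpLen u w ≤ lcpLen u v := by
  induction u generalizing v w with
  | nil => cases w <;> simp [lcpLen]
  | cons a u ih =>
    cases v with
    | nil => exact absurd h1 (not_le.2 (List.nil_lt_cons _ _))
    | cons b v =>
      cases w with
      | nil => simp [lcpLen]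
      | cons c w =>
        simp only [lcpLen]
        by_cases hac : a = c
        · subst hac
          rw [cons_le_cons_iff'] at h1 h2
          have hab : a = b := by
            rcases h1 with h1 | h1
            · rcases h2 with h2 | h2
              · exact absurd h1 (lt_asymm h2)
              · exact absurd h1 (h2.1 ▸ lt_irrefl _)
            · exact h1.1
          subst hab
          simp only [if_true, Nat.add_le_add_iff_right]
          exact ih (by simpa using h1) (by simpa using h2)
        · rw [if_neg hac]
          exact Nat.zero_le _

theorem lcpLen_le_of_le' [LinearOrder A] {u v w : List A} (h1 : u ≤ v) (h2 : v ≤ w) :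
    lcpLen u w ≤ lcpLen v w := by
  have h3 := lcpLen_le_of_le h1 h2
  have := min_lcpLen_le v u w
  rw [lcpLen_comm v u, min_eq_right h3] at this
  exact this

/-- Length of the longest common prefix of two rows of the suffix array. -/
def rowLcp [DecidableEq A] (R : List A) (sa : ℕ → ℕ) (i j : ℕ) : ℤ :=
  lcpLen (R.drop (sa i - 1)) (R.drop (sa j - 1))

variable [LinearOrder A] {R : List A} {sa : ℕ → ℕ}

theorem IsSuffixArray.mem (h : IsSuffixArray R sa) {i : ℕ} (h1 : 1 ≤ i) (h2 : i ≤ R.length) :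
    1 ≤ sa i ∧ sa i ≤ R.length := h.1.mapsTo ⟨h1, h2⟩

theorem IsSuffixArray.inj (h : IsSuffixArray R sa) {i j : ℕ} (h1 : 1 ≤ i) (h2 : i ≤ R.length)
    (h3 : 1 ≤ j) (h4 : j ≤ R.length) (hij : sa i = sa j) : i = j :=
  h.1.injOn ⟨h1, h2⟩ ⟨h3, h4⟩ hij

theorem IsSuffixArray.exists_row (h : IsSuffixArray R sa) {p : ℕ} (h1 : 1 ≤ p) (h2 : p ≤ R.length) :
    ∃ i, 1 ≤ i ∧ i ≤ R.length ∧ sa i = p := by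
  obtain ⟨i, hi, hp⟩ := h.1.surjOn (show p ∈ Set.Icc 1 R.length from ⟨h1, h2⟩)
  exact ⟨i, hi.1, hi.2, hp⟩

theorem IsSuffixArray.le (h : IsSuffixArray R sa) {i j : ℕ} (h1 : 1 ≤ i) (hij : i ≤ j)
    (h2 : j ≤ R.length) : R.drop (sa i - 1) ≤ R.drop (sa j - 1) := by
  rcases hij.eq_or_lt with rfl | hij
  · exact le_rfl
  · exact (h.2 i j h1 hij h2).le

theorem IsSuffixArray.le_iff (h : IsSuffixArray R sa) {i j : ℕ} (h1 : 1 ≤ i) (h2 : i ≤ R.length)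
    (h3 : 1 ≤ j) (h4 : j ≤ R.length) : R.drop (sa i - 1) ≤ R.drop (sa j - 1) ↔ i ≤ j := by
  refine ⟨fun hle => ?_, fun hij => h.le h1 hij h4⟩
  by_contra hlt
  exact absurd hle (not_le.2 (h.2 j i h3 (by omega) h2))

theorem IsSuffixArray.rows (h : IsSuffixArray R sa) : Rows R.length (rowLcp R sa) where
  nonneg i j := Int.natCast_nonneg _
  le i j := by
    have := lcpLen_le_left (R.drop (sa i - 1)) (R.drop (sa j - 1))
    rw [List.length_drop] at this
    unfold rowLcp
    omega
  symm i j := by rw [rowLcp, lcpLen_comm, rowLcp]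
  ultra i j k := by
    unfold rowLcp
    exact_mod_cast min_lcpLen_le _ _ _
  left i j k h1 hij hjk hk := by
    unfold rowLcp
    exact_mod_cast lcpLen_le_of_le (h.le h1 hij (hjk.trans hk)) (h.le (h1.trans hij) hjk hk)
  right i j k h1 hij hjk hk := by
    unfold rowLcp
    exact_mod_cast lcpLen_le_of_le' (h.le h1 hij (hjk.trans hk)) (h.le (h1.trans hij) hjk hk)

end Lcp

section Suffixient

variable {A : Type*} [LinearOrder A] {T : List A}

/-- The reverse of `T[1,x-1]` followed by the end marker, a suffix of the reversed text. -/
theorem IsText.drop_revText (hT : IsText T) {x : ℕ} (h1 : 1 ≤ x) (hx : x ≤ T.length) :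
    ∃ d, d ∉ T.dropLast ∧ (revText T).drop (T.length - x) = (T.take (x - 1)).reverse ++ [d] := by
  obtain ⟨w, d, rfl, hw, hd, -⟩ := hT
  simp only [List.length_append, List.length_singleton] at hx
  refine ⟨d, by simpa using hd, ?_⟩
  simp only [revText, List.dropLast_concat, List.length_append, List.length_singleton,
    List.getLast?_append, List.getLast?_singleton, Option.some_or, Option.toList_some]
  rw [List.drop_append_of_le_length (by simp; omega), List.take_append_of_le_length (by omega),
    List.reverse_take]
  congr 2
  omega

theorem concat_suffix_concat_iff {B : Type*} {u v : List B} {a b : B} :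
    u ++ [a] <:+ v ++ [b] ↔ a = b ∧ u <:+ v := by
  rw [← List.reverse_prefix, ← List.reverse_prefix (l₁ := u)]
  simp [List.cons_prefix_cons]

theorem concat_infix_iff {B : Type*} {u v : List B} {a : B} :
    u ++ [a] <:+: v ↔ ∃ x, 1 ≤ x ∧ x ≤ v.length ∧ v[x - 1]? = some a ∧ u <:+ v.take (x - 1) := by
  constructor
  · rintro ⟨s, t, rfl⟩
    refine ⟨s.length + u.length + 1, by omega, by simp, ?_, s, ?_⟩
    · rw [Nat.add_sub_cancel, ← List.append_assoc, ← List.length_append,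
        List.append_assoc, List.getElem?_append_right le_rfl]
      simp
    · rw [Nat.add_sub_cancel, ← List.append_assoc, List.append_assoc, ← List.length_append,
        List.take_left']
      rfl
  · rintro ⟨x, h1, h2, h3, s, hs⟩
    refine ⟨s, v.drop x, ?_⟩
    rw [← List.append_assoc, hs]
    conv_rhs => rw [← List.take_append_drop x v]
    congr 1
    obtain ⟨y, rfl⟩ : ∃ y, x = y + 1 := ⟨x - 1, by omega⟩
    simp only [Nat.add_sub_cancel] at h3 ⊢
    rw [List.take_add_one, h3]
    rfl

theorem take_eq_concat {B : Type*} {v : List B} {x : ℕ} {a : B} (h1 : 1 ≤ x)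
    (ha : v[x - 1]? = some a) : v.take x = v.take (x - 1) ++ [a] := by
  obtain ⟨y, rfl⟩ : ∃ y, x = y + 1 := ⟨x - 1, by omega⟩
  simp only [Nat.add_sub_cancel] at ha ⊢
  rw [List.take_add_one, ha]
  rfl

theorem sub_eq_concat {B : Type*} {v : List B} {i j : ℕ} {a : B} (h1 : 1 ≤ i) (hij : i ≤ j)
    (ha : v[j - 1]? = some a) : sub v i j = sub v i (j - 1) ++ [a] := by
  have hlt := (List.getElem?_eq_some_iff.1 ha).1
  unfold sub
  rw [take_eq_concat (by omega) ha, List.drop_append_of_le_length (by simp; omega)]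

theorem IsText.le_lcpLen_iff (hT : IsText T) {x j l : ℕ} (h1 : 1 ≤ x) (hx : x ≤ T.length)
    (hj : j ≤ T.length) (hl : l + 1 ≤ j) :
    l ≤ lcpLen ((revText T).drop (T.length - x)) ((revText T).drop (T.length - j)) ↔
      sub T (j - l) (j - 1) <:+ T.take (x - 1) := by
  have hlen : (sub T (j - l) (j - 1)).length = l := by
    simp [sub]
    omega
  obtain ⟨d, hd, e1⟩ := hT.drop_revText h1 hx
  obtain ⟨d', hd', e2⟩ := hT.drop_revText (show 1 ≤ j by omega) hj
  have hmem : ∀ y, y ∈ T.take (j - 1) → y ∈ T.dropLast := by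
    intro y hy
    rw [List.dropLast_eq_take]
    exact (List.take_subset_take_left _ (by omega)) hy
  have t1 : (T.take (x - 1)).length = x - 1 := by simp; omega
  have t2 : (T.take (j - 1)).length = j - 1 := by simp; omega
  rw [Suffixient.le_lcpLen_iff, e1, e2, List.suffix_iff_eq_drop, hlen, t1]
  have hR : ((T.take (j - 1)).reverse ++ [d']).take l = (sub T (j - l) (j - 1)).reverse := by
    rw [List.take_append_of_le_length (by simp; omega), List.take_reverse, t2, sub]
    congr 2
    omega
  have hL : l ≤ x - 1 → ((T.take (x - 1)).reverse ++ [d]).take l =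
      ((T.take (x - 1)).drop (x - 1 - l)).reverse := by
    intro h
    rw [List.take_append_of_le_length (by rw [List.length_reverse, t1]; exact h), List.take_reverse, t1]
  constructor
  · rintro ⟨h3, h4, h5⟩
    have hlx : l ≤ x - 1 := by
      by_contra hcon
      have hx : ((T.take (x - 1)).reverse ++ [d])[x - 1]? = some d := by
        rw [List.getElem?_append_right (by rw [List.length_reverse, t1]), List.length_reverse, t1]
        simp
      have hx' : (((T.take (x - 1)).reverse ++ [d]).take l)[x - 1]? = some d := by
        rw [List.getElem?_take_of_lt (by omega), hx]
      rw [h5, hR] at hx'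
      have := List.mem_of_getElem? hx'
      rw [List.mem_reverse] at this
      exact hd (hmem d (List.mem_of_mem_drop this))
    rw [hL hlx, hR] at h5
    exact (List.reverse_injective h5).symm
  · intro h
    have hlx : l ≤ x - 1 := by
      have := congrArg List.length h
      rw [hlen, List.length_drop, t1] at this
      omega
    refine ⟨by simp; omega, by simp; omega, ?_⟩
    rw [hL hlx, hR, ← h]

/-- The text position of a row of the suffix array of the reversed text. -/
def rowPos (n : ℕ) (sa : ℕ → ℕ) (k : ℕ) : ℕ := n - sa k + 1

variable {sa : ℕ → ℕ}

theorem rowPos_mem (hT : IsText T) (h : IsSuffixArray (revText T) sa) {k : ℕ} (h1 : 1 ≤ k)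
    (h2 : k ≤ T.length) : 1 ≤ rowPos T.length sa k ∧ rowPos T.length sa k ≤ T.length := by
  have hn := hT.length_revText
  have := h.mem h1 (by omega)
  unfold rowPos
  omega

theorem rowPos_inj (hT : IsText T) (h : IsSuffixArray (revText T) sa) {k k' : ℕ} (h1 : 1 ≤ k)
    (h2 : k ≤ T.length) (h3 : 1 ≤ k') (h4 : k' ≤ T.length)
    (he : rowPos T.length sa k = rowPos T.length sa k') : k = k' := by
  have hn := hT.length_revText
  have a := h.mem h1 (by omega)
  have b := h.mem h3 (by omega)
  unfold rowPos at he
  exact h.inj h1 (by omega) h3 (by omega) (by omega)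

theorem exists_rowPos (hT : IsText T) (h : IsSuffixArray (revText T) sa) {x : ℕ} (h1 : 1 ≤ x)
    (h2 : x ≤ T.length) : ∃ k, 1 ≤ k ∧ k ≤ T.length ∧ rowPos T.length sa k = x := by
  have hn := hT.length_revText
  obtain ⟨k, a, b, c⟩ := h.exists_row (show 1 ≤ T.length + 1 - x by omega) (by omega)
  refine ⟨k, a, by omega, ?_⟩
  unfold rowPos
  omega

theorem drop_rowPos (hT : IsText T) (h : IsSuffixArray (revText T) sa) {k : ℕ} (h1 : 1 ≤ k)
    (h2 : k ≤ T.length) :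
    (revText T).drop (sa k - 1) = (revText T).drop (T.length - rowPos T.length sa k) := by
  have hn := hT.length_revText
  have := h.mem h1 (by omega)
  unfold rowPos
  congr 1
  omega

theorem bwtArray_rowPos (hT : IsText T) (h : IsSuffixArray (revText T) sa) {k : ℕ} (h1 : 1 ≤ k)
    (h2 : k ≤ T.length) : bwtArray (revText T) sa k = T[rowPos T.length sa k - 1]? := by
  have hn := hT.length_revText
  have hm := h.mem h1 (by omega)
  unfold bwtArray charAt rowPos
  split_ifs with h0
  · rw [List.getLast?_eq_getElem?, hn, hT.revText_getElem?_last (by omega)]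
    congr 1
    omega
  · rw [hT.revText_getElem? (by omega)]
    congr 1
    omega

theorem le_rowLcp_iff (hT : IsText T) (h : IsSuffixArray (revText T) sa) {k k' l : ℕ} (h1 : 1 ≤ k)
    (h2 : k ≤ T.length) (h3 : 1 ≤ k') (h4 : k' ≤ T.length) (hl : l + 1 ≤ rowPos T.length sa k') :
    (l : ℤ) ≤ rowLcp (revText T) sa k k' ↔
      sub T (rowPos T.length sa k' - l) (rowPos T.length sa k' - 1) <:+
        T.take (rowPos T.length sa k - 1) := by
  have a := rowPos_mem hT h h1 h2
  have b := rowPos_mem hT h h3 h4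
  rw [rowLcp, drop_rowPos hT h h1 h2, drop_rowPos hT h h3 h4, Nat.cast_le]
  exact hT.le_lcpLen_iff a.1 a.2 b.2 hl

/-- A common prefix of two rows does not reach the end marker. -/
theorem rowLcp_lt (hT : IsText T) (h : IsSuffixArray (revText T) sa) {k k' : ℕ} (h1 : 1 ≤ k)
    (h2 : k ≤ T.length) (h3 : 1 ≤ k') (h4 : k' ≤ T.length) (hne : k ≠ k') :
    rowLcp (revText T) sa k k' < rowPos T.length sa k := by
  have key : ∀ x y, 1 ≤ x → x ≤ T.length → 1 ≤ y → y ≤ T.length → x ≠ y →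
      ¬ x ≤ lcpLen ((revText T).drop (T.length - x)) ((revText T).drop (T.length - y)) := by
    intro x y x1 x2 y1 y2 hxy hle
    obtain ⟨d, hd, e1⟩ := hT.drop_revText x1 x2
    obtain ⟨d', hd', e2⟩ := hT.drop_revText y1 y2
    have t1 : (T.take (x - 1)).length = x - 1 := by simp; omega
    have t2 : (T.take (y - 1)).length = y - 1 := by simp; omega
    obtain ⟨l1, l2, l3⟩ := Suffixient.le_lcpLen_iff.1 hle
    have hmem : ((revText T).drop (T.length - x))[x - 1]? = some d := by
      rw [e1, List.getElem?_append_right (by rw [List.length_reverse, t1]), List.length_reverse, t1]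
      simp
    have hlt : x < y := by
      rw [e2] at l2
      simp at l2
      omega
    have : ((revText T).drop (T.length - y))[x - 1]? = some d := by
      rw [← hmem, ← List.getElem?_take_of_lt (show x - 1 < x by omega), ← l3,
        List.getElem?_take_of_lt (by omega)]
    rw [e2, List.getElem?_append_left (by rw [List.length_reverse, t2]; omega)] at this
    have := List.mem_of_getElem? this
    rw [List.mem_reverse] at this
    refine hd ?_
    rw [List.dropLast_eq_take]
    exact (List.take_subset_take_left _ (by omega)) this
  have a := rowPos_mem hT h h1 h2
  have b := rowPos_mem hT h h3 h4
  have := key _ _ a.1 a.2 b.1 b.2 (fun he => hne (rowPos_inj hT h h1 h2 h3 h4 he))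
  rw [rowLcp, drop_rowPos hT h h1 h2, drop_rowPos hT h h3 h4]
  omega

end Suffixient


section Optimality

variable {A : Type*} [Fintype A] [LinearOrder A] {T : List A} {sa : ℕ → ℕ}

/-- The letters of the Burrows-Wheeler transform. -/
def rowLetter (R : List A) (sa : ℕ → ℕ) (k : ℕ) : ℤ := code (bwtArray R sa k)

theorem rowLetter_eq_iff (hT : IsText T) (h : IsSuffixArray (revText T) sa) {k k' : ℕ} (h1 : 1 ≤ k)
    (h2 : k ≤ T.length) (h3 : 1 ≤ k') (h4 : k' ≤ T.length) :
    rowLetter (revText T) sa k = rowLetter (revText T) sa k' ↔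
      T[rowPos T.length sa k - 1]? = T[rowPos T.length sa k' - 1]? := by
  rw [rowLetter, rowLetter, code_inj, bwtArray_rowPos hT h h1 h2, bwtArray_rowPos hT h h3 h4]

/-- Extending a common factor by one letter. -/
theorem sub_suffix_iff (hT : IsText T) (h : IsSuffixArray (revText T) sa) {k k' l : ℕ} (h1 : 1 ≤ k)
    (h2 : k ≤ T.length) (h3 : 1 ≤ k') (h4 : k' ≤ T.length) (hl : l + 1 ≤ rowPos T.length sa k') :
    sub T (rowPos T.length sa k' - l) (rowPos T.length sa k') <:+ T.take (rowPos T.length sa k) ↔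
      rowLetter (revText T) sa k = rowLetter (revText T) sa k' ∧
        (l : ℤ) ≤ rowLcp (revText T) sa k k' := by
  have a := rowPos_mem hT h h1 h2
  have b := rowPos_mem hT h h3 h4
  have ga := List.getElem?_eq_getElem (show rowPos T.length sa k - 1 < T.length by omega)
  have gb := List.getElem?_eq_getElem (show rowPos T.length sa k' - 1 < T.length by omega)
  rw [le_rowLcp_iff hT h h1 h2 h3 h4 hl, rowLetter_eq_iff hT h h1 h2 h3 h4, ga, gb, Option.some_inj,
    sub_eq_concat (by omega) (by omega) gb, take_eq_concat a.1 ga, concat_suffix_concat_iff]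
  exact and_congr_left' eq_comm

theorem Optimal.isSmallestSuffixient (hT : IsText T) (h : IsSuffixArray (revText T) sa) {S : Set ℕ}
    (hS : Optimal T.length (rowLetter (revText T) sa) (rowLcp (revText T) sa) S) {P : Finset ℕ}
    (hP : ∀ x, x ∈ P ↔ ∃ k ∈ S, x = rowPos T.length sa k) : IsSmallestSuffixient T P := by
  classical
  have hrows := hT.length_revText ▸ h.rows
  refine ⟨⟨fun x hx => ?_, fun i j hi hij hj hmax => ?_⟩, fun S' hS' => ?_⟩
  · obtain ⟨k, hk, rfl⟩ := (hP x).1 hx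
    have := hS.mem k hk
    exact Finset.mem_Icc.2 (rowPos_mem hT h this.1 this.2)
  · obtain ⟨k, k1, k2, rfl⟩ := exists_rowPos hT h (show 1 ≤ j by omega) hj
    obtain ⟨a, b, hab, ha, hb⟩ := hmax.resolve_left (by omega)
    have gk := List.getElem?_eq_getElem (show rowPos T.length sa k - 1 < T.length by omega)
    have key : ∀ a, sub T i (rowPos T.length sa k - 1) ++ [a] <:+: T →
        T[rowPos T.length sa k - 1]? ≠ some a → ∃ x ∈ P, sub T i (rowPos T.length sa k) <:+ T.take x := by
      intro a ha hne
      obtain ⟨x, x1, x2, x3, x4⟩ := concat_infix_iff.1 ha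
      obtain ⟨k', k1', k2', rfl⟩ := exists_rowPos hT h x1 x2
      have hle := (le_rowLcp_iff hT h k1' k2' k1 k2 (l := rowPos T.length sa k - i) (by omega)).2
        (by rwa [show rowPos T.length sa k - (rowPos T.length sa k - i) = i by omega])
      obtain ⟨y, hy, hyb, hyl⟩ := hS.covers k k' k1 k2 k1' k2' (fun he => hne (by
        rw [← x3, ← rowLetter_eq_iff hT h k1 k2 k1' k2', he]))
      have hym := hS.mem y hy
      rw [hrows.symm k k'] at hyl
      have := (sub_suffix_iff hT h hym.1 hym.2 k1 k2 (by omega)).2 ⟨hyb, hle.trans hyl⟩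
      rw [show rowPos T.length sa k - (rowPos T.length sa k - i) = i by omega] at this
      exact ⟨_, (hP _).2 ⟨y, hy, rfl⟩, this⟩
    by_cases hka : T[rowPos T.length sa k - 1]? = some a
    · exact key b hb (by rw [hka]; simpa using hab)
    · exact key a ha hka
  · have hex : ∀ x ∈ P, ∃ x' ∈ S', ∃ y ∈ S, x = rowPos T.length sa y ∧ ∃ k', 1 ≤ k' ∧ k' ≤ T.length ∧
        x' = rowPos T.length sa k' ∧ rowLetter (revText T) sa k' = rowLetter (revText T) sa y ∧
        ∀ y' ∈ S, y' ≠ y → rowLetter (revText T) sa y' = rowLetter (revText T) sa y →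
          rowLcp (revText T) sa y y' < rowLcp (revText T) sa k' y := by
      intro x hx
      obtain ⟨y, hy, rfl⟩ := (hP x).1 hx
      have hym := hS.mem y hy
      have hyp := rowPos_mem hT h hym.1 hym.2
      obtain ⟨z, ⟨z1, z2, hzb⟩, hz⟩ := hS.sep y hy
      have hzp := rowPos_mem hT h z1 z2
      have hyz : y ≠ z := by
        rintro rfl
        exact hzb rfl
      obtain ⟨l, hl⟩ := Int.eq_ofNat_of_zero_le (hrows.nonneg y z)
      have hlt := rowLcp_lt hT h hym.1 hym.2 z1 z2 hyz
      rw [hl] at hlt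
      have hsuf := (le_rowLcp_iff hT h z1 z2 hym.1 hym.2 (l := l) (by omega)).1
        (by rw [hrows.symm, hl])
      have gy := List.getElem?_eq_getElem (show rowPos T.length sa y - 1 < T.length by omega)
      have gz := List.getElem?_eq_getElem (show rowPos T.length sa z - 1 < T.length by omega)
      have hne : T[rowPos T.length sa y - 1] ≠ T[rowPos T.length sa z - 1] := by
        intro he
        refine hzb ((rowLetter_eq_iff hT h z1 z2 hym.1 hym.2).2 ?_)
        rw [gy, gz, he]
      obtain ⟨x', hx', hs'⟩ := hS'.2 (rowPos T.length sa y - l) (rowPos T.length sa y) (by omega) (by omega)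
        hyp.2 (Or.inr ⟨_, _, hne, concat_infix_iff.2 ⟨_, hyp.1, hyp.2, gy, List.drop_suffix _ _⟩,
          concat_infix_iff.2 ⟨_, hzp.1, hzp.2, gz, hsuf⟩⟩)
      have hx'' := Finset.mem_Icc.1 (hS'.1 hx')
      obtain ⟨k', k1, k2, rfl⟩ := exists_rowPos hT h hx''.1 hx''.2
      rw [sub_suffix_iff hT h k1 k2 hym.1 hym.2 (by omega)] at hs'
      refine ⟨_, hx', y, hy, rfl, k', k1, k2, rfl, hs'.1, fun y' hy' hne hb => ?_⟩
      have := hz y' hy' hne hb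
      omega
    choose! g hg hg' using hex
    refine Finset.card_le_card_of_injOn g hg fun x hx x' hx' he => ?_
    obtain ⟨y, hy, rfl, k, k1, k2, hk, hkb, hksep⟩ := hg' x hx
    obtain ⟨y', hy', rfl, k', k1', k2', hk', hkb', hksep'⟩ := hg' x' hx'
    obtain rfl : k = k' := rowPos_inj hT h k1 k2 k1' k2' (by rw [← hk, ← hk', he])
    by_contra hne
    have hyy : y ≠ y' := by
      rintro rfl
      exact hne rfl
    have e1 := hksep y' hy' hyy.symm (by rw [← hkb, ← hkb'])
    have e2 := hksep' y hy hyy (by rw [← hkb, ← hkb'])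
    have e3 := hrows.ultra y k y'
    rw [hrows.symm y k] at e3
    rw [hrows.symm y' y] at e2
    exact absurd e3 (not_le.2 (lt_min e1 e2))

end Optimality

section LastToFirst

variable {A : Type*} [LinearOrder A] {T : List A} {sa : ℕ → ℕ}

theorem IsText.getElem?_ne_last (hT : IsText T) {p : ℕ} (hp : p + 1 < T.length) :
    (revText T)[p]? ≠ (revText T)[T.length - 1]? := by
  obtain ⟨w, d, rfl, hw, hd, -⟩ := hT
  simp only [List.length_append, List.length_singleton, Nat.add_sub_cancel] at hp ⊢
  simp only [revText, List.dropLast_concat]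
  rw [List.getElem?_append_left (by simp; omega), List.getElem?_append_right (by simp)]
  simp only [List.length_reverse, Nat.sub_self, List.getLast?_append, List.getLast?_singleton,
    Option.some_or, Option.toList_some, List.getElem?_cons_zero]
  intro he
  have := List.mem_of_getElem? he
  exact hd (by simpa using this)

theorem drop_eq_cons (hT : IsText T) (h : IsSuffixArray (revText T) sa) {k k' : ℕ} (k1 : 1 ≤ k)
    (k2 : k ≤ T.length) (hk : sa k + 1 = sa k') :
    ∃ a, (revText T)[sa k - 1]? = some a ∧
      (revText T).drop (sa k - 1) = a :: (revText T).drop (sa k' - 1) := by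
  have hn := hT.length_revText
  have := h.mem k1 (by omega)
  have hlt : sa k - 1 < (revText T).length := by omega
  refine ⟨(revText T)[sa k - 1], List.getElem?_eq_getElem hlt, ?_⟩
  rw [List.drop_eq_getElem_cons hlt]
  congr 2
  omega

variable [Fintype A]

/-- The number of letters of the text smaller than `c`. -/
def smaller (T : List A) (c : ℤ) : ℕ := ((Finset.range T.length).filter (fun p => code T[p]? < c)).card

/-- The number of rows `k ≤ i` with letter `c`. -/
def rowCount (b : ℕ → ℤ) (i : ℕ) (c : ℤ) : ℕ := ((Finset.Icc 1 i).filter (fun k => b k = c)).card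

theorem rowCount_succ (b : ℕ → ℤ) (i : ℕ) (c : ℤ) :
    rowCount b (i + 1) c = rowCount b i c + if b (i + 1) = c then 1 else 0 := by
  unfold rowCount
  rw [← Finset.insert_Icc_right_eq_Icc_add_one (by omega), Finset.filter_insert]
  split_ifs with h
  · rw [Finset.card_insert_of_notMem (by simp)]
  · rfl

theorem IsText.smaller_revText (hT : IsText T) (c : ℤ) : smaller (revText T) c = smaller T c := by
  have hn := hT.length_revText
  unfold smaller
  rw [hn]
  set g : ℕ → ℕ := fun p => if p + 1 = T.length then p else T.length - 2 - p with hg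
  have hlt : ∀ p < T.length, g p < T.length := by
    intro p hp
    simp only [hg]
    split_ifs <;> omega
  have hgg : ∀ p < T.length, g (g p) = p := by
    intro p hp
    simp only [hg]
    split_ifs <;> omega
  have hget : ∀ p < T.length, (revText T)[p]? = T[g p]? := by
    intro p hp
    simp only [hg]
    split_ifs with h
    · exact hT.revText_getElem?_last h
    · exact hT.revText_getElem? (by omega)
  refine Finset.card_nbij' g g ?_ ?_ ?_ ?_
  · intro p hp
    simp only [Finset.coe_filter, Finset.mem_range, Set.mem_ofPred_eq] at hp ⊢
    exact ⟨hlt p hp.1, by rw [← hget p hp.1]; exact hp.2⟩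
  · intro p hp
    simp only [Finset.coe_filter, Finset.mem_range, Set.mem_ofPred_eq] at hp ⊢
    exact ⟨hlt p hp.1, by rw [hget _ (hlt p hp.1), hgg p hp.1]; exact hp.2⟩
  · intro p hp
    simp only [Finset.coe_filter, Finset.mem_range, Set.mem_ofPred_eq] at hp
    exact hgg p hp.1
  · intro p hp
    simp only [Finset.coe_filter, Finset.mem_range, Set.mem_ofPred_eq] at hp
    exact hgg p hp.1

theorem rowLetter_of_two_le {R : List A} {k : ℕ} (hk : 2 ≤ sa k) :
    rowLetter R sa k = code R[sa k - 2]? := by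
  simp only [rowLetter, bwtArray, charAt]
  rw [if_neg (by omega)]
  congr 1

theorem rowLetter_ne_of_sa_eq_one (hT : IsText T) (h : IsSuffixArray (revText T) sa) {i k : ℕ}
    (hk : sa k = 1) (h1 : 1 ≤ i) (h2 : i ≤ T.length) (hi : 2 ≤ sa i) :
    rowLetter (revText T) sa k ≠ rowLetter (revText T) sa i := by
  intro he
  have hn := hT.length_revText
  rw [rowLetter_of_two_le hi] at he
  have e : bwtArray (revText T) sa k = (revText T)[T.length - 1]? := by
    simp [bwtArray, charAt, hk, List.getLast?_eq_getElem?, hn]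
  rw [rowLetter, e, code_inj] at he
  have := h.mem h1 (by omega)
  exact hT.getElem?_ne_last (by omega) he.symm

theorem two_le_sa (hT : IsText T) (h : IsSuffixArray (revText T) sa) {i k : ℕ} (k1 : 1 ≤ k)
    (k2 : k ≤ T.length) (h1 : 1 ≤ i) (h2 : i ≤ T.length) (hne : i ≠ k)
    (hb : rowLetter (revText T) sa k = rowLetter (revText T) sa i) : 2 ≤ sa k := by
  have hn := hT.length_revText
  have a1 := h.mem k1 (by omega)
  have a2 := h.mem h1 (by omega)
  by_contra hcon
  have hk : sa k = 1 := by omega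
  have : sa i ≠ 1 := fun hi => hne (h.inj h1 (by omega) k1 (by omega) (by omega))
  exact rowLetter_ne_of_sa_eq_one hT h hk h1 h2 (by omega) hb

/-- The last-to-first mapping. -/
theorem lf_row (hT : IsText T) (h : IsSuffixArray (revText T) sa) {i j : ℕ} (h1 : 1 ≤ i)
    (h2 : i ≤ T.length) (hi : 2 ≤ sa i) (h3 : 1 ≤ j) (h4 : j ≤ T.length) (hj : sa j + 1 = sa i) :
    smaller T (rowLetter (revText T) sa i) + rowCount (rowLetter (revText T) sa) i
      (rowLetter (revText T) sa i) = j := by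
  classical
  have hn := hT.length_revText
  set R := revText T with hR
  set b := rowLetter R sa with hb
  have hlast : ∀ p, p + 1 < T.length → R[p]? ≠ R[T.length - 1]? := fun p hp => hT.getElem?_ne_last hp
  have hbk : ∀ k, 2 ≤ sa k → b k = code R[sa k - 2]? := fun k hk => rowLetter_of_two_le hk
  have hb1 : ∀ k, sa k = 1 → b k ≠ b i := fun k hk => rowLetter_ne_of_sa_eq_one hT h hk h1 h2 hi
  have hcons : ∀ {k k'}, 1 ≤ k → k ≤ T.length → sa k + 1 = sa k' → ∃ a, R[sa k - 1]? = some a ∧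
      R.drop (sa k - 1) = a :: R.drop (sa k' - 1) := fun k1 k2 hk => drop_eq_cons hT h k1 k2 hk
  obtain ⟨a, ha, hda⟩ := hcons h3 h4 hj
  have hbi : b i = rank a := by
    rw [hbk i hi, show sa i - 2 = sa j - 1 by omega, ha, code_some]
  choose! ρ hρ1 hρ2 hρ3 using fun p (hp : 1 ≤ p ∧ p ≤ T.length) =>
    h.exists_row hp.1 (show p ≤ R.length by omega)
  rw [hn] at hρ2
  have hρsa : ∀ k, 1 ≤ k → k ≤ T.length → ρ (sa k) = k := by
    intro k k1 k2
    have := h.mem k1 (by omega)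
    exact h.inj (hρ1 _ ⟨by omega, by omega⟩) (by rw [hn]; exact hρ2 _ ⟨by omega, by omega⟩) k1 (by omega)
      (hρ3 _ ⟨by omega, by omega⟩)
  have hfirst : ∀ k, 1 ≤ k → k ≤ T.length → ∃ e v, R[sa k - 1]? = some e ∧ R.drop (sa k - 1) = e :: v := by
    intro k k1 k2
    have := h.mem k1 (by omega)
    have hlt : sa k - 1 < R.length := by omega
    exact ⟨_, _, List.getElem?_eq_getElem hlt, List.drop_eq_getElem_cons hlt⟩
  have hA : ((Finset.Icc 1 j).filter (fun k => code R[sa k - 1]? < b i)).card = smaller T (b i) := by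
    rw [← hT.smaller_revText, ← hR, smaller, hn]
    refine Finset.card_nbij' (fun k => sa k - 1) (fun p => ρ (p + 1)) ?_ ?_ ?_ ?_
    · intro k hk
      simp only [Finset.coe_filter, Finset.mem_Icc, Finset.mem_range, Set.mem_ofPred_eq] at hk ⊢
      have := h.mem hk.1.1 (by omega)
      exact ⟨by omega, hk.2⟩
    · intro p hp
      simp only [Finset.coe_filter, Finset.mem_Icc, Finset.mem_range, Set.mem_ofPred_eq] at hp ⊢
      have e1 := hρ1 (p + 1) ⟨by omega, by omega⟩
      have e2 := hρ2 (p + 1) ⟨by omega, by omega⟩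
      have e3 := hρ3 (p + 1) ⟨by omega, by omega⟩
      have hcode : code R[sa (ρ (p + 1)) - 1]? < b i := by
        rw [e3, Nat.add_sub_cancel]
        exact hp.2
      refine ⟨⟨e1, ?_⟩, hcode⟩
      rw [← h.le_iff e1 (by omega) h3 (by omega)]
      obtain ⟨e, v, he, hv⟩ := hfirst _ e1 e2
      rw [he, code_some, hbi, rank_lt_iff] at hcode
      rw [hv, hda, cons_le_cons_iff']
      exact Or.inl hcode
    · intro k hk
      simp only [Finset.coe_filter, Finset.mem_Icc, Set.mem_ofPred_eq] at hk
      have := h.mem hk.1.1 (by omega)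
      simp only
      rw [show sa k - 1 + 1 = sa k by omega, hρsa k hk.1.1 (by omega)]
    · intro p hp
      simp only [Finset.coe_filter, Finset.mem_range, Set.mem_ofPred_eq] at hp
      simp only
      rw [hρ3 (p + 1) ⟨by omega, by omega⟩, Nat.add_sub_cancel]
  have hlt : ∀ k, 1 ≤ k → k ≤ T.length → code R[sa k - 1]? = b i → sa k + 1 ≤ T.length := by
    intro k k1 k2 hk
    have := h.mem k1 (by omega)
    have := h.mem h1 (by omega)
    by_contra hcon
    rw [hbk i hi, code_inj, show sa k - 1 = T.length - 1 by omega] at hk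
    exact hlast _ (by omega) hk.symm
  have hpair : ∀ k k', 1 ≤ k → k ≤ T.length → 1 ≤ k' → k' ≤ T.length → sa k + 1 = sa k' →
      code R[sa k - 1]? = b i → (k ≤ j ↔ k' ≤ i) := by
    intro k k' k1 k2 k1' k2' hk hc
    obtain ⟨e, he, hv⟩ := hcons k1 k2 hk
    have hea : e = a := by
      have : code (some e) = code (some a) := by rw [← he, hc, hbi, code_some]
      exact Option.some.inj (code_inj.1 this)
    rw [← h.le_iff k1 (by omega) h3 (by omega), ← h.le_iff k1' (by omega) h1 (by omega), hv, hda, hea,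
      cons_le_cons_iff']
    simp
  have hB : ((Finset.Icc 1 j).filter (fun k => code R[sa k - 1]? = b i)).card = rowCount b i (b i) := by
    refine Finset.card_nbij' (fun k => ρ (sa k + 1)) (fun k => ρ (sa k - 1)) ?_ ?_ ?_ ?_
    · intro k hk
      simp only [Finset.coe_filter, Finset.mem_Icc, Set.mem_ofPred_eq] at hk ⊢
      have hm := h.mem hk.1.1 (by omega)
      have hr := hlt k hk.1.1 (by omega) hk.2
      have e1 := hρ1 (sa k + 1) ⟨by omega, hr⟩
      have e2 := hρ2 (sa k + 1) ⟨by omega, hr⟩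
      have e3 := hρ3 (sa k + 1) ⟨by omega, hr⟩
      refine ⟨⟨e1, (hpair k _ hk.1.1 (by omega) e1 e2 e3.symm hk.2).1 hk.1.2⟩, ?_⟩
      rw [hbk _ (by omega), e3, show sa k + 1 - 2 = sa k - 1 by omega, hk.2]
    · intro k hk
      simp only [Finset.coe_filter, Finset.mem_Icc, Set.mem_ofPred_eq] at hk ⊢
      have hm := h.mem hk.1.1 (by omega)
      have hne : sa k ≠ 1 := fun he => hb1 k he hk.2
      have e1 := hρ1 (sa k - 1) ⟨by omega, by omega⟩
      have e2 := hρ2 (sa k - 1) ⟨by omega, by omega⟩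
      have e3 := hρ3 (sa k - 1) ⟨by omega, by omega⟩
      have e4 : code R[sa (ρ (sa k - 1)) - 1]? = b i := by
        rw [e3, ← hk.2, hbk k (by omega)]
        congr 1
      exact ⟨⟨e1, (hpair _ k e1 e2 hk.1.1 (by omega) (by omega) e4).2 hk.1.2⟩, e4⟩
    · intro k hk
      simp only [Finset.coe_filter, Finset.mem_Icc, Set.mem_ofPred_eq] at hk
      have hr := hlt k hk.1.1 (by omega) hk.2
      simp only
      rw [hρ3 (sa k + 1) ⟨by omega, hr⟩, Nat.add_sub_cancel, hρsa k hk.1.1 (by omega)]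
    · intro k hk
      simp only [Finset.coe_filter, Finset.mem_Icc, Set.mem_ofPred_eq] at hk
      have hm := h.mem hk.1.1 (by omega)
      have hne : sa k ≠ 1 := fun he => hb1 k he hk.2
      simp only
      rw [hρ3 (sa k - 1) ⟨by omega, by omega⟩, show sa k - 1 + 1 = sa k by omega,
        hρsa k hk.1.1 (by omega)]
  rw [← hA, ← hB]
  have hcard := Finset.card_filter_add_card_filter_not (s := Finset.Icc 1 j)
    (fun k => code R[sa k - 1]? < b i)
  rw [Nat.card_Icc, Nat.add_sub_cancel] at hcard
  rw [Finset.filter_congr (q := fun k => ¬ code R[sa k - 1]? < b i) (p := fun k => code R[sa k - 1]? = b i)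
    ?_, hcard]
  intro k hk
  rw [Finset.mem_Icc] at hk
  obtain ⟨e, v, he, hv⟩ := hfirst k hk.1 (by omega)
  have hle := (h.le_iff hk.1 (by omega) h3 (by omega)).2 hk.2
  rw [hv, hda, cons_le_cons_iff'] at hle
  rw [he, code_some, hbi, rank_lt_iff]
  rcases hle with hle | ⟨rfl, -⟩
  · simp [hle, (rank_lt hle).ne]
  · simp

/-- Consecutive rows with letter `c` are mapped to consecutive rows. -/
theorem lf_lcp (hT : IsText T) (h : IsSuffixArray (revText T) sa) {i q : ℕ} (hi : i < T.length)
    (hq : IsLast (rowLetter (revText T) sa) i (rowLetter (revText T) sa (i + 1)) q) {j : ℕ}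
    (hj : j = smaller T (rowLetter (revText T) sa (i + 1)) + rowCount (rowLetter (revText T) sa) (i + 1)
      (rowLetter (revText T) sa (i + 1))) :
    2 ≤ j ∧ j ≤ T.length ∧
      (lcpArray (revText T) sa j : ℤ) = rowLcp (revText T) sa q (i + 1) + 1 := by
  have hn := hT.length_revText
  set b := rowLetter (revText T) sa with hb
  have q1 := hq.pos
  have q2 := hq.le
  have s1 : 2 ≤ sa (i + 1) := two_le_sa hT h (by omega) (by omega) q1 (by omega) (by omega) hq.eq.symm
  have s2 : 2 ≤ sa q := two_le_sa hT h q1 (by omega) (show 1 ≤ i + 1 by omega) (by omega) (by omega) hq.eq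
  have m1 := h.mem (show 1 ≤ i + 1 by omega) (by omega)
  have m2 := h.mem q1 (by omega)
  obtain ⟨j₁, a1, a2, a3⟩ := h.exists_row (show 1 ≤ sa (i + 1) - 1 by omega) (by omega)
  obtain ⟨j₂, b1, b2, b3⟩ := h.exists_row (show 1 ≤ sa q - 1 by omega) (by omega)
  have e1 := lf_row hT h (show 1 ≤ i + 1 by omega) (by omega) s1 a1 (by omega) (by omega)
  have e2 := lf_row hT h q1 (by omega) s2 b1 (by omega) (by omega)
  rw [← hb, hq.eq] at e2
  rw [← hb] at e1
  have hcount : ∀ k, q ≤ k → k ≤ i → rowCount b k (b (i + 1)) = rowCount b q (b (i + 1)) := by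
    intro k hk
    induction k, hk using Nat.le_induction with
    | base => exact fun _ => rfl
    | succ k hk ih =>
      intro hki
      rw [rowCount_succ, if_neg (hq.ne (k + 1) (by omega) hki), ih (by omega)]
      rfl
  have e3 := hcount i q2 le_rfl
  have e4 := rowCount_succ b i (b (i + 1))
  rw [if_pos rfl] at e4
  obtain rfl : j = j₁ := by omega
  obtain rfl : j₂ = j - 1 := by omega
  refine ⟨by omega, by omega, ?_⟩
  obtain ⟨c₁, g1, d1⟩ := drop_eq_cons hT h a1 (by omega) (show sa j + 1 = sa (i + 1) by omega)
  obtain ⟨c₂, g2, d2⟩ := drop_eq_cons hT h b1 (by omega) (show sa (j - 1) + 1 = sa q by omega)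
  have hc : c₁ = c₂ := by
    have : b q = b (i + 1) := hq.eq
    rw [hb, rowLetter_of_two_le s1, rowLetter_of_two_le s2, show sa q - 2 = sa (j - 1) - 1 by omega,
      show sa (i + 1) - 2 = sa j - 1 by omega, code_inj, g1, g2] at this
    exact (Option.some.inj this).symm
  rw [lcpArray, d1, d2, hc, lcpLen, if_pos rfl, rowLcp, lcpLen_comm]
  push_cast
  rfl

end LastToFirst


/-! ## Execution of the scan -/

theorem Ter.frame {W : ℕ} {c : Cmd} {s : Store} {Q : Store → Prop} (h : Ter W c s Q)
    (hc : c.noAlloc = true) : Ter W c s (fun s' => Q s' ∧ Frame c.wv c.wa s s') :=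
  let ⟨_, _, h1, h2⟩ := h
  ⟨_, _, h1, h2, h1.frame hc⟩

/-- The machine holds the arrays used by the scan. -/
structure Env (W n σ : ℕ) (b : ℕ → ℤ) (sa : ℕ → ℕ) (lcp : ℕ → ℤ) (s : Store) : Prop where
  n_eq : s.var 0 = n
  bwt : ∀ k : ℕ, 1 ≤ k → k ≤ n → s.arr 3 k = b k
  letter : ∀ k : ℕ, 1 ≤ k → k ≤ n → 1 ≤ b k ∧ b k ≤ σ
  suf : ∀ k : ℕ, 1 ≤ k → k ≤ n → s.arr 1 k = sa k
  suf_mem : ∀ k : ℕ, 1 ≤ k → k ≤ n → 1 ≤ sa k ∧ sa k ≤ n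
  lcp_eq : ∀ k : ℕ, 2 ≤ k → k ≤ n → s.arr 2 k = lcp k
  lcp_mem : ∀ k : ℕ, 2 ≤ k → k ≤ n → 0 ≤ lcp k ∧ lcp k ≤ n
  size_suf : n < s.size 1
  size_lcp : n < s.size 2
  size_bwt : n < s.size 3
  size_set : n < s.size 4
  size_len : σ < s.size 5
  size_pos : σ < s.size 6
  size_act : σ < s.size 7
  size_lf : σ < s.size 8
  le : σ ≤ n
  fit : 10 * n + 20 ≤ W

theorem Env.frame {W n σ : ℕ} {b : ℕ → ℤ} {sa : ℕ → ℕ} {lcp : ℕ → ℤ} {s s' : Store} {X Y : List ℕ}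
    (h : Env W n σ b sa lcp s) (f : Frame X Y s s') (hX : 0 ∉ X) (h1 : 1 ∉ Y)
    (h2 : 2 ∉ Y) (h3 : 3 ∉ Y) : Env W n σ b sa lcp s' where
  n_eq := by rw [f.var 0 hX, h.n_eq]
  bwt := by rw [f.arr 3 h3]; exact h.bwt
  letter := h.letter
  suf := by rw [f.arr 1 h1]; exact h.suf
  suf_mem := h.suf_mem
  lcp_eq := by rw [f.arr 2 h2]; exact h.lcp_eq
  lcp_mem := h.lcp_mem
  size_suf := by rw [f.size]; exact h.size_suf
  size_lcp := by rw [f.size]; exact h.size_lcp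
  size_bwt := by rw [f.size]; exact h.size_bwt
  size_set := by rw [f.size]; exact h.size_set
  size_len := by rw [f.size]; exact h.size_len
  size_pos := by rw [f.size]; exact h.size_pos
  size_act := by rw [f.size]; exact h.size_act
  size_lf := by rw [f.size]; exact h.size_lf
  le := h.le
  fit := h.fit

/-- The machine holds the candidates `R` and the set of the positions of the rows in `S`. -/
structure Rep (n σ : ℕ) (sa : ℕ → ℕ) (s : Store) (S : Set ℕ) (R : ℤ → Cell) : Prop where
  len : ∀ c : ℤ, 1 ≤ c → c ≤ σ → s.arr 5 c = (R c).len
  len_mem : ∀ c : ℤ, 1 ≤ c → c ≤ σ → -1 ≤ (R c).len ∧ (R c).len ≤ n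
  pos : ∀ c : ℤ, 1 ≤ c → c ≤ σ → (R c).act = true → s.arr 6 c = rowPos n sa (R c).pos
  pos_mem : ∀ c : ℤ, 1 ≤ c → c ≤ σ → (R c).act = true → 1 ≤ (R c).pos ∧ (R c).pos ≤ n
  act : ∀ c : ℤ, 1 ≤ c → c ≤ σ → s.arr 7 c = if (R c).act = true then 1 else 0
  set : ∀ x : ℕ, 1 ≤ x → x ≤ n → (s.arr 4 x = 1 ↔ ∃ k ∈ S, x = rowPos n sa k)

section

variable {W n σ : ℕ} {b : ℕ → ℤ} {sa : ℕ → ℕ} {lcp : ℕ → ℤ} {s s' : Store} {S S' : Set ℕ} {R : ℤ → Cell}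
  {c : ℤ}

theorem Rep.congr (h : Rep n σ sa s S R) (h4 : s'.arr 4 = s.arr 4) (h5 : s'.arr 5 = s.arr 5)
    (h6 : s'.arr 6 = s.arr 6) (h7 : s'.arr 7 = s.arr 7) : Rep n σ sa s' S R := by
  obtain ⟨a1, a2, a3, a4, a5, a6⟩ := h
  exact ⟨by rwa [h5], a2, by rwa [h6], a4, by rwa [h7], by rwa [h4]⟩

theorem Rep.update (h : Rep n σ sa s S R) (r : Cell) (hlen : -1 ≤ r.len ∧ r.len ≤ n)
    (hpos : r.act = true → 1 ≤ r.pos ∧ r.pos ≤ n)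
    (h5 : ∀ x, s'.arr 5 x = if x = c then r.len else s.arr 5 x)
    (h6 : ∀ x, x ≠ c → s'.arr 6 x = s.arr 6 x) (h6' : r.act = true → s'.arr 6 c = rowPos n sa r.pos)
    (h7 : ∀ x, s'.arr 7 x = if x = c then (if r.act = true then 1 else 0) else s.arr 7 x)
    (h4 : ∀ x : ℕ, 1 ≤ x → x ≤ n → (s'.arr 4 x = 1 ↔ ∃ k ∈ S', x = rowPos n sa k)) :
    Rep n σ sa s' S' (Function.update R c r) := by
  refine ⟨fun x h1 h2 => ?_, fun x h1 h2 => ?_, fun x h1 h2 => ?_, fun x h1 h2 => ?_, fun x h1 h2 => ?_, h4⟩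
  · by_cases hx : x = c
    · subst hx
      simpa using h5 x
    · simp only [Function.update_of_ne hx]
      rw [h5, if_neg hx, h.len x h1 h2]
  · by_cases hx : x = c
    · subst hx
      simpa using hlen
    · simp only [Function.update_of_ne hx]
      exact h.len_mem x h1 h2
  · by_cases hx : x = c
    · subst hx
      simpa using h6'
    · simp only [Function.update_of_ne hx]
      rw [h6 x hx]
      exact h.pos x h1 h2
  · by_cases hx : x = c
    · subst hx
      simpa using hpos
    · simp only [Function.update_of_ne hx]
      exact h.pos_mem x h1 h2
  · by_cases hx : x = c
    · subst hx
      simpa using h7 x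
    · simp only [Function.update_of_ne hx]
      rw [h7, if_neg hx, h.act x h1 h2]

theorem evalCand_ter (e : Env W n σ b sa lcp s) (h : Rep n σ sa s S R) {l : ℤ} (hc : s.var 4 = c)
    (c1 : 1 ≤ c) (c2 : c ≤ σ) (hl : s.var 5 = l) (l1 : -1 ≤ l) (l2 : l ≤ n) :
    Ter W evalCand s (fun s' => Rep n σ sa s' ((R c).evalSet l S)
      (Function.update R c ((R c).eval l))) := by
  have z4 := e.size_set
  have z5 := e.size_len
  have z6 := e.size_pos
  have z7 := e.size_act
  have hfit := e.fit
  have hσ := e.le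
  have hlen := h.len c c1 c2
  have hlen' := h.len_mem c c1 c2
  have hact := h.act c c1 c2
  unfold evalCand
  simp only [whenever, block, Ter_ite, Ter_seq, Ter_put, Ter_skip]
  refine ⟨?_, fun hlt => ?_, fun hlt => ?_⟩
  · simp [hl, hc, hlen]
    omega
  · simp [hl, hc, hlen] at hlt
    have hev : (R c).eval l = ⟨l, 0, false⟩ := by rw [Cell.eval, if_pos hlt]
    rw [hev]
    refine ⟨?_, fun ha => ?_, fun ha => ?_⟩
    · simp [hc, hact]
      split_ifs <;> omega
    · simp [hc, hact] at ha
      have hp := h.pos c c1 c2 ha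
      have hpm := h.pos_mem c c1 c2 ha
      have hpm' := e.suf_mem _ hpm.1 hpm.2
      have hb : 1 ≤ rowPos n sa (R c).pos ∧ rowPos n sa (R c).pos ≤ n := by
        unfold rowPos
        omega
      refine ⟨?_, ?_, ?_, ?_, ?_, ?_, ?_, ?_, ?_, ?_, ?_, ?_, ?_⟩
      · simp [hc, hp]
        omega
      · simp
        omega
      · simp [hc, hp]
        omega
      · simp [hc]
        omega
      · simp [hl]
        omega
      · simp [hc]
        omega
      · simp [hc]
        omega
      · simp
      · simp [hc]
        omega
      · simp [hc]
        omega
      · simp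
      · simp [hc]
        omega
      · refine h.update (c := c) ⟨l, 0, false⟩ ⟨l1, l2⟩ (by simp) ?_ ?_ (by simp) ?_ ?_
        · intro x
          simp [hc, hl]
        · intro x hx
          simp [hc, hx]
        · intro x
          simp [hc]
        · intro x x1 x2
          have := h.set x x1 x2
          simp only [Store.setCell_arr, Store.setCell_var, aS, aLen, aPos, aAct, Expr.val, xC, hc, hp,
            Cell.evalSet, Set.mem_ofPred_eq]
          simp only [Nat.reduceEqDiff, if_false, if_true, Nat.cast_inj]
          split_ifs with hx
          · simp only [true_iff]
            exact ⟨_, Or.inr ⟨hlt, ha, rfl⟩, hx⟩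
          · rw [this]
            constructor
            · rintro ⟨k, hk, rfl⟩
              exact ⟨k, Or.inl hk, rfl⟩
            · rintro ⟨k, hk | ⟨-, -, rfl⟩, rfl⟩
              · exact ⟨k, hk, rfl⟩
              · exact absurd rfl hx
    · simp [hc, hact] at ha
      refine ⟨?_, ?_, ?_, ?_, ?_, ?_, ?_, ?_, ?_, ?_⟩
      · simp [hc]
        omega
      · simp [hl]
        omega
      · simp [hc]
        omega
      · simp [hc]
        omega
      · simp
      · simp [hc]
        omega
      · simp [hc]
        omega
      · simp
      · simp [hc]
        omega
      · refine h.update (c := c) ⟨l, 0, false⟩ ⟨l1, l2⟩ (by simp) ?_ ?_ (by simp) ?_ ?_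
        · intro x
          simp [hc, hl]
        · intro x hx
          simp [hc, hx]
        · intro x
          simp [hc]
        · intro x x1 x2
          have := h.set x x1 x2
          simpa [hc, hl, Cell.evalSet, ha] using this
  · simp [hl, hc, hlen] at hlt
    have hev : (R c).eval l = R c := by rw [Cell.eval, if_neg (by omega)]
    have hS : (R c).evalSet l S = S := by
      ext y
      simp only [Cell.evalSet, Set.mem_ofPred_eq, or_iff_left_iff_imp]
      omega
    rw [hev, hS, Function.update_eq_self]
    exact h

/-- The command which replaces the candidate by a longer one. -/
def offerCand : Cmd := whenever (.lt (.get aLen (.var xC)) (.get aLCP (.var xI))) (block [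
    put aLen (.var xC) (.get aLCP (.var xI)),
    put aPos (.var xC) (.add (.sub (.var xN) (.get aSA (.var xK))) (.lit 1)),
    put aAct (.var xC) (.lit 1)])

theorem offerCand_ter (e : Env W n σ b sa lcp s) (h : Rep n σ sa s S R) {i k : ℕ} (hc : s.var 4 = c)
    (c1 : 1 ≤ c) (c2 : c ≤ σ) (hi : s.var 2 = i) (i1 : 2 ≤ i) (i2 : i ≤ n) (hk : s.var 3 = k) (k1 : 1 ≤ k)
    (k2 : k ≤ n) :
    Ter W offerCand s (fun s' => Rep n σ sa s' S (Function.update R c ((R c).offer (lcp i) k))) := by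
  have z1 := e.size_suf
  have z2 := e.size_lcp
  have z5 := e.size_len
  have z6 := e.size_pos
  have z7 := e.size_act
  have hfit := e.fit
  have hσ := e.le
  have hn := e.n_eq
  have hlen := h.len c c1 c2
  have hlen' := h.len_mem c c1 c2
  have hv := e.lcp_eq i i1 i2
  have hv' := e.lcp_mem i i1 i2
  have hs := e.suf k k1 k2
  have hs' := e.suf_mem k k1 k2
  unfold offerCand
  simp only [whenever, block, Ter_ite, Ter_seq, Ter_put, Ter_skip]
  refine ⟨?_, fun hlt => ?_, fun hlt => ?_⟩
  · simp [hi, hc, hlen, hv]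
    omega
  · simp [hi, hc, hlen, hv] at hlt
    rw [Cell.offer, if_pos hlt]
    refine ⟨?_, ?_, ?_, ?_, ?_, ?_, ?_, ?_, ?_, ?_⟩
    · simp [hc]
      omega
    · simp [hi, hv]
      omega
    · simp [hc]
      omega
    · simp [hc]
      omega
    · simp [hn, hk, hs]
      omega
    · simp [hc]
      omega
    · simp [hc]
      omega
    · simp
      omega
    · simp [hc]
      omega
    · refine h.update (c := c) ⟨lcp i, k, true⟩ (by simp; omega) (fun _ => ⟨k1, k2⟩) ?_ ?_ ?_ ?_ ?_
      · intro x
        simp [hc, hi, hv]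
      · intro x hx
        simp [hc, hx]
      · intro _
        simp [hc, hn, hk, hs, rowPos]
        omega
      · intro x
        simp [hc]
      · intro x x1 x2
        have := h.set x x1 x2
        simpa [hc] using this
  · simp [hi, hc, hlen, hv] at hlt
    rw [Cell.offer, if_neg (by omega), Function.update_eq_self]
    exact h

theorem processCand_eq : processCand = block [
    assign xC (.get aBWT (.var xK)),
    ite (.eq (.var xK) (.sub (.var xI) (.lit 1)))
      (block [assign xL (.var xM), evalCand])
      (whenever (.not (.eq (.get aLen (.var xC)) (.lit (-1))))
        (block [assign xL (.sub (.get aLCP (.get aLF (.var xC))) (.lit 1)), evalCand])),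
    offerCand] := rfl

theorem Env.setVar (e : Env W n σ b sa lcp s) (x : ℕ) (v : ℤ) (hx : x ≠ 0) :
    Env W n σ b sa lcp (s.setVar x v) :=
  e.frame (Frame.setVar s x v) (by simpa using hx.symm) (by simp) (by simp) (by simp)

theorem Rep.setVar (h : Rep n σ sa s S R) (x : ℕ) (v : ℤ) : Rep n σ sa (s.setVar x v) S R :=
  h.congr rfl rfl rfl rfl

theorem processCand_left (e : Env W n σ b sa lcp s) (h : Rep n σ sa s S R) {i : ℕ} {m : ℤ}
    (hi : s.var 2 = ((i + 1 : ℕ) : ℤ)) (i1 : 1 ≤ i) (i2 : i < n) (hk : s.var 3 = i) (hm : s.var 6 = m)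
    (m1 : 0 ≤ m) (m2 : m ≤ n) :
    Ter W processCand s (fun s' => Rep n σ sa s' ((R (b i)).evalSet m S)
      (Function.update R (b i) (((R (b i)).eval m).offer (lcp (i + 1)) i))) := by
  have hfit := e.fit
  have hσ := e.le
  have z3 := e.size_bwt
  have hb := e.bwt i i1 (by omega)
  have hb' := e.letter i i1 (by omega)
  rw [processCand_eq]
  simp only [block]
  rw [Ter_seq, Ter_assign, Ter_seq, Ter_ite]
  refine ⟨?_, ?_, fun _ => ?_, fun hc => ?_⟩
  · simp [hk, hb]
    omega
  · simp [hk, hi]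
    omega
  · rw [Ter_seq, Ter_assign]
    refine ⟨by simp [hm]; omega, ?_⟩
    have := evalCand_ter (l := m) (c := b i) ((e.setVar 4 (b i) (by simp)).setVar 5 m (by simp))
      ((h.setVar 4 (b i)).setVar 5 m) (by simp) hb'.1 hb'.2 (by simp) (by omega) m2
    simp only [Expr.val, xC, xL, xK, xM, aBWT, hk, hb, Store.setVar_var, hm,
      Nat.reduceEqDiff, if_false]
    refine (this.frame rfl).mono ?_
    rintro s' ⟨h', f⟩
    have := offerCand_ter (((e.setVar 4 (b i) (by simp)).setVar 5 m (by simp)).frame f (by decide)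
      (by decide) (by decide) (by decide)) h' (i := i + 1) (k := i) (c := b i)
      (by rw [f.var _ (by decide)]; simp) hb'.1 hb'.2 (by rw [f.var _ (by decide)]; simpa using hi)
      (by omega) (by omega) (by rw [f.var _ (by decide)]; simpa using hk) i1 (by omega)
    simpa using this
  · simp [hk, hi] at hc

theorem processCand_right (e : Env W n σ b sa lcp s) (h : Rep n σ sa s S R) {i : ℕ}
    (hi : s.var 2 = ((i + 1 : ℕ) : ℤ)) (i2 : i < n) (i1 : 1 ≤ i) (hk : s.var 3 = ((i + 1 : ℕ) : ℤ)) {l : ℤ}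
    (hl0 : -1 ≤ l) (hl : (R (b (i + 1))).len ≠ -1 → ∃ j : ℕ, 2 ≤ j ∧ j ≤ n ∧ s.arr 8 (b (i + 1)) = j ∧
      lcp j = l + 1) :
    Ter W processCand s (fun s' => Rep n σ sa s' ((R (b (i + 1))).evalSet l S)
      (Function.update R (b (i + 1)) (((R (b (i + 1))).eval l).offer (lcp (i + 1)) (i + 1)))) := by
  have hfit := e.fit
  have hσ := e.le
  have z2 := e.size_lcp
  have z3 := e.size_bwt
  have z5 := e.size_len
  have z8 := e.size_lf
  have hb := e.bwt (i + 1) (by omega) i2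
  have hb' := e.letter (i + 1) (by omega) i2
  have hlen := h.len _ hb'.1 hb'.2
  have hlen' := h.len_mem _ hb'.1 hb'.2
  rw [processCand_eq]
  simp only [block]
  rw [Ter_seq, Ter_assign, Ter_seq, Ter_ite]
  refine ⟨?_, ?_, fun hc => ?_, fun _ => ?_⟩
  · simp only [Expr.ok, Expr.val, xK, aBWT, hk, hb]
    omega
  · simp [hk, hi]
    omega
  · simp [hk, hi] at hc
  · simp only [Expr.val, xC, xK, aBWT, hk, hb, whenever]
    rw [Ter_ite]
    have e1 := e.setVar 4 (b (i + 1)) (by simp)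
    have h1 := h.setVar 4 (b (i + 1))
    refine ⟨?_, fun hne => ?_, fun hne => ?_⟩
    · simp [hlen]
      omega
    · simp [hlen] at hne
      obtain ⟨j, j1, j2, hj, hjl⟩ := hl hne
      have hv := e.lcp_eq j j1 j2
      have hv' := e.lcp_mem j j1 j2
      rw [Ter_seq, Ter_assign]
      refine ⟨?_, ?_⟩
      · simp [hj, hv]
        omega
      · have := evalCand_ter (l := l) (c := b (i + 1)) (e1.setVar 5 l (by simp))
          (h1.setVar 5 l) (by simp) hb'.1 hb'.2 (by simp) hl0 (by omega)
        simp only [Expr.val, xL, aLF, aLCP, Store.setVar_var, Store.setVar_arr, if_true, hj, hv, hjl,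
          Int.add_sub_cancel]
        refine (this.frame rfl).mono ?_
        rintro s' ⟨h', f⟩
        have := offerCand_ter ((e1.setVar 5 l (by simp)).frame f (by decide)
          (by decide) (by decide) (by decide)) h' (i := i + 1) (k := i + 1) (c := b (i + 1))
          (by rw [f.var _ (by decide)]; simp) hb'.1 hb'.2 (by rw [f.var _ (by decide)]; simpa using hi)
          (by omega) (by omega) (by rw [f.var _ (by decide)]; simpa using hk) (by omega) (by omega)
        simpa using this
    · simp [hlen] at hne
      have hev : (R (b (i + 1))).eval l = R (b (i + 1)) := by rw [Cell.eval, if_neg (by omega)]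
      have hS : (R (b (i + 1))).evalSet l S = S := by
        ext y
        simp only [Cell.evalSet, Set.mem_ofPred_eq, or_iff_left_iff_imp]
        omega
      rw [Ter_skip, hev, hS]
      exact offerCand_ter e1 h1 (by simp) hb'.1 hb'.2 (by simpa using hi) (by omega) (by omega)
        (by simpa using hk) (by omega) (by omega)

end


/-- The body of the scan. -/
def scanBody : Cmd := block [
  incr aLF (.get aBWT (.var xI)),
  whenever (.lt (.get aLCP (.var xI)) (.var xM)) (assign xM (.get aLCP (.var xI))),
  whenever (.not (.eq (.get aBWT (.var xI)) (.get aBWT (.sub (.var xI) (.lit 1))))) (block [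
    assign xK (.sub (.var xI) (.lit 1)),
    processCand,
    assign xK (.var xI),
    processCand,
    assign xM infinity])]

/-- The state of the machine after the scan of `i` rows. -/
structure ScanInv (n σ : ℕ) (b : ℕ → ℤ) (L : ℕ → ℕ → ℤ) (sa : ℕ → ℕ) (base : ℤ → ℕ) (i : ℕ) (s : Store) :
    Prop where
  lf : ∀ c : ℤ, 1 ≤ c → c ≤ σ → s.arr 8 c = base c + rowCount b i c
  nonneg : 0 ≤ s.var 6
  le : s.var 6 ≤ n + 1
  stage : ∃ S R, Rep n σ sa s S R ∧ Stage n b L i S R (s.var 6)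

theorem rowCount_le (b : ℕ → ℤ) (i : ℕ) (c : ℤ) : rowCount b i c ≤ i :=
  (Finset.card_filter_le _ _).trans (by simp)

theorem IsLast.unique {b : ℕ → ℤ} {i q q' : ℕ} {c : ℤ} (h : IsLast b i c q) (h' : IsLast b i c q') :
    q = q' := by
  rcases lt_trichotomy q q' with hq | hq | hq
  · exact absurd h'.eq (h.ne q' hq h'.le)
  · exact hq
  · exact absurd h.eq (h'.ne q hq h.le)

section

variable {W n σ : ℕ} {b : ℕ → ℤ} {L : ℕ → ℕ → ℤ} {sa : ℕ → ℕ} {base : ℤ → ℕ} {s : Store} {i : ℕ}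

theorem scanBody_ter (e : Env W n σ b sa (fun k => L (k - 1) k) s) (hL : Rows n L)
    (hbase : ∀ c, base c ≤ n)
    (hLF : ∀ q, IsLast b i (b (i + 1)) q → ∃ j : ℕ, 2 ≤ j ∧ j ≤ n ∧
      base (b (i + 1)) + rowCount b (i + 1) (b (i + 1)) = j ∧ L (j - 1) j = L q (i + 1) + 1)
    (h : ScanInv n σ b L sa base i s) (hi : s.var 2 = ((i + 1 : ℕ) : ℤ)) (i1 : 1 ≤ i) (i2 : i < n) :
    Ter W scanBody s (fun s' => ScanInv n σ b L sa base (i + 1) s') := by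
  obtain ⟨hlf, hm0, hm1, S, R, hR, hS⟩ := h
  have hfit := e.fit
  have hσ := e.le
  have z2 := e.size_lcp
  have z3 := e.size_bwt
  have z8 := e.size_lf
  have hb := e.bwt (i + 1) (by omega) i2
  have hb' := e.letter (i + 1) (by omega) i2
  have hbi := e.bwt i (by omega) (by omega)
  have hv := e.lcp_eq (i + 1) (by omega) i2
  have hv' := e.lcp_mem (i + 1) (by omega) i2
  simp only [Nat.add_sub_cancel] at hv hv'
  have hcell := hlf _ hb'.1 hb'.2
  have hrc := rowCount_le b i (b (i + 1))
  have hbs := hbase (b (i + 1))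
  unfold scanBody
  simp only [block]
  rw [Ter_seq, incr, Ter_put]
  refine ⟨?_, ?_, ?_, ?_⟩
  · simp only [Expr.ok, Expr.val, xI, aBWT, hi, hb]
    omega
  · simp only [Expr.ok, Expr.val, xI, aBWT, aLF, hi, hb, hcell]
    omega
  · simp only [Expr.val, xI, aBWT, aLF, hi, hb]
    omega
  simp only [Expr.val, xI, aBWT, aLF, hi, hb, hcell]
  set s₁ := s.setCell 8 (b (i + 1)) (base (b (i + 1)) + rowCount b i (b (i + 1)) + 1) with hs₁
  have f₁ : Frame [] [8] s s₁ := by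
    refine ⟨fun _ _ => rfl, fun a ha => ?_, rfl, rfl⟩
    funext j
    simp only [List.mem_singleton] at ha
    simp [hs₁, ha]
  have e₁ := e.frame f₁ (by decide) (by decide) (by decide) (by decide)
  have r₁ : Rep n σ sa s₁ S R := hR.congr (f₁.arr _ (by decide)) (f₁.arr _ (by decide))
    (f₁.arr _ (by decide)) (f₁.arr _ (by decide))
  have lf₁ : ∀ c : ℤ, 1 ≤ c → c ≤ σ → s₁.arr 8 c = base c + rowCount b (i + 1) c := by
    intro c c1 c2
    rw [hs₁, Store.setCell_arr, if_pos rfl, rowCount_succ]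
    by_cases hc : c = b (i + 1)
    · rw [if_pos hc, if_pos hc.symm, hc]
      push_cast
      ring
    · rw [if_neg hc, if_neg (Ne.symm hc), hlf c c1 c2]
      simp
  have i₁ : s₁.var 2 = ((i + 1 : ℕ) : ℤ) := hi
  have m₁ : s₁.var 6 = s.var 6 := rfl
  clear_value s₁
  have hmin : Ter W (whenever (.lt (.get aLCP (.var xI)) (.var xM)) (assign xM (.get aLCP (.var xI)))) s₁
      (fun s₂ => s₂ = s₁.setVar 6 (min (s.var 6) (L i (i + 1)))) := by
    have hv₁ := e₁.lcp_eq (i + 1) (by omega) i2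
    simp only [Nat.add_sub_cancel] at hv₁
    have z2' := e₁.size_lcp
    simp only [whenever, Ter_ite, Ter_assign, Ter_skip]
    refine ⟨?_, fun hlt => ⟨?_, ?_⟩, fun hlt => ?_⟩
    · simp only [Cond.ok, Expr.ok, Expr.val, xI, aLCP, xM, i₁, m₁, hv₁]
      omega
    · simp only [Expr.ok, Expr.val, xI, aLCP, i₁, hv₁]
      omega
    · simp only [Cond.holds, Expr.val, xI, aLCP, xM, i₁, m₁, hv₁] at hlt ⊢
      rw [min_eq_right hlt.le]
    · simp only [Cond.holds, Expr.val, xI, aLCP, xM, i₁, m₁, hv₁, not_lt] at hlt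
      rw [min_eq_left hlt, ← m₁]
      simp [Store.setVar]
  rw [Ter_seq]
  refine hmin.mono ?_
  rintro s₂ rfl
  set m := min (s.var 6) (L i (i + 1)) with hm
  have hmm : 0 ≤ m ∧ m ≤ n := ⟨le_min hm0 hv'.1, (min_le_right _ _).trans hv'.2⟩
  have e₂ := e₁.setVar 6 m (by decide)
  have r₂ := r₁.setVar 6 m
  have hb₂ := e₂.bwt (i + 1) (by omega) i2
  have hbi₂ := e₂.bwt i (by omega) (by omega)
  have lf₂ : ∀ c : ℤ, 1 ≤ c → c ≤ σ → (s₁.setVar 6 m).arr 8 c = base c + rowCount b (i + 1) c := lf₁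
  have i₂ : (s₁.setVar 6 m).var 2 = ((i + 1 : ℕ) : ℤ) := by simpa using i₁
  have m₂ : (s₁.setVar 6 m).var 6 = m := by simp
  generalize s₁.setVar 6 m = s₂ at *
  have z3' := e₂.size_bwt
  have hbb := e.letter i (by omega) (by omega)
  have hsub : (((i + 1 : ℕ) : ℤ) - 1) = i := by omega
  rw [whenever, Ter_ite, Ter_skip]
  refine ⟨?_, fun hne => ?_, fun heq => ?_⟩
  · simp only [Cond.ok, Expr.ok, Expr.val, i₂, hb₂, hsub, hbi₂]
    omega
  · simp only [Cond.holds, Expr.val, i₂, hb₂, hsub, hbi₂] at hne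
    obtain ⟨l, hl0, hl, hl'⟩ : ∃ l : ℤ, -1 ≤ l ∧ (∀ q, IsLast b i (b (i + 1)) q → l = L q (i + 1)) ∧
        ((R (b (i + 1))).len ≠ -1 → ∃ q, IsLast b i (b (i + 1)) q) := by
      have hex : (R (b (i + 1))).len ≠ -1 → ∃ q, IsLast b i (b (i + 1)) q := by
        intro hlen
        obtain ⟨cur, F, -, hw⟩ := hS.inv (b (i + 1)) (fun hf => hlen (hS.fresh _ hf).1)
        rcases hw with ⟨-, hq, -⟩ | ⟨heq, -⟩
        · exact ⟨cur, hq⟩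
        · exact absurd heq.symm hne
      by_cases hq : ∃ q, IsLast b i (b (i + 1)) q
      · obtain ⟨q, hq⟩ := hq
        exact ⟨L q (i + 1), by have := hL.nonneg q (i + 1); omega, fun q' hq' => by rw [hq.unique hq'], hex⟩
      · exact ⟨0, by omega, fun q hq' => absurd ⟨q, hq'⟩ hq, hex⟩
    rw [Ter_seq, Ter_assign]
    refine ⟨?_, ?_⟩
    · simp only [Expr.ok, Expr.val, i₂]
      omega
    simp only [Expr.val, xK, i₂, hsub]
    rw [Ter_seq]
    refine ((processCand_left (e₂.setVar 3 i (by decide)) (r₂.setVar 3 i) (i := i) (m := m)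
      (by simpa using i₂) i1 i2 (by simp) (by simpa using m₂) hmm.1 hmm.2).frame rfl).mono ?_
    rintro s₃ ⟨r₃, f₃⟩
    simp only [Nat.add_sub_cancel] at r₃
    have e₃ := (e₂.setVar 3 i (by decide)).frame f₃ (by decide) (by decide) (by decide) (by decide)
    have i₃ : s₃.var 2 = ((i + 1 : ℕ) : ℤ) := by
      rw [f₃.var _ (by decide)]
      simpa using i₂
    have lf₃ : ∀ c : ℤ, 1 ≤ c → c ≤ σ → s₃.arr 8 c = base c + rowCount b (i + 1) c := by
      rw [f₃.arr 8 (by decide)]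
      exact lf₂
    rw [Ter_seq, Ter_assign]
    refine ⟨?_, ?_⟩
    · simp only [Expr.ok, i₃]
      omega
    simp only [Expr.val, i₃]
    rw [Ter_seq]
    have hR' : (Function.update R (b i) (((R (b i)).eval m).offer (L i (i + 1)) i)) (b (i + 1)) =
        R (b (i + 1)) := Function.update_of_ne hne _ _
    refine ((processCand_right (e₃.setVar 3 _ (by decide)) (r₃.setVar 3 _) (i := i) (l := l)
      (by simpa using i₃) i2 i1 (by simp) hl0 ?_).frame rfl).mono ?_
    · rw [hR']
      intro hlen
      obtain ⟨q, hq⟩ := hl' hlen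
      obtain ⟨j, j1, j2, j3, j4⟩ := hLF q hq
      refine ⟨j, j1, j2, ?_, by rw [j4, hl q hq]⟩
      rw [Store.setVar_arr, lf₃ _ hb'.1 hb'.2]
      exact_mod_cast j3
    · rintro s₄ ⟨r₄, f₄⟩
      simp only [Nat.add_sub_cancel] at r₄
      have e₄ := (e₃.setVar 3 ((i + 1 : ℕ) : ℤ) (by decide)).frame f₄ (by decide) (by decide) (by decide)
        (by decide)
      have n₄ := e₄.n_eq
      rw [Ter_assign]
      refine ⟨?_, ?_⟩
      · simp only [infinity, Expr.ok, Expr.val, xN, n₄]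
        omega
      simp only [infinity, Expr.val, xN, n₄, xM]
      refine ⟨?_, ?_, ?_, _, _, r₄.setVar 6 _, ?_⟩
      · rw [Store.setVar_arr, f₄.arr 8 (by decide)]
        exact lf₃
      · simp only [Store.setVar_var, if_true]
        omega
      · simp only [Store.setVar_var, if_true]
        omega
      · simp only [Store.setVar_var, if_true]
        exact hS.succ_of_ne hL i1 i2 hne hl0 hl rfl rfl
  · simp only [Cond.holds, Expr.val, i₂, hb₂, hsub, hbi₂, not_not] at heq
    refine ⟨lf₂, by rw [m₂]; exact hmm.1, by rw [m₂]; omega, S, R, r₂, ?_⟩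
    rw [m₂]
    exact hS.succ_of_eq hL i1 i2 heq

theorem scan_run (e : Env W n σ b sa (fun k => L (k - 1) k) s) (hL : Rows n L)
    (hbase : ∀ c, base c ≤ n)
    (hLF : ∀ i q, 1 ≤ i → i < n → IsLast b i (b (i + 1)) q → ∃ j : ℕ, 2 ≤ j ∧ j ≤ n ∧
      base (b (i + 1)) + rowCount b (i + 1) (b (i + 1)) = j ∧ L (j - 1) j = L q (i + 1) + 1)
    (h : ScanInv n σ b L sa base 1 s) (hn : 1 ≤ n) :
    Run W (forUp xI (.lit 2) (.var xN) scanBody) s (400 * n) (fun s' => ScanInv n σ b L sa base n s' ∧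
      Frame (xI :: scanBody.wv) scanBody.wa s s') := by
  have hfit := e.fit
  have hcost : scanBody.maxCost ≤ 380 := by decide
  refine (Run.forUp 2 (n + 1) (fun v s' => ScanInv n σ b L sa base (v - 1) s') (by omega) (by push_cast; omega)
    rfl (by decide) ⟨by simp; omega, by simp⟩ ?_ ?_ ?_).mono ?_ ?_
  · intro v s' _ _ f _ _
    have := (e.frame f (by decide) (by decide) (by decide) (by decide)).n_eq
    simp [this]
    omega
  · obtain ⟨h1, h2, h3, S, R, h4, h5⟩ := h
    exact ⟨h1, by simpa using h2, by simpa using h3, S, R, h4.setVar _ _, by simpa using h5⟩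
  · intro v s' v1 v2 f hv hI
    obtain ⟨i, rfl⟩ : ∃ i, v = i + 1 := ⟨v - 1, by omega⟩
    refine (scanBody_ter (e.frame f (by decide) (by decide) (by decide) (by decide)) hL hbase
      (fun q => hLF i q (by omega) (by omega)) hI hv (by omega) (by omega)).mono ?_
    rintro s'' ⟨h1, h2, h3, S, R, h4, h5⟩
    exact ⟨h1, by simpa using h2, by simpa using h3, S, R, h4.setVar _ _, by simpa using h5⟩
  · simp only [Expr.cost]
    rw [show n + 1 - 2 = n - 1 by omega]
    obtain ⟨k, rfl⟩ : ∃ k, n = k + 1 := ⟨n - 1, by omega⟩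
    rw [Nat.add_sub_cancel]
    nlinarith
  · rintro s' ⟨h1, -, h2⟩
    exact ⟨h1, h2⟩

end


section

variable {W n σ : ℕ} {s : Store}

theorem initLen_run (hσ : s.var 1 = σ) (hz : σ < s.size 5) (hfit : σ + 10 ≤ W) :
    Run W (forUp xC (.lit 1) (.var xSigma) (put aLen (.var xC) (.lit (-1)))) s (30 * σ + 30) (fun s' =>
      (∀ c : ℤ, 1 ≤ c → c ≤ σ → s'.arr 5 c = -1) ∧ Frame [4] [5] s s') := by
  refine (Run.forUp 1 (σ + 1) (fun v s' => ∀ c : ℤ, 1 ≤ c → c < v → s'.arr 5 c = -1) (by omega)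
    (by push_cast; omega) rfl (by decide) ⟨by simp; omega, by simp⟩ ?_ ?_ ?_).mono ?_ ?_
  · intro v s' _ _ f _ _
    have := f.var 1 (by decide)
    simp [this, hσ]
    omega
  · intro c c1 c2
    push_cast at c2
    omega
  · intro v s' v1 v2 f hv hI
    replace hv : s'.var 4 = v := hv
    have hz' := f.size
    simp only [Ter_put]
    refine ⟨?_, ?_, ?_, ?_⟩
    · simp [hv]
      omega
    · simp
      omega
    · simp [hv, hz']
      omega
    · intro c c1 c2
      push_cast at c2
      by_cases hc : c = v
      · simp [hc, hv]
      · simp [hc, hv]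
        exact hI c c1 (by omega)
  · simp [Cmd.maxCost, Expr.cost]
    omega
  · rintro s' ⟨h1, -, f⟩
    refine ⟨fun c c1 c2 => h1 c c1 (by push_cast; omega), f.mono (by decide) (by decide)⟩

theorem countOcc_run {k : ℕ → ℕ} (hn : s.var 0 = n) (hT : ∀ x : ℕ, 1 ≤ x → x ≤ n → s.arr 0 x = k (x - 1))
    (hk : ∀ p < n, k p ≤ σ) (hz0 : n < s.size 0) (hz : σ < s.size 9) (h0 : s.arr 9 = fun _ => 0)
    (hfit : 10 * n + 20 ≤ W) (hσ : σ ≤ n) :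
    Run W (forUp xI (.lit 1) (.var xN) (incr aOcc (.get aT (.var xI)))) s (40 * n + 40) (fun s' =>
      (∀ c : ℕ, s'.arr 9 c = countEq k n c) ∧ Frame [2] [9] s s') := by
  refine (Run.forUp 1 (n + 1) (fun v s' => ∀ c : ℕ, s'.arr 9 c = countEq k (v - 1) c) (by omega)
    (by push_cast; omega) rfl (by decide) ⟨by simp; omega, by simp⟩ ?_ ?_ ?_).mono ?_ ?_
  · intro v s' _ _ f _ _
    have := f.var 0 (by decide)
    simp [this, hn]
    omega
  · intro c
    simp [h0, countEq_zero]
  · intro v s' v1 v2 f hv hI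
    obtain ⟨i, rfl⟩ : ∃ i, v = i + 1 := ⟨v - 1, by omega⟩
    replace hv : s'.var 2 = ((i + 1 : ℕ) : ℤ) := hv
    have hz' := f.size
    have ha : s'.arr 0 ((i + 1 : ℕ) : ℤ) = k i := by
      rw [f.arr 0 (by decide), hT (i + 1) (by omega) (by omega)]
      rfl
    have hki := hk i (by omega)
    have hc := hI (k i)
    have hle := countEq_le k i (k i)
    simp only [Nat.add_sub_cancel] at hI hc
    simp only [incr, Ter_put]
    refine ⟨?_, ?_, ?_, ?_⟩
    · simp only [Expr.ok, Expr.val, xI, aT, hv, ha, hz']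
      omega
    · simp only [Expr.ok, Expr.val, xI, aT, aOcc, hv, ha, hz', hc]
      omega
    · simp only [Expr.val, xI, aT, aOcc, hv, ha, hz']
      omega
    · intro c
      simp only [Expr.val, xI, aT, aOcc, hv, ha, hc, Store.setVar_arr, Store.setCell_arr, if_true,
        Nat.add_sub_cancel, countEq_succ, Nat.cast_inj]
      by_cases h : c = k i
      · simp [h]
      · simp [h, hI c]
  · simp [Cmd.maxCost, Expr.cost]
    omega
  · rintro s' ⟨h1, -, f⟩
    exact ⟨h1, f.mono (by decide) (by decide)⟩

theorem sumOcc_run {k : ℕ → ℕ} (hσ : s.var 1 = σ) (hk : ∀ p < n, 1 ≤ k p)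
    (hocc : ∀ c : ℕ, s.arr 9 c = countEq k n c) (hz8 : σ < s.size 8) (hz9 : σ < s.size 9)
    (h0 : s.arr 8 = fun _ => 0) (hfit : 10 * n + 20 ≤ W) (hσn : σ ≤ n) (h1σ : 1 ≤ σ) :
    Run W (forUp xC (.lit 2) (.var xSigma) (put aLF (.var xC) (.add (.get aLF (.sub (.var xC) (.lit 1)))
      (.get aOcc (.sub (.var xC) (.lit 1)))))) s (50 * σ + 50) (fun s' =>
      (∀ c : ℕ, 1 ≤ c → c ≤ σ → s'.arr 8 c = countLt k n c) ∧ Frame [4] [8] s s') := by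
  have hone : countLt k n 1 = 0 := by
    rw [countLt, Finset.card_eq_zero, Finset.filter_eq_empty_iff]
    intro p hp
    have := hk p (Finset.mem_range.1 hp)
    omega
  refine (Run.forUp 2 (σ + 1) (fun v s' => ∀ c : ℕ, 1 ≤ c → c < v → s'.arr 8 c = countLt k n c) (by omega)
    (by push_cast; omega) rfl (by decide) ⟨by simp; omega, by simp⟩ ?_ ?_ ?_).mono ?_ ?_
  · intro v s' _ _ f _ _
    have := f.var 1 (by decide)
    simp [this, hσ]
    omega
  · intro c c1 c2
    obtain rfl : c = 1 := by omega
    simp [h0, hone]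
  · intro v s' v1 v2 f hv hI
    obtain ⟨i, rfl⟩ : ∃ i, v = i + 1 := ⟨v - 1, by omega⟩
    replace hv : s'.var 4 = ((i + 1 : ℕ) : ℤ) := hv
    have hz' := f.size
    have ha : s'.arr 9 (i : ℤ) = countEq k n i := by rw [f.arr 9 (by decide), hocc]
    have hb := hI i (by omega) (by omega)
    have hle := countEq_le k n i
    have hle' := countLt_le k n i
    have hs : ((i + 1 : ℕ) : ℤ) - 1 = i := by omega
    simp only [Ter_put]
    refine ⟨?_, ?_, ?_, ?_⟩
    · simp only [Expr.ok, xC, hv]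
      omega
    · simp only [Expr.ok, Expr.val, xC, aLF, aOcc, hv, hs, ha, hb, hz']
      omega
    · simp only [Expr.val, xC, aLF, hv, hz']
      omega
    · intro c c1 c2
      simp only [Expr.val, xC, aLF, aOcc, hv, hs, ha, hb, Store.setVar_arr, Store.setCell_arr, if_true,
        Nat.cast_inj]
      by_cases h : c = i + 1
      · rw [if_pos h, h, countLt_succ]
        push_cast
        rfl
      · rw [if_neg h, hI c c1 (by omega)]
  · simp [Cmd.maxCost, Expr.cost]
    omega
  · rintro s' ⟨h1, -, f⟩
    exact ⟨fun c c1 c2 => h1 c c1 (by omega), f.mono (by decide) (by decide)⟩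

theorem flush_run {b : ℕ → ℤ} {sa : ℕ → ℕ} {lcp : ℕ → ℤ} {S : Set ℕ} {R : ℤ → Cell}
    (e : Env W n σ b sa lcp s) (h : Rep n σ sa s S R) (hσ : s.var 1 = σ) :
    Run W (forUp xC (.lit 1) (.var xSigma) (block [assign xL (.lit (-1)), evalCand])) s (60 * σ + 60)
      (fun s' => ∀ x : ℕ, 1 ≤ x → x ≤ n → (s'.arr 4 x = 1 ↔ ∃ y, (y ∈ S ∨ ∃ c ∈ {c : ℤ | 1 ≤ c ∧ c ≤ σ},
        (R c).act = true ∧ -1 < (R c).len ∧ y = (R c).pos) ∧ x = rowPos n sa y)) := by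
  have hfit := e.fit
  have hσn := e.le
  have hcost : (block [assign xL (.lit (-1)), evalCand]).maxCost ≤ 40 := by decide
  refine (Run.forUp 1 (σ + 1) (fun v s' => Rep n σ sa s' {y | y ∈ S ∨ ∃ c ∈ {c : ℤ | 1 ≤ c ∧ c < v},
      (R c).act = true ∧ -1 < (R c).len ∧ y = (R c).pos}
      (fun c => if c < v then (R c).eval (-1) else R c)) (by omega)
    (by push_cast; omega) rfl (by decide) ⟨by simp; omega, by simp⟩ ?_ ?_ ?_).mono ?_ ?_
  · intro v s' _ _ f _ _
    have := f.var 1 (by decide)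
    simp [this, hσ]
    omega
  · have h1 : {y | y ∈ S ∨ ∃ c ∈ {c : ℤ | 1 ≤ c ∧ c < ((1 : ℕ) : ℤ)}, (R c).act = true ∧ -1 < (R c).len ∧
        y = (R c).pos} = S := by
      ext y
      simp only [Set.mem_ofPred_eq, or_iff_left_iff_imp]
      rintro ⟨c, hc, -⟩
      push_cast at hc
      omega
    rw [h1]
    obtain ⟨a1, a2, a3, a4, a5, a6⟩ := h.setVar xC ((1 : ℕ) : ℤ)
    refine ⟨fun c c1 c2 => ?_, fun c c1 c2 => ?_, fun c c1 c2 => ?_, fun c c1 c2 => ?_, fun c c1 c2 => ?_,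
      a6⟩
    all_goals
      have hc : ¬ c < ((1 : ℕ) : ℤ) := by
        push_cast
        omega
      simp only [if_neg hc]
    · exact a1 c c1 c2
    · exact a2 c c1 c2
    · exact a3 c c1 c2
    · exact a4 c c1 c2
    · exact a5 c c1 c2
  · intro v s' v1 v2 f hv hI
    have e' := e.frame f (by decide) (by decide) (by decide) (by decide)
    simp only [block]
    rw [Ter_seq, Ter_assign]
    refine ⟨by simp; omega, ?_⟩
    refine (evalCand_ter (c := v) (l := -1) (e'.setVar 5 _ (by decide)) (hI.setVar 5 _) (by simpa using hv)
      (by omega) (by omega) (by simp) le_rfl (by omega)).mono ?_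
    intro s'' h''
    simp only [lt_irrefl, if_false] at h''
    have hS : (R v).evalSet (-1) {y | y ∈ S ∨ ∃ c ∈ {c : ℤ | 1 ≤ c ∧ c < v},
        (R c).act = true ∧ -1 < (R c).len ∧ y = (R c).pos} = {y | y ∈ S ∨
          ∃ c ∈ {c : ℤ | 1 ≤ c ∧ c < ((v + 1 : ℕ) : ℤ)}, (R c).act = true ∧ -1 < (R c).len ∧ y = (R c).pos} := by
      ext y
      simp only [Cell.evalSet, Set.mem_ofPred_eq]
      constructor
      · rintro ((hy | ⟨c, hc, hy⟩) | ⟨h1, h2, h3⟩)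
        · exact Or.inl hy
        · exact Or.inr ⟨c, by push_cast; omega, hy⟩
        · exact Or.inr ⟨v, by push_cast; omega, h2, h1, h3⟩
      · rintro (hy | ⟨c, hc, h1, h2, h3⟩)
        · exact Or.inl (Or.inl hy)
        · by_cases hcv : c = v
          · subst hcv
            exact Or.inr ⟨h2, h1, h3⟩
          · push_cast at hc
            exact Or.inl (Or.inr ⟨c, by omega, h1, h2, h3⟩)
    have hR : Function.update (fun c : ℤ => if c < v then (R c).eval (-1) else R c) (v : ℤ)
        ((R v).eval (-1)) = fun c => if c < ((v + 1 : ℕ) : ℤ) then (R c).eval (-1) else R c := by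
      funext c
      by_cases hcv : c = v
      · subst hcv
        rw [Function.update_self, if_pos (by push_cast; omega)]
      · rw [Function.update_of_ne hcv]
        by_cases hlt : c < v
        · rw [if_pos hlt, if_pos (by push_cast; omega)]
        · rw [if_neg hlt, if_neg (by push_cast; omega)]
    rw [hS, hR] at h''
    exact h''.setVar _ _
  · simp only [Expr.cost]
    rw [Nat.add_sub_cancel]
    nlinarith
  · rintro s' ⟨h1, -, f⟩ x x1 x2
    rw [h1.set x x1 x2]
    simp only [Set.mem_ofPred_eq, Nat.cast_add, Nat.cast_one, Int.lt_add_one_iff]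

end

theorem Store.newArray_arr_of_ne (s : Store) {a b : ℕ} (k : ℕ) (h : b ≠ a) :
    (s.newArray a k).arr b = s.arr b := by
  funext j
  simp [h]

theorem Store.newArray_arr_self (s : Store) (a k : ℕ) : (s.newArray a k).arr a = fun _ => 0 := by
  funext j
  simp

theorem rowLcp_pred {A : Type*} [DecidableEq A] (R : List A) (sa : ℕ → ℕ) (k : ℕ) : rowLcp R sa (k - 1) k = lcpArray R sa k := by
  rw [rowLcp, lcpArray, lcpLen_comm]

section

variable {A : Type*} [Fintype A] [LinearOrder A] {T : List A} {sa : ℕ → ℕ}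

theorem smaller_eq_countLt (T : List A) (c : ℕ) : smaller T c = countLt (letters T) T.length c := by
  unfold smaller countLt
  congr 1
  refine Finset.filter_congr fun p _ => ?_
  rw [← letters_cast, Nat.cast_lt]

theorem smaller_le (T : List A) (c : ℤ) : smaller T c ≤ T.length :=
  (Finset.card_filter_le _ _).trans (by simp)

theorem rowLetter_mem (hT : IsText T) (h : IsSuffixArray (revText T) sa) {k : ℕ} (h1 : 1 ≤ k)
    (h2 : k ≤ T.length) :
    1 ≤ rowLetter (revText T) sa k ∧ rowLetter (revText T) sa k ≤ Fintype.card A := by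
  have a := rowPos_mem hT h h1 h2
  rw [rowLetter, bwtArray_rowPos hT h h1 h2,
    List.getElem?_eq_getElem (show rowPos T.length sa k - 1 < T.length by omega), code_some]
  exact ⟨rank_pos _, rank_le _⟩

end


section

variable {A : Type*} [Fintype A] [LinearOrder A] {T : List A}

theorem outputSet_isSmallestSuffixient (hT : IsText T) {sa : ℕ → ℕ}
    (h : IsSuffixArray (revText T) sa) {S : Set ℕ} {R : ℤ → Cell} {m : ℤ} {s : Store}
    (hS : Stage T.length (rowLetter (revText T) sa) (rowLcp (revText T) sa) T.length S R m)
    (hs : ∀ x : ℕ, 1 ≤ x → x ≤ T.length → (s.arr 4 x = 1 ↔ ∃ y, (y ∈ S ∨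
      ∃ c ∈ {c : ℤ | 1 ≤ c ∧ c ≤ Fintype.card A}, (R c).act = true ∧ -1 < (R c).len ∧ y = (R c).pos) ∧
        x = rowPos T.length sa y)) :
    IsSmallestSuffixient T (outputSet T.length s) := by
  have hn := hT.length_revText
  have h2 := hT.two_le
  have hopt := hS.optimal (hn ▸ h.rows) ?_ (C := {c : ℤ | 1 ≤ c ∧ c ≤ Fintype.card A})
    (fun k k1 k2 => rowLetter_mem hT h k1 k2)
  · refine hopt.isSmallestSuffixient hT h fun x => ?_
    simp only [outputSet, Finset.mem_filter, Finset.mem_Icc]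
    constructor
    · rintro ⟨⟨x1, x2⟩, hx⟩
      exact (hs x x1 x2).1 hx
    · rintro ⟨k, hk, rfl⟩
      have := hopt.mem k hk
      have hp := rowPos_mem hT h this.1 this.2
      exact ⟨hp, (hs _ hp.1 hp.2).2 ⟨k, hk, rfl⟩⟩
  · obtain ⟨k, k1, k2, k3⟩ := h.exists_row (le_refl 1) (by omega)
    obtain ⟨k', k1', k2', k3'⟩ := h.exists_row (show 1 ≤ 2 by omega) (by omega)
    exact ⟨k, k', k1, by omega, k1', by omega, rowLetter_ne_of_sa_eq_one hT h k3 k1' (by omega) (by omega)⟩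

/-- The algorithm without the preprocessing. -/
def scanProgram : Cmd := block [
  alloc aS (.add (.var xN) (.lit 1)),
  alloc aLen (.add (.var xSigma) (.lit 1)),
  alloc aPos (.add (.var xSigma) (.lit 1)),
  alloc aAct (.add (.var xSigma) (.lit 1)),
  forUp xC (.lit 1) (.var xSigma) (put aLen (.var xC) (.lit (-1))),
  alloc aLF (.add (.var xSigma) (.lit 1)),
  alloc aOcc (.add (.var xSigma) (.lit 1)),
  assign xM infinity,
  forUp xI (.lit 1) (.var xN) (incr aOcc (.get aT (.var xI))),
  forUp xC (.lit 2) (.var xSigma)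
    (put aLF (.var xC) (.add (.get aLF (.sub (.var xC) (.lit 1)))
      (.get aOcc (.sub (.var xC) (.lit 1))))),
  incr aLF (.get aBWT (.lit 1)),
  forUp xI (.lit 2) (.var xN) scanBody,
  forUp xC (.lit 1) (.var xSigma) (block [assign xL (.lit (-1)), evalCand])]

theorem Exec.alloc_val {W : ℕ} {s : Store} (a : ℕ) (e : Expr) {k : ℕ} (h : e.ok W s) (hk : e.val s = k) :
    Exec W (.alloc a e) s (e.cost + k + 1) (s.newArray a k) :=
  .alloc s a e k (e.eval_eq_some_iff.2 ⟨h, hk.symm⟩)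

theorem scanProgram_run {W : ℕ} (hT : IsText T) (hA : Fintype.card A ≤ T.length) {s : Store}
    (hs : HoldsArrays T s) (hW : 10 * T.length + 20 ≤ W) :
    ∃ t s', Exec W scanProgram s t s' ∧ t ≤ 2000 * T.length ∧ s'.used ≤ s.used + 20 * T.length ∧
      IsSmallestSuffixient T (outputSet T.length s') := by
  obtain ⟨hn, hσ, ⟨zT, hText⟩, sa, hsa, ⟨zSA, hSA⟩, ⟨zLCP, hLCP⟩, ⟨zBWT, hBWT⟩⟩ := hs
  simp only [xN, xSigma, aT, aSA, aLCP, aBWT] at hn hσ zT hText zSA hSA zLCP hLCP zBWT hBWT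
  have h2 := hT.two_le
  have hrn := hT.length_revText
  have hrows := hrn ▸ hsa.rows
  have hcard : 1 ≤ Fintype.card A := by
    have := rowLetter_mem hT hsa (le_refl 1) (by omega)
    omega
  set n := T.length with hn_def
  set σ := Fintype.card A with hσ_def
  set b := rowLetter (revText T) sa with hb
  set L := rowLcp (revText T) sa with hL
  have x₁ : Exec W (alloc aS (.add (.var xN) (.lit 1))) s _ (s.newArray 4 (n + 1)) :=
    .alloc_val aS _ (by simp [hn]; omega) (by simp [hn])
  have x₂ : Exec W (alloc aLen (.add (.var xSigma) (.lit 1))) (s.newArray 4 (n + 1)) _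
      ((s.newArray 4 (n + 1)).newArray 5 (σ + 1)) :=
    .alloc_val aLen _ (by simp [hσ]; omega) (by simp [hσ])
  have x₃ : Exec W (alloc aPos (.add (.var xSigma) (.lit 1))) ((s.newArray 4 (n + 1)).newArray 5 (σ + 1)) _
      (((s.newArray 4 (n + 1)).newArray 5 (σ + 1)).newArray 6 (σ + 1)) :=
    .alloc_val aPos _ (by simp [hσ]; omega) (by simp [hσ])
  have x₄ : Exec W (alloc aAct (.add (.var xSigma) (.lit 1)))
      (((s.newArray 4 (n + 1)).newArray 5 (σ + 1)).newArray 6 (σ + 1)) _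
      ((((s.newArray 4 (n + 1)).newArray 5 (σ + 1)).newArray 6 (σ + 1)).newArray 7 (σ + 1)) :=
    .alloc_val aAct _ (by simp [hσ]; omega) (by simp [hσ])
  set s₄ := (((s.newArray 4 (n + 1)).newArray 5 (σ + 1)).newArray 6 (σ + 1)).newArray 7 (σ + 1) with hs₄
  obtain ⟨t₅, s₅, x₅, b₅, l₅, f₅⟩ := initLen_run (W := W) (s := s₄) (σ := σ) hσ (by simp [hs₄]) (by omega)
  have v₅ : s₅.var 0 = n ∧ s₅.var 1 = σ :=
    ⟨(f₅.var _ (by decide)).trans hn, (f₅.var _ (by decide)).trans hσ⟩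
  have x₆ : Exec W (alloc aLF (.add (.var xSigma) (.lit 1))) s₅ _ (s₅.newArray 8 (σ + 1)) :=
    .alloc_val aLF _ (by simp [v₅.2]; omega) (by simp [v₅.2])
  have x₇ : Exec W (alloc aOcc (.add (.var xSigma) (.lit 1))) (s₅.newArray 8 (σ + 1)) _
      ((s₅.newArray 8 (σ + 1)).newArray 9 (σ + 1)) :=
    .alloc_val aOcc _ (by simp [v₅.2]; omega) (by simp [v₅.2])
  have x₈ : Exec W (assign xM infinity) ((s₅.newArray 8 (σ + 1)).newArray 9 (σ + 1)) _
      (((s₅.newArray 8 (σ + 1)).newArray 9 (σ + 1)).setVar 6 (n + 1)) :=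
    .assign_val xM infinity (by simp [infinity, v₅.1]; omega) (by simp [infinity, v₅.1])
  set s₈ := ((s₅.newArray 8 (σ + 1)).newArray 9 (σ + 1)).setVar 6 (n + 1) with hs₈
  have v₈ : s₈.var 0 = n ∧ s₈.var 1 = σ ∧ s₈.var 6 = n + 1 := by simp [hs₈, v₅]
  have keep : ∀ a, a ≤ 3 → s₈.arr a = s.arr a ∧ s₈.size a = s.size a := by
    intro a ha
    constructor
    · rw [hs₈, Store.setVar_arr, Store.newArray_arr_of_ne _ _ (by omega), Store.newArray_arr_of_ne _ _ (by omega),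
        f₅.arr _ (by simp; omega), hs₄, Store.newArray_arr_of_ne _ _ (by omega),
        Store.newArray_arr_of_ne _ _ (by omega), Store.newArray_arr_of_ne _ _ (by omega),
        Store.newArray_arr_of_ne _ _ (by omega)]
    · rw [hs₈, Store.setVar_size, Store.newArray_size, if_neg (by omega), Store.newArray_size,
        if_neg (by omega), f₅.size, hs₄, Store.newArray_size, if_neg (by omega), Store.newArray_size,
        if_neg (by omega), Store.newArray_size, if_neg (by omega), Store.newArray_size, if_neg (by omega)]
  have z₈ : s₈.size 4 = n + 1 ∧ s₈.size 5 = σ + 1 ∧ s₈.size 6 = σ + 1 ∧ s₈.size 7 = σ + 1 ∧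
      s₈.size 8 = σ + 1 ∧ s₈.size 9 = σ + 1 := by
    simp [hs₈, f₅.size, hs₄]
  have a₈ : s₈.arr 8 = (fun _ => 0) ∧ s₈.arr 9 = (fun _ => 0) := by
    refine ⟨?_, ?_⟩
    · rw [hs₈, Store.setVar_arr, Store.newArray_arr_of_ne _ _ (by omega), Store.newArray_arr_self]
    · rw [hs₈, Store.setVar_arr, Store.newArray_arr_self]
  have r₈ : Rep n σ sa s₈ ∅ (fun _ => ⟨-1, 0, false⟩) := by
    refine ⟨fun c c1 c2 => ?_, fun c c1 c2 => ?_, by simp, by simp, fun c c1 c2 => ?_, fun x x1 x2 => ?_⟩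
    · simpa [hs₈] using l₅ c c1 c2
    · simp only
      omega
    · simp [hs₈, f₅.arr 7 (by decide), hs₄]
    · simp [hs₈, f₅.arr 4 (by decide), hs₄]
  have u₈ : s₈.used = s.used + (n + 1) + 5 * (σ + 1) := by
    simp only [hs₈, Store.setVar_used, Store.newArray_used, f₅.used, hs₄]
    ring
  clear_value s₈
  obtain ⟨t₉, s₉, x₉, b₉, o₉, f₉⟩ := countOcc_run (W := W) (s := s₈) (n := n) (σ := σ) (k := letters T) v₈.1
    (fun x x1 x2 => by
      rw [(keep 0 (by omega)).1, hText x x1 x2, letters_cast, charAt, if_neg (by omega)])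
    (fun p _ => letters_le T p) (by rw [(keep 0 (by omega)).2]; exact zT) (by omega) a₈.2 hW hA
  obtain ⟨t₁₀, s₁₀, x₁₀, b₁₀, o₁₀, f₁₀⟩ := sumOcc_run (W := W) (s := s₉) (n := n) (σ := σ) (k := letters T)
    ((f₉.var _ (by decide)).trans v₈.2.1) (fun p hp => (letters_isStr T).pos p hp) o₉
    (by rw [f₉.size]; omega) (by rw [f₉.size]; omega) (by rw [f₉.arr _ (by decide)]; exact a₈.1) hW hA hcard
  have f' : Frame [2, 4] [8, 9] s₈ s₁₀ := (f₉.mono (by decide) (by decide)).trans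
    (f₁₀.mono (by decide) (by decide))
  have e₁₀ : Env W n σ b sa (fun k => L (k - 1) k) s₁₀ := by
    have hz := f'.size
    refine ⟨(f'.var _ (by decide)).trans v₈.1, fun k k1 k2 => ?_, fun k k1 k2 => rowLetter_mem hT hsa k1 k2,
      fun k k1 k2 => ?_, fun k k1 k2 => hrn ▸ hsa.mem k1 (by omega), fun k k1 k2 => ?_, fun k k1 k2 => ?_,
      ?_, ?_, ?_, ?_, ?_, ?_, ?_, ?_, hA, hW⟩
    · rw [f'.arr 3 (by decide), (keep 3 (by omega)).1, hBWT k k1 k2, hb, rowLetter]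
    · rw [f'.arr 1 (by decide), (keep 1 (by omega)).1, hSA k k1 k2]
    · rw [f'.arr 2 (by decide), (keep 2 (by omega)).1, hLCP k k1 k2, hL, rowLcp_pred]
    · exact ⟨hrows.nonneg _ _, hrows.le _ _⟩
    · rw [hz, (keep 1 (by omega)).2]
      exact zSA
    · rw [hz, (keep 2 (by omega)).2]
      exact zLCP
    · rw [hz, (keep 3 (by omega)).2]
      exact zBWT
    all_goals
      rw [hz]
      omega
  have hb1 := e₁₀.letter 1 le_rfl (by omega)
  have hbw : s₁₀.arr 3 1 = b 1 := e₁₀.bwt 1 le_rfl (by omega)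
  have z3 := e₁₀.size_bwt
  have z8 := e₁₀.size_lf
  have lf₁₀ : ∀ c : ℤ, 1 ≤ c → c ≤ σ → s₁₀.arr 8 c = smaller T c := by
    intro c c1 c2
    obtain ⟨d, rfl⟩ := Int.eq_ofNat_of_zero_le (show 0 ≤ c by omega)
    rw [o₁₀ d (by omega) (by omega), smaller_eq_countLt]
  have hsm := smaller_le T (b 1)
  obtain ⟨t₁₁, s₁₁, x₁₁, b₁₁, hs₁₁⟩ := Ter.run (W := W) (s := s₁₀) (c := incr aLF (.get aBWT (.lit 1)))
    (Q := fun s' => s' = s₁₀.setCell 8 (b 1) (smaller T (b 1) + 1)) (by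
      simp only [incr, Ter_put]
      refine ⟨?_, ?_, ?_, ?_⟩
      · simp only [Expr.ok, Expr.val, aBWT, hbw]
        omega
      · simp only [Expr.ok, Expr.val, aBWT, aLF, hbw, lf₁₀ _ hb1.1 hb1.2]
        omega
      · simp only [Expr.val, aBWT, aLF, hbw]
        omega
      · simp only [Expr.val, aBWT, aLF, hbw, lf₁₀ _ hb1.1 hb1.2]) rfl
  have f₁₁ := x₁₁.frame rfl
  have f'' : Frame [2, 4] [8, 9] s₈ s₁₁ := f'.trans (f₁₁.mono (by decide) (by decide))
  have e₁₁ := e₁₀.frame f₁₁ (by decide) (by decide) (by decide) (by decide)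
  have m₁₁ : s₁₁.var 6 = n + 1 := (f''.var _ (by decide)).trans v₈.2.2
  have i₁₁ : ScanInv n σ b L sa (smaller T) 1 s₁₁ := by
    refine ⟨fun c c1 c2 => ?_, by omega, by omega, ∅, _, r₈.congr (f''.arr _ (by decide))
      (f''.arr _ (by decide)) (f''.arr _ (by decide)) (f''.arr _ (by decide)), ?_⟩
    · rw [hs₁₁, Store.setCell_arr, if_pos rfl, rowCount_succ b 0 c]
      have h0 : rowCount b 0 c = 0 := by simp [rowCount]
      by_cases hc : c = b 1
      · rw [if_pos hc, if_pos hc.symm, h0, hc]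
        simp
      · rw [if_neg hc, if_neg (Ne.symm hc), h0, lf₁₀ c c1 c2]
        simp
    · rw [m₁₁]
      exact Stage.init hrows
  obtain ⟨t₁₂, s₁₂, x₁₂, b₁₂, i₁₂, f₁₂⟩ := scan_run e₁₁ hrows (smaller_le T) (fun i q i1 i2 hq => by
    obtain ⟨j1, j2, j3⟩ := lf_lcp hT hsa i2 hq rfl
    exact ⟨_, j1, j2, rfl, by rw [hL, rowLcp_pred, j3]⟩) i₁₁ (by omega)
  obtain ⟨-, -, -, S, R, r₁₂, hS⟩ := i₁₂
  have e₁₂ := e₁₁.frame f₁₂ (by decide) (by decide) (by decide) (by decide)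
  obtain ⟨t₁₃, s₁₃, x₁₃, b₁₃, hout⟩ := flush_run e₁₂ r₁₂
    ((f₁₂.var _ (by decide)).trans ((f''.var _ (by decide)).trans v₈.2.1))
  have f₁₃ := x₁₃.frame rfl
  refine ⟨_, s₁₃, .seq _ _ _ _ _ _ _ x₁ <| .seq _ _ _ _ _ _ _ x₂ <| .seq _ _ _ _ _ _ _ x₃ <|
    .seq _ _ _ _ _ _ _ x₄ <| .seq _ _ _ _ _ _ _ x₅ <| .seq _ _ _ _ _ _ _ x₆ <| .seq _ _ _ _ _ _ _ x₇ <|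
    .seq _ _ _ _ _ _ _ x₈ <| .seq _ _ _ _ _ _ _ x₉ <| .seq _ _ _ _ _ _ _ x₁₀ <| .seq _ _ _ _ _ _ _ x₁₁ <|
    .seq _ _ _ _ _ _ _ x₁₂ x₁₃, ?_, ?_, outputSet_isSmallestSuffixient hT hsa hS hout⟩
  · simp only [Expr.cost, infinity, incr, Cmd.maxCost] at b₁₁ ⊢
    omega
  · rw [f₁₃.used, f₁₂.used, f''.used, u₈]
    omega

end

theorem linearTimeAlgorithm_spec {prep : Cmd} (h : BuildsArrays.{u} prep) :
    ∃ C : ℕ, ∀ (A : Type u) [Fintype A] [LinearOrder A] (T : List A), IsText T →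
      Fintype.card A ≤ T.length → RunsLinearly C (linearTimeAlgorithm prep) T (fun s =>
        IsSmallestSuffixient T (outputSet T.length s)) := by
  obtain ⟨C, hC⟩ := h
  refine ⟨C + 2000, fun A _ _ T hT hA => ?_⟩
  obtain ⟨t, s, x, ht, hu, hs⟩ := hC A T hT hA
  have h2 := hT.two_le
  have hpow := mul_le_pow h2 (show 8 ≤ C + 2000 by omega)
  obtain ⟨t', s', x', ht', hu', hS⟩ := scanProgram_run (W := T.length ^ (C + 2000)) hT hA hs (by omega)
  refine ⟨t + t', s', .seq _ _ _ _ _ _ _ (x.mono (Nat.pow_le_pow_right (by omega) (by omega))) x', ?_, ?_, hS⟩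
  · rw [add_mul]
    omega
  · rw [add_mul]
    omega

end Suffixient

theorem mainTheorem9 :
    (∃ prep : Suffixient.Cmd, Suffixient.BuildsArrays.{u} prep) ∧
    ∀ prep : Suffixient.Cmd, Suffixient.BuildsArrays.{u} prep →
      ∃ C : ℕ, ∀ (A : Type u) [Fintype A] [LinearOrder A] (T : List A),
        Suffixient.IsText T → Fintype.card A ≤ T.length →
        Suffixient.RunsLinearly C (Suffixient.linearTimeAlgorithm prep) T (fun s =>
          Suffixient.IsSmallestSuffixient T (Suffixient.outputSet T.length s)) := by
  exact ⟨⟨Suffixient.buildArrays, Suffixient.buildArrays_spec⟩,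
    fun _ h => Suffixient.linearTimeAlgorithm_spec h⟩
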